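/- Use the max norm on $\mathbb R^2$, and let $Q=[0,1]^2$. Fix constants $0<\alpha<1$ and $K_0>1$. **Model.** Let $\{E_i\}_{i\in I}$ be a countable collection of full height curvilinear rectangles in $Q$: $E_i=\{(x,y): 0\le y\le 1,\ l_i(y)\le x\le r_i(y)\}$ with $0\le l_i<r_i\le 1$ of class $C^1$ and $|l_i'|,|r_i'|\le\alpha$. Let $f_i$ be a $C^2$ diffeomorphism between open subsets of $\mathbb R^2$, with domain containing $E_i$, which maps $E_i$ onto a full width strip $S_i=f_i(E_i)=\{(x,y): 0\le x\le 1,\ b_i(x)\le y\le t_i(x)\}$, with $0\le b_i<t_i\le 1$ of class $C^1$ and $|b_i'|,|t_i'|\le\alpha$. Write $F=(F_1,F_2)=f_i$ on $E_i$. For $z\in Q$ let $\delta_z(E_i)$ be the diameter of the section of $E_i$ by the horizontal line through $z$, and let $\delta_{i,\max},\delta_{i,\min}$ be its maximum and minimum over $z\in Q$. Let $J_F=|F_{1x}F_{2y}-F_{1y}F_{2x}|$. Assume: * (G1) $\operatorname{int}E_i\cap \operatorname{int}E_j=\emptyset$ and $\operatorname{int}S_i\cap \operatorname{int}S_j=\emptyset$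 for $i\ne j$. * (G2) $Q\setminus\bigcup_i\operatorname{int}E_i$ has Lebesgue measure $0$. * (G3) $-\sum_i\delta_{i,\max}\log\delta_{i,\min}<\infty$. * On every $E_i$: (H1) $|F_{2x}|+\alpha|F_{2y}|+\alpha^2|F_{1y}|\le\alpha|F_{1x}|$; (H2) $|F_{1x}|-\alpha|F_{1y}|\ge K_0$; (H3) $|F_{1y}|+\alpha|F_{2y}|+\alpha^2|F_{2x}|\le\alpha|F_{1x}|$; (H4) $|F_{1x}|-\alpha|F_{2x}|\ge J_FK_0$. * (H5) $\frac1{K_0^2}+\alpha^2<1$. * (D2) There is $C_0$ with $|D^2f_i(z)|/|\partial_xf_i(z)|<C_0$ for all $i$ and $z\in E_i$, where $|D^2f_i|$ is the maximum of the absolute values of all second partial derivatives of both components of $f_i$. **Coding.** Put $E_{i_0\dots i_{n-1}}=E_{i_0}\cap f_{i_0}^{-1}E_{i_1\dots i_{n-1}}$ and $S_{i_{-m}\dots i_{-1}}=f_{i_{-1}}(S_{i_{-m}\dots i_{-2}}\cap E_{i_{-1}})$. For a past $(i_{-k})_{k\ge1}$ the unstable manifold is $W^u=\bigcap_mS_{i_{-m}\dots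 i_{-1}}$; for a future $(i_k)_{k\ge0}$ the stable manifold is $W^s=\bigcap_nE_{i_0\dots i_{n-1}}$. A two-sided sequence $\omega\in I^{\mathbb Z}$ codes the point $z=z(\omega)$ at which the unstable manifold of its past meets the stable manifold of its future; points of the attractor are identified with two-sided sequences, and $F$ with the shift $\sigma$. Let $D^uF(\omega)$ be the norm of the restriction of $Df_{i_0}(z)$ to the tangent line at $z$ of the unstable manifold of $\omega$, and let $\phi(\omega)=-\log D^uF(\omega)$. **Potential.** Fix an unstable manifold $W^u_0$, i.e. a past $p$. For $\omega\in I^{\mathbb Z}$ let $\omega_0$ be the sequence with past $p$ and the same future as $\omega$ (it codes the point $z_0=W^s(z)\cap W_0^u$), and put $$u(\omega)=\sum_{k\ge0}\bigl(\phi(\sigma^k\omega)-\phi(\sigma^k\omega_0)\bigr),\qquad \psi=\phi-u+u\circ\sigma .$$ **Proposition 7.1.** For every choice of $W_0^u$ the following hold. 1. For each $\omega$ the unstable and the stable manifold given by its past and its future meet in exactly one point. Each unstable manifold is the graph over $[0,1]$ of a $C^1$ function $y(x)$. The series defining $u$ converges (absolutely) for every $\omega$. The function $\psi$ depends only on the future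 of $\omega$, so it defines a function $\phi^u$ on the space $\Omega_+=I^{\mathbb N}$ of one-sided sequences $(i_0i_1i_2\dots)$. 2. The Gurevich topological pressure of $\phi^u$ is zero, $P(\phi^u)=0$: for every symbol $a\in I$, $$\lim_{n\to\infty}\frac1n\log Z_n(\phi^u,a)=0,\qquad Z_n(\phi^u,a)=\sum_{T^nx=x,\;x_0=a}\exp\Bigl(\sum_{k=0}^{n-1}\phi^u(T^kx)\Bigr),$$ where $T$ is the shift on $\Omega_+$. -/

import Mathlib

open Set Filter Topology MeasureTheory
open scoped ENNReal

/-- The unit square; on `ℝ × ℝ` the norm and the distance are the max norm and max distance. -/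
def unitSquare : Set (ℝ × ℝ) := Icc 0 1 ×ˢ Icc 0 1

/-- The partial derivative `g_x` (as a vector of the two components). -/
noncomputable def partialX (g : ℝ × ℝ → ℝ × ℝ) (z : ℝ × ℝ) : ℝ × ℝ := fderiv ℝ g z (1, 0)

/-- The partial derivative `g_y` (as a vector of the two components). -/
noncomputable def partialY (g : ℝ × ℝ → ℝ × ℝ) (z : ℝ × ℝ) : ℝ × ℝ := fderiv ℝ g z (0, 1)

/-- The absolute value of the Jacobian determinant. -/
noncomputable def absJacobian (g : ℝ × ℝ → ℝ × ℝ) (z : ℝ × ℝ) : ℝ :=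
  |(partialX g z).1 * (partialY g z).2 - (partialY g z).1 * (partialX g z).2|

/-- The maximum of the absolute values of all second partial derivatives of both components
(the norm of a vector of `ℝ × ℝ` is the maximum over the two components). -/
noncomputable def maxSecondPartial (g : ℝ × ℝ → ℝ × ℝ) (z : ℝ × ℝ) : ℝ :=
  max ‖partialX (partialX g) z‖ (max ‖partialY (partialX g) z‖ ‖partialY (partialY g) z‖)

/-- A full height curvilinear rectangle of the unit square: the closed region between two disjoint
graphs `x = l y` and `x = r y`, `0 ≤ y ≤ 1`, of `C¹` functions with slopes at most `α`. -/
def IsFullHeight (α : ℝ) (E : Set (ℝ × ℝ)) : Prop :=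
  ∃ l r : ℝ → ℝ, ContDiffOn ℝ 1 l (Icc 0 1) ∧ ContDiffOn ℝ 1 r (Icc 0 1) ∧
    (∀ y ∈ Icc (0 : ℝ) 1, |derivWithin l (Icc 0 1) y| ≤ α ∧ |derivWithin r (Icc 0 1) y| ≤ α) ∧
    (∀ y ∈ Icc (0 : ℝ) 1, 0 ≤ l y ∧ l y < r y ∧ r y ≤ 1) ∧
    E = {z | z.2 ∈ Icc (0 : ℝ) 1 ∧ l z.2 ≤ z.1 ∧ z.1 ≤ r z.2}

/-- A full width strip of the unit square: the closed region between two disjoint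
graphs `y = b x` and `y = t x`, `0 ≤ x ≤ 1`, of `C¹` functions with slopes at most `α`. -/
def IsFullWidth (α : ℝ) (S : Set (ℝ × ℝ)) : Prop :=
  ∃ b t : ℝ → ℝ, ContDiffOn ℝ 1 b (Icc 0 1) ∧ ContDiffOn ℝ 1 t (Icc 0 1) ∧
    (∀ x ∈ Icc (0 : ℝ) 1, |derivWithin b (Icc 0 1) x| ≤ α ∧ |derivWithin t (Icc 0 1) x| ≤ α) ∧
    (∀ x ∈ Icc (0 : ℝ) 1, 0 ≤ b x ∧ b x < t x ∧ t x ≤ 1) ∧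
    S = {z | z.1 ∈ Icc (0 : ℝ) 1 ∧ b z.1 ≤ z.2 ∧ z.2 ≤ t z.1}

/-- The `z`-width of `E`: the diameter of the section of `E` by the horizontal line through `z`. -/
noncomputable def sectionWidth (E : Set (ℝ × ℝ)) (z : ℝ × ℝ) : ℝ :=
  Metric.diam ({w | w.2 = z.2} ∩ E)

/-- The maximal width of the horizontal sections of `E`. -/
noncomputable def maxWidth (E : Set (ℝ × ℝ)) : ℝ := sSup (sectionWidth E '' unitSquare)

/-- The minimal width of the horizontal sections of `E`. -/
noncomputable def minWidth (E : Set (ℝ × ℝ)) : ℝ := sInf (sectionWidth E '' unitSquare)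

/-- The data of the piecewise smooth map `F`: sets `E i`, and homeomorphisms `f i` between open
subsets of the plane, with `F = f i` on `E i`. -/
structure PiecewiseMap (ι : Type*) where
  E : ι → Set (ℝ × ℝ)
  f : ι → OpenPartialHomeomorph (ℝ × ℝ) (ℝ × ℝ)

/-! ### Sequences -/

/-- The shift on one-sided sequences. -/
def shiftOne {ι : Type*} (x : ℕ → ι) : ℕ → ι := fun n => x (n + 1)

/-- The shift on two-sided sequences. -/
def shiftTwo {ι : Type*} (ω : ℤ → ι) : ℤ → ι := fun n => ω (n + 1)

/-- The future `(i₀, i₁, …)` of a two-sided sequence. -/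
def future {ι : Type*} (ω : ℤ → ι) : ℕ → ι := fun k => ω (k : ℤ)

/-- The past `(i₋₁, i₋₂, …)` of a two-sided sequence, the most recent symbol first. -/
def past {ι : Type*} (ω : ℤ → ι) : ℕ → ι := fun k => ω (-((k : ℤ) + 1))

/-- The two-sided sequence with past `p` and future `x`. -/
def joinSeq {ι : Type*} (p x : ℕ → ι) : ℤ → ι
  | Int.ofNat k => x k
  | Int.negSucc k => p k

/-! ### Gurevich pressure on the full shift -/

/-- `Z_n(φ, a)`: the sum of `exp (φ x + φ (T x) + ⋯ + φ (T^(n-1) x))` over all sequences `x` with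
`T^n x = x` and `x₀ = a`, as an element of `[0, ∞]`. -/
noncomputable def partitionSum {ι : Type*} (φ : (ℕ → ι) → ℝ) (n : ℕ) (a : ι) : ℝ≥0∞ :=
  ∑' x : {x : ℕ → ι // shiftOne^[n] x = x ∧ x 0 = a},
    ENNReal.ofReal (Real.exp (∑ k ∈ Finset.range n, φ (shiftOne^[k] x.1)))

/-- The Gurevich pressure of `φ` exists and equals `P`: for every symbol `a`,
`(1/n) log Z_n(φ, a)` converges to `P` in `[-∞, ∞]`. -/
def HasGurevichPressure {ι : Type*} (φ : (ℕ → ι) → ℝ) (P : EReal) : Prop :=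
  ∀ a : ι, Tendsto (fun n : ℕ => ENNReal.log (partitionSum φ n a) / (n : EReal)) atTop (𝓝 P)

namespace PiecewiseMap

variable {ι : Type*}

/-! ### Hypotheses on the map -/

/-- The image strip `S i = f i (E i)`. -/
def S (M : PiecewiseMap ι) (i : ι) : Set (ℝ × ℝ) := M.f i '' M.E i

/-- Each `E i` is a full height curvilinear rectangle inside the domain of the `C²` diffeomorphism
`f i`, which maps it onto a full width strip. -/
structure IsModel (M : PiecewiseMap ι) (α : ℝ) : Prop where
  subset_source : ∀ i, M.E i ⊆ (M.f i).source
  contDiffOn : ∀ i, ContDiffOn ℝ 2 (M.f i) (M.f i).source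
  contDiffOn_symm : ∀ i, ContDiffOn ℝ 2 (M.f i).symm (M.f i).target
  fullHeight : ∀ i, IsFullHeight α (M.E i)
  fullWidth : ∀ i, IsFullWidth α (M.S i)

/-- The geometric conditions. -/
structure Geometric (M : PiecewiseMap ι) : Prop where
  disjoint_E : ∀ i j, i ≠ j → interior (M.E i) ∩ interior (M.E j) = ∅
  disjoint_S : ∀ i j, i ≠ j → interior (M.S i) ∩ interior (M.S j) = ∅
  full_measure : volume (unitSquare \ ⋃ i, interior (M.E i)) = 0
  summable_width : Summable fun i => -(maxWidth (M.E i) * Real.log (minWidth (M.E i)))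

/-- The hyperbolicity conditions. -/
structure Hyperbolic (M : PiecewiseMap ι) (α K₀ : ℝ) : Prop where
  h1 : ∀ i, ∀ z ∈ M.E i,
    |(partialX (M.f i) z).2| + α * |(partialY (M.f i) z).2| + α ^ 2 * |(partialY (M.f i) z).1|
      ≤ α * |(partialX (M.f i) z).1|
  h2 : ∀ i, ∀ z ∈ M.E i, K₀ ≤ |(partialX (M.f i) z).1| - α * |(partialY (M.f i) z).1|
  h3 : ∀ i, ∀ z ∈ M.E i,
    |(partialY (M.f i) z).1| + α * |(partialY (M.f i) z).2| + α ^ 2 * |(partialX (M.f i) z).2|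
      ≤ α * |(partialX (M.f i) z).1|
  h4 : ∀ i, ∀ z ∈ M.E i,
    absJacobian (M.f i) z * K₀ ≤ |(partialX (M.f i) z).1| - α * |(partialX (M.f i) z).2|
  h5 : 1 / K₀ ^ 2 + α ^ 2 < 1

/-- The distortion condition with constant `C₀`. -/
def Distortion (M : PiecewiseMap ι) (C₀ : ℝ) : Prop :=
  ∀ i, ∀ z ∈ M.E i, maxSecondPartial (M.f i) z / ‖partialX (M.f i) z‖ < C₀

/-! ### Stable and unstable manifolds and the coding of the attractor -/

/-- The rectangle `E_{x₀ ⋯ x_{n-1}}`, with `E_{i w} = E i ∩ (f i)⁻¹ E_w`. -/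
def cylE (M : PiecewiseMap ι) : ℕ → (ℕ → ι) → Set (ℝ × ℝ)
  | 0, _ => unitSquare
  | n + 1, x => M.E (x 0) ∩ M.f (x 0) ⁻¹' M.cylE n (shiftOne x)

/-- The strip `S_{p_{m-1} ⋯ p₁ p₀}`, with `S_{w i} = f i (S_w ∩ E i)`; the past `p` is listed
with the most recent symbol first. -/
def cylS (M : PiecewiseMap ι) : ℕ → (ℕ → ι) → Set (ℝ × ℝ)
  | 0, _ => unitSquare
  | m + 1, p => M.f (p 0) '' (M.cylS m (shiftOne p) ∩ M.E (p 0))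

/-- The stable manifold with future `x`. -/
def stableManifold (M : PiecewiseMap ι) (x : ℕ → ι) : Set (ℝ × ℝ) := ⋂ n, M.cylE n x

/-- The unstable manifold with past `p`. -/
def unstableManifold (M : PiecewiseMap ι) (p : ℕ → ι) : Set (ℝ × ℝ) := ⋂ m, M.cylS m p

/-- The point of the attractor coded by `ω`: the point where the unstable manifold given by the
past and the stable manifold given by the future meet. -/
noncomputable def point (M : PiecewiseMap ι) (ω : ℤ → ι) : ℝ × ℝ :=
  Classical.epsilon fun z => z ∈ M.unstableManifold (past ω) ∩ M.stableManifold (future ω)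

/-- The unstable manifold with past `p`, as the graph of a function of `x`. -/
noncomputable def unstableHeight (M : PiecewiseMap ι) (p : ℕ → ι) (x : ℝ) : ℝ :=
  sSup {y | (x, y) ∈ M.unstableManifold p}

/-- The slope of the unstable manifold at the point coded by `ω`. -/
noncomputable def unstableSlope (M : PiecewiseMap ι) (ω : ℤ → ι) : ℝ :=
  derivWithin (M.unstableHeight (past ω)) (Icc 0 1) (M.point ω).1

/-- `D^u F`: the norm of the derivative of `F` in the unstable direction, at the point coded
by `ω` (which lies in `E (ω 0)`). -/
noncomputable def unstableDeriv (M : PiecewiseMap ι) (ω : ℤ → ι) : ℝ :=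
  ‖fderiv ℝ (M.f (ω 0)) (M.point ω) (1, M.unstableSlope ω)‖ / ‖((1, M.unstableSlope ω) : ℝ × ℝ)‖

/-! ### The potentials -/

/-- `φ = -log D^u F` on two-sided sequences. -/
noncomputable def phi (M : PiecewiseMap ι) (ω : ℤ → ι) : ℝ := -Real.log (M.unstableDeriv ω)

/-- The `k`-th term `φ (F^k z) - φ (F^k z₀)` of the series defining `u`. Here `z₀` is the
intersection of the stable manifold of `z` with the fixed unstable manifold, the one with
past `p`. -/
noncomputable def transferTerm (M : PiecewiseMap ι) (p : ℕ → ι) (ω : ℤ → ι) (k : ℕ) : ℝ :=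
  M.phi (shiftTwo^[k] ω) - M.phi (shiftTwo^[k] (joinSeq p (future ω)))

/-- `u(z) = ∑ₖ (φ (F^k z) - φ (F^k z₀))`. -/
noncomputable def transfer (M : PiecewiseMap ι) (p : ℕ → ι) (ω : ℤ → ι) : ℝ :=
  ∑' k, M.transferTerm p ω k

/-- `ψ(z) = φ(z) - u(z) + u(F z)`. -/
noncomputable def psi (M : PiecewiseMap ι) (p : ℕ → ι) (ω : ℤ → ι) : ℝ :=
  M.phi ω - M.transfer p ω + M.transfer p (shiftTwo ω)

/-- `φᵘ` on one-sided sequences: the value of `ψ` at the two-sided sequences with future `x`.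
The theorem asserts that the value does not depend on the past; here the past `p` is used. -/
noncomputable def phiU (M : PiecewiseMap ι) (p : ℕ → ι) (x : ℕ → ι) : ℝ := M.psi p (joinSeq p x)

end PiecewiseMap

/-! The hypotheses (H1)-(H4) say that the derivative preserves the horizontal cone of slopes at most
`α` and expands it by `K₀`, and that the inverse does the same to the vertical cone. Inverting every
branch and swapping the axes gives a model of the same kind (`IsHyperbolicModel.dual`), so each fact
about the rectangles `cylE` is also one about the strips `cylS`. Cylinders of length `n` are strips
with `α`-Lipschitz sides and width at most `K₀⁻ⁿ` (`cylE_strip`, `cylE_width`). Their intersections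
are therefore Lipschitz graphs, and a stable and an unstable one cross exactly once because `α² < 1`
(`existsUnique_point`).

The derivative acts on slopes by a Möbius map, which (H4) and (H5) make a contraction of the cone.
By (D2) this map and the logarithm of the expansion rate are Lipschitz in the base point, uniformly
over all branches (`IsRegular`). Pulling chords of an unstable manifold back and pushing their
slopes forward shows that chords with a common end point have almost equal slopes. This gives the
`C¹` property and the invariance of tangent slopes (`chord_sub_le`, `height_slope_image`). Along two
orbits with the same future the points approach geometrically, and the slopes satisfy a contraction
inequality with geometric error, so the series for `u` converges absolutely (`summable_phi_sub`). In
`ψ` every value of `φ` along the given orbit cancels (`psi_eq_tsum`).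

For the pressure, `ψ` and `φ` have equal Birkhoff sums along periodic orbits, since they differ by a
coboundary. A cylinder of length `n` is stretched by `Fⁿ` across the whole square, so by bounded
distortion its width, hence its area, is `exp` of the Birkhoff sum of `φ` up to a factor independent
of `n` (`exists_distortion`). The cylinders of length `n` starting with `a` correspond to the
periodic points in the partition sum and tile `E a` up to null sets. Hence `Z_n` lies between two
positive constants, and its exponential growth rate is zero (`partitionSum_bounds`). -/

/-- The first component of the image of `(1, s)` under the derivative. -/
noncomputable def runRate (g : ℝ × ℝ → ℝ × ℝ) (z : ℝ × ℝ) (s : ℝ) : ℝ :=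
  (partialX g z).1 + s * (partialY g z).1

/-- The second component of the image of `(1, s)` under the derivative. -/
noncomputable def riseRate (g : ℝ × ℝ → ℝ × ℝ) (z : ℝ × ℝ) (s : ℝ) : ℝ :=
  (partialX g z).2 + s * (partialY g z).2

/-- The slope of the image of a line of slope `s` under the derivative. -/
noncomputable def slopeMap (g : ℝ × ℝ → ℝ × ℝ) (z : ℝ × ℝ) (s : ℝ) : ℝ :=
  riseRate g z s / runRate g z s

theorem fderiv_apply_eq (g : ℝ × ℝ → ℝ × ℝ) (z v : ℝ × ℝ) :
    fderiv ℝ g z v = v.1 • partialX g z + v.2 • partialY g z := by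
  have : v = v.1 • ((1 : ℝ), (0 : ℝ)) + v.2 • ((0 : ℝ), (1 : ℝ)) := by ext <;> simp
  conv_lhs => rw [this]
  rw [map_add, map_smul, map_smul]; rfl

theorem fderiv_apply_one (g : ℝ × ℝ → ℝ × ℝ) (z : ℝ × ℝ) (s : ℝ) :
    fderiv ℝ g z (1, s) = (runRate g z s, riseRate g z s) := by
  rw [fderiv_apply_eq]; ext <;> simp [runRate, riseRate]

/-! ### Strips bounded by Lipschitz graphs. -/

/-- The closed region between two graphs over the vertical axis, both `α`-Lipschitz. -/
structure IsVStrip (α : ℝ) (l r : ℝ → ℝ) (E : Set (ℝ × ℝ)) : Prop where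
  lip_left : ∀ y ∈ Icc (0 : ℝ) 1, ∀ y' ∈ Icc (0 : ℝ) 1, |l y - l y'| ≤ α * |y - y'|
  lip_right : ∀ y ∈ Icc (0 : ℝ) 1, ∀ y' ∈ Icc (0 : ℝ) 1, |r y - r y'| ≤ α * |y - y'|
  nonneg : ∀ y ∈ Icc (0 : ℝ) 1, 0 ≤ l y
  lt : ∀ y ∈ Icc (0 : ℝ) 1, l y < r y
  le_one : ∀ y ∈ Icc (0 : ℝ) 1, r y ≤ 1
  eq : E = {z | z.2 ∈ Icc (0 : ℝ) 1 ∧ l z.2 ≤ z.1 ∧ z.1 ≤ r z.2}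

theorem lipschitz_of_derivWithin_le {α : ℝ} {l : ℝ → ℝ} (h : ContDiffOn ℝ 1 l (Icc 0 1))
    (hb : ∀ y ∈ Icc (0 : ℝ) 1, |derivWithin l (Icc 0 1) y| ≤ α) :
    ∀ y ∈ Icc (0 : ℝ) 1, ∀ y' ∈ Icc (0 : ℝ) 1, |l y - l y'| ≤ α * |y - y'| := by
  intro y hy y' hy'
  have := (convex_Icc (0 : ℝ) 1).norm_image_sub_le_of_norm_derivWithin_le
    (h.differentiableOn (by norm_num)) (C := α) (fun x hx => hb x hx) hy' hy
  simpa using this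

/-- Only the Lipschitz bound on the sides is kept: it is what the cone conditions reproduce for the
sides of longer cylinders. -/
theorem IsFullHeight.exists_strip {α : ℝ} {E : Set (ℝ × ℝ)} (h : IsFullHeight α E) :
    ∃ l r, IsVStrip α l r E := by
  obtain ⟨l, r, hl, hr, hd, ho, rfl⟩ := h
  exact ⟨l, r, lipschitz_of_derivWithin_le hl fun y hy => (hd y hy).1,
    lipschitz_of_derivWithin_le hr fun y hy => (hd y hy).2, fun y hy => (ho y hy).1,
    fun y hy => (ho y hy).2.1, fun y hy => (ho y hy).2.2, rfl⟩

namespace IsVStrip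

variable {α : ℝ} {l r : ℝ → ℝ} {E : Set (ℝ × ℝ)}

theorem le (h : IsVStrip α l r E) : ∀ y ∈ Icc (0 : ℝ) 1, l y ≤ r y := fun y hy => (h.lt y hy).le

theorem mem_iff (h : IsVStrip α l r E) {z : ℝ × ℝ} :
    z ∈ E ↔ z.2 ∈ Icc (0 : ℝ) 1 ∧ l z.2 ≤ z.1 ∧ z.1 ≤ r z.2 := by rw [h.eq]; rfl

theorem mem_square (h : IsVStrip α l r E) {z : ℝ × ℝ} (hz : z ∈ E) :
    z.1 ∈ Icc (0 : ℝ) 1 ∧ z.2 ∈ Icc (0 : ℝ) 1 := by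
  obtain ⟨h1, h2, h3⟩ := h.mem_iff.1 hz
  exact ⟨⟨(h.nonneg _ h1).trans h2, h3.trans (h.le_one _ h1)⟩, h1⟩

theorem left_mem (h : IsVStrip α l r E) {y : ℝ} (hy : y ∈ Icc (0 : ℝ) 1) : (l y, y) ∈ E :=
  h.mem_iff.2 ⟨hy, le_rfl, h.le y hy⟩

theorem right_mem (h : IsVStrip α l r E) {y : ℝ} (hy : y ∈ Icc (0 : ℝ) 1) : (r y, y) ∈ E :=
  h.mem_iff.2 ⟨hy, h.le y hy, le_rfl⟩

theorem continuousOn_left (h : IsVStrip α l r E) : ContinuousOn l (Icc 0 1) :=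
  (LipschitzOnWith.of_dist_le_mul (K := α.toNNReal) fun x hx y hy => by
    rw [Real.dist_eq, Real.dist_eq]
    exact (h.lip_left x hx y hy).trans (by gcongr; exact Real.le_coe_toNNReal α)).continuousOn

theorem continuousOn_right (h : IsVStrip α l r E) : ContinuousOn r (Icc 0 1) :=
  (LipschitzOnWith.of_dist_le_mul (K := α.toNNReal) fun x hx y hy => by
    rw [Real.dist_eq, Real.dist_eq]
    exact (h.lip_right x hx y hy).trans (by gcongr; exact Real.le_coe_toNNReal α)).continuousOn

/-- A strip need not be convex, but along a chord of slope at most `α` a side moves horizontally by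
at most `α²` times the horizontal progress, so the chord cannot cross it. This permits mean value
arguments along such chords. -/
theorem segment_subset (h : IsVStrip α l r E) (h0 : 0 ≤ α) (h1 : α ≤ 1) {z z' : ℝ × ℝ}
    (hz : z ∈ E) (hz' : z' ∈ E) (hh : |z'.2 - z.2| ≤ α * |z'.1 - z.1|) : segment ℝ z z' ⊆ E := by
  wlog hle : z.1 ≤ z'.1 generalizing z z'
  · rw [segment_symm]
    exact this hz' hz (by rwa [abs_sub_comm, abs_sub_comm z.1]) (le_of_not_ge hle)
  rintro w ⟨a, b, ha, hb, hab, rfl⟩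
  obtain ⟨p1, p2, p3⟩ := h.mem_iff.1 hz
  obtain ⟨q1, q2, q3⟩ := h.mem_iff.1 hz'
  obtain rfl : a = 1 - b := by linarith
  rw [abs_of_nonneg (sub_nonneg.2 hle)] at hh
  have hw : (1 - b) * z.2 + b * z'.2 ∈ Icc (0 : ℝ) 1 := convex_Icc (0 : ℝ) 1 p1 q1 ha hb hab
  rw [h.mem_iff]
  simp only [Prod.smul_fst, Prod.smul_snd, Prod.fst_add, Prod.snd_add, smul_eq_mul]
  have haa : α * (α * (z'.1 - z.1)) ≤ z'.1 - z.1 := by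
    have : 0 ≤ z'.1 - z.1 := sub_nonneg.2 hle
    nlinarith [mul_nonneg h0 this]
  have e1 : |(1 - b) * z.2 + b * z'.2 - z.2| = b * |z'.2 - z.2| := by
    rw [← abs_of_nonneg hb, ← abs_mul, abs_of_nonneg hb]; ring_nf
  have e2 : |(1 - b) * z.2 + b * z'.2 - z'.2| = (1 - b) * |z'.2 - z.2| := by
    rw [← abs_of_nonneg ha, ← abs_mul, abs_of_nonneg ha, abs_sub_comm]; ring_nf
  refine ⟨hw, ?_, ?_⟩
  · have := (abs_le.1 (h.lip_left _ hw _ p1)).2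
    rw [e1] at this
    nlinarith [mul_le_mul_of_nonneg_left hh h0]
  · have := (abs_le.1 (h.lip_right _ hw _ q1)).1
    rw [e2] at this
    nlinarith [mul_le_mul_of_nonneg_left hh h0]

theorem abs_fst_sub_le (h : IsVStrip α l r E) {w : ℝ} (hw : ∀ y ∈ Icc (0 : ℝ) 1, r y - l y ≤ w)
    {z z' : ℝ × ℝ} (hz : z ∈ E) (hz' : z' ∈ E) : |z.1 - z'.1| ≤ α * |z.2 - z'.2| + w := by
  obtain ⟨p1, p2, p3⟩ := h.mem_iff.1 hz
  obtain ⟨q1, q2, q3⟩ := h.mem_iff.1 hz'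
  have a1 := abs_le.1 (h.lip_left _ p1 _ q1)
  have a2 := hw _ p1
  have a3 := hw _ q1
  rw [abs_le]; constructor <;> linarith

theorem isClosed (h : IsVStrip α l r E) : IsClosed E := by
  have hc : IsClosed {z : ℝ × ℝ | z.2 ∈ Icc (0 : ℝ) 1} := isClosed_Icc.preimage continuous_snd
  have hs : MapsTo Prod.snd {z : ℝ × ℝ | z.2 ∈ Icc (0 : ℝ) 1} (Icc 0 1) := fun z hz => hz
  have c1 := (continuous_fst.continuousOn.sub
    (h.continuousOn_left.comp continuous_snd.continuousOn hs)).preimage_isClosed_of_isClosed hc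
    (isClosed_Ici (a := (0 : ℝ)))
  have c2 := (continuous_fst.continuousOn.sub
    (h.continuousOn_right.comp continuous_snd.continuousOn hs)).preimage_isClosed_of_isClosed hc
    (isClosed_Iic (a := (0 : ℝ)))
  convert c1.inter c2 using 1
  ext z
  rw [h.mem_iff]
  simp; tauto

theorem isCompact (h : IsVStrip α l r E) : IsCompact E :=
  (isCompact_Icc.prod isCompact_Icc).of_isClosed_subset h.isClosed fun _ hz => h.mem_square hz

end IsVStrip

/-! ### Invariance of the cones and expansion along chords. -/

namespace PiecewiseMap

variable {ι : Type*}

/-- A model satisfying the hyperbolicity conditions, together with the bounds on the constants. -/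
structure IsHyperbolicModel (M : PiecewiseMap ι) (α K₀ : ℝ) : Prop where
  pos : 0 < α
  lt_one : α < 1
  one_lt : 1 < K₀
  model : M.IsModel α
  hyp : M.Hyperbolic α K₀

namespace IsHyperbolicModel

variable {M : PiecewiseMap ι} {α K₀ : ℝ}

theorem exists_strip (H : M.IsHyperbolicModel α K₀) (i : ι) : ∃ l r, IsVStrip α l r (M.E i) :=
  (H.model.fullHeight i).exists_strip

theorem mem_source (H : M.IsHyperbolicModel α K₀) {i : ι} {z : ℝ × ℝ} (hz : z ∈ M.E i) :
    z ∈ (M.f i).source := H.model.subset_source i hz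

theorem contDiffAt (H : M.IsHyperbolicModel α K₀) {i : ι} {z : ℝ × ℝ} (hz : z ∈ M.E i) :
    ContDiffAt ℝ 2 (M.f i) z :=
  (H.model.contDiffOn i).contDiffAt ((M.f i).open_source.mem_nhds (H.mem_source hz))

theorem differentiableAt (H : M.IsHyperbolicModel α K₀) {i : ι} {z : ℝ × ℝ} (hz : z ∈ M.E i) :
    DifferentiableAt ℝ (M.f i) z :=
  (H.contDiffAt hz).differentiableAt (by norm_num)

theorem continuousOn (H : M.IsHyperbolicModel α K₀) (i : ι) : ContinuousOn (M.f i) (M.E i) :=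
  fun _ hz => (H.differentiableAt hz).continuousAt.continuousWithinAt

theorem mem_S {i : ι} {z : ℝ × ℝ} (hz : z ∈ M.E i) : M.f i z ∈ M.S i := mem_image_of_mem _ hz

theorem injOn (H : M.IsHyperbolicModel α K₀) (i : ι) : InjOn (M.f i) (M.E i) :=
  (M.f i).injOn.mono (H.model.subset_source i)

theorem abs_partial_le (H : M.IsHyperbolicModel α K₀) {i : ι} {z : ℝ × ℝ} (hz : z ∈ M.E i) :
    |(partialY (M.f i) z).1| ≤ α * |(partialX (M.f i) z).1| ∧
      |(partialX (M.f i) z).2| ≤ α * |(partialX (M.f i) z).1| := by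
  have h1 := H.hyp.h1 i z hz
  have h3 := H.hyp.h3 i z hz
  have := H.pos
  constructor
  · have a : 0 ≤ α * |(partialY (M.f i) z).2| := by positivity
    have b : 0 ≤ α ^ 2 * |(partialX (M.f i) z).2| := by positivity
    linarith
  · have a : 0 ≤ α * |(partialY (M.f i) z).2| := by positivity
    have b : 0 ≤ α ^ 2 * |(partialY (M.f i) z).1| := by positivity
    linarith

theorem one_sub_sq_pos (H : M.IsHyperbolicModel α K₀) : 0 < 1 - α ^ 2 := by
  nlinarith [H.pos, H.lt_one]

theorem runRate_lower (M : PiecewiseMap ι) {α : ℝ} {i : ι} {z : ℝ × ℝ} {s : ℝ} (hs : |s| ≤ α) :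
    |(partialX (M.f i) z).1| - α * |(partialY (M.f i) z).1| ≤ |runRate (M.f i) z s| := by
  unfold runRate
  have h1 : |(partialX (M.f i) z).1| ≤ |(partialX (M.f i) z).1 + s * (partialY (M.f i) z).1| +
      |s * (partialY (M.f i) z).1| := by
    have := abs_sub ((partialX (M.f i) z).1 + s * (partialY (M.f i) z).1)
      (s * (partialY (M.f i) z).1)
    simpa using this
  rw [abs_mul] at h1
  have := mul_le_mul_of_nonneg_right hs (abs_nonneg (partialY (M.f i) z).1)
  linarith

theorem le_runRate (H : M.IsHyperbolicModel α K₀) {i : ι} {z : ℝ × ℝ} (hz : z ∈ M.E i) {s : ℝ}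
    (hs : |s| ≤ α) : K₀ ≤ |runRate (M.f i) z s| :=
  (H.hyp.h2 i z hz).trans (runRate_lower M hs)

theorem runRate_ne_zero (H : M.IsHyperbolicModel α K₀) {i : ι} {z : ℝ × ℝ} (hz : z ∈ M.E i) {s : ℝ}
    (hs : |s| ≤ α) : runRate (M.f i) z s ≠ 0 := by
  have := H.le_runRate hz hs
  have := H.one_lt
  rw [← abs_pos]; linarith

theorem partialX_le_runRate (H : M.IsHyperbolicModel α K₀) {i : ι} {z : ℝ × ℝ} (hz : z ∈ M.E i)
    {s : ℝ} (hs : |s| ≤ α) :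
    (1 - α ^ 2) * |(partialX (M.f i) z).1| ≤ |runRate (M.f i) z s| := by
  refine le_trans ?_ (runRate_lower M hs)
  nlinarith [mul_le_mul_of_nonneg_left (H.abs_partial_le hz).1 H.pos.le]

theorem abs_riseRate_le (H : M.IsHyperbolicModel α K₀) {i : ι} {z : ℝ × ℝ} (hz : z ∈ M.E i) {s : ℝ}
    (hs : |s| ≤ α) : |riseRate (M.f i) z s| ≤ α * |runRate (M.f i) z s| := by
  have h1 := H.hyp.h1 i z hz
  have h2 := mul_le_mul_of_nonneg_left (runRate_lower M (i := i) (z := z) hs) H.pos.le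
  refine le_trans ?_ h2
  unfold riseRate
  have := abs_add_le (partialX (M.f i) z).2 (s * (partialY (M.f i) z).2)
  rw [abs_mul] at this
  have := mul_le_mul_of_nonneg_right hs (abs_nonneg (partialY (M.f i) z).2)
  nlinarith

theorem abs_slopeMap_le (H : M.IsHyperbolicModel α K₀) {i : ι} {z : ℝ × ℝ} (hz : z ∈ M.E i) {s : ℝ}
    (hs : |s| ≤ α) : |slopeMap (M.f i) z s| ≤ α := by
  rw [slopeMap, abs_div, div_le_iff₀ (abs_pos.2 (H.runRate_ne_zero hz hs))]
  exact H.abs_riseRate_le hz hs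

theorem segment_subset (H : M.IsHyperbolicModel α K₀) {i : ι} {z z' : ℝ × ℝ} (hz : z ∈ M.E i)
    (hz' : z' ∈ M.E i) (hh : |z'.2 - z.2| ≤ α * |z'.1 - z.1|) : segment ℝ z z' ⊆ M.E i := by
  obtain ⟨l, r, h⟩ := H.exists_strip i
  exact h.segment_subset H.pos.le H.lt_one.le hz hz' hh

/-- The mean value theorem along a chord of slope `c`. -/
theorem exists_chord (H : M.IsHyperbolicModel α K₀) {i : ι} {z z' : ℝ × ℝ} (hz : z ∈ M.E i)
    (hz' : z' ∈ M.E i) {c : ℝ} (hc : |c| ≤ α) (hh : z'.2 - z.2 = c * (z'.1 - z.1)) :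
    segment ℝ z z' ⊆ M.E i ∧
    (∃ ξ ∈ segment ℝ z z',
      (M.f i z').1 - (M.f i z).1 = runRate (M.f i) ξ c * (z'.1 - z.1)) ∧
    ∃ ξ ∈ segment ℝ z z',
      (M.f i z').2 - (M.f i z).2 = slopeMap (M.f i) ξ c * ((M.f i z').1 - (M.f i z).1) := by
  have hseg : segment ℝ z z' ⊆ M.E i := H.segment_subset hz hz' (by
    rw [hh, abs_mul]; gcongr)
  refine ⟨hseg, ?_⟩
  set Δ := z'.1 - z.1 with hΔ
  rcases eq_or_ne Δ 0 with h0 | h0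
  · have : z' = z := by
      rw [h0, mul_zero] at hh
      exact Prod.ext (by linarith) (by linarith)
    subst this
    exact ⟨⟨z', left_mem_segment _ _ _, by simp [h0]⟩, ⟨z', left_mem_segment _ _ _, by simp⟩⟩
  set γ : ℝ → ℝ × ℝ := fun t => z + t • (z' - z) with hγ
  have hγm : ∀ t ∈ Icc (0 : ℝ) 1, γ t ∈ segment ℝ z z' := fun t ht => by
    rw [segment_eq_image']; exact ⟨t, ht, rfl⟩
  have hv : z' - z = Δ • ((1 : ℝ), c) := by
    ext
    · simp [hΔ]
    · simp [hh, mul_comm]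
  have hγd : ∀ t, HasDerivAt γ (Δ • ((1 : ℝ), c)) t := fun t => by
    have := ((hasDerivAt_id t).smul_const (z' - z)).const_add z
    rw [one_smul, hv] at this
    simpa [hγ, hv] using this
  have hd : ∀ t ∈ Icc (0 : ℝ) 1, HasDerivAt (fun t => M.f i (γ t))
      (Δ • (runRate (M.f i) (γ t) c, riseRate (M.f i) (γ t) c)) t := fun t ht => by
    have := (H.differentiableAt (hseg (hγm t ht))).hasFDerivAt.comp_hasDerivAt t (hγd t)
    rwa [map_smul, fderiv_apply_one] at this
  have hd1 : ∀ t ∈ Icc (0 : ℝ) 1, HasDerivAt (fun t => (M.f i (γ t)).1)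
      (Δ * runRate (M.f i) (γ t) c) t := fun t ht => by
    exact hasFDerivAt_fst.comp_hasDerivAt t (hd t ht)
  have hd2 : ∀ t ∈ Icc (0 : ℝ) 1, HasDerivAt (fun t => (M.f i (γ t)).2)
      (Δ * riseRate (M.f i) (γ t) c) t := fun t ht => by
    exact hasFDerivAt_snd.comp_hasDerivAt t (hd t ht)
  have c1 : ContinuousOn (fun t => (M.f i (γ t)).1) (Icc 0 1) :=
    fun t ht => (hd1 t ht).continuousAt.continuousWithinAt
  have c2 : ContinuousOn (fun t => (M.f i (γ t)).2) (Icc 0 1) :=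
    fun t ht => (hd2 t ht).continuousAt.continuousWithinAt
  have e0 : γ 0 = z := by simp [hγ]
  have e1 : γ 1 = z' := by simp [hγ]
  constructor
  · obtain ⟨t, ht, h⟩ := exists_hasDerivAt_eq_slope _ _ one_pos c1
      fun t ht => hd1 t (Ioo_subset_Icc_self ht)
    refine ⟨γ t, hγm t (Ioo_subset_Icc_self ht), ?_⟩
    rw [e0, e1, sub_zero, div_one] at h
    rw [← h, mul_comm]
  -- Cauchy's mean value theorem, so that numerator and denominator of the image slope are taken at
  -- the same point.
  · obtain ⟨t, ht, h⟩ := exists_ratio_hasDerivAt_eq_ratio_slope _ _ one_pos c1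
      (fun t ht => hd1 t (Ioo_subset_Icc_self ht)) _ _ c2
      fun t ht => hd2 t (Ioo_subset_Icc_self ht)
    refine ⟨γ t, hγm t (Ioo_subset_Icc_self ht), ?_⟩
    rw [e0, e1] at h
    have hne := H.runRate_ne_zero (hseg (hγm t (Ioo_subset_Icc_self ht))) hc
    rw [slopeMap]
    field_simp
    refine mul_left_cancel₀ h0 ?_
    linarith

theorem exists_slope {α x y : ℝ} (h : |y| ≤ α * |x|) (h0 : 0 ≤ α) : ∃ c, |c| ≤ α ∧ y = c * x := by
  rcases eq_or_ne x 0 with rfl | hx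
  · exact ⟨0, by simpa using h0, by simpa using h⟩
  · refine ⟨y / x, ?_, by field_simp⟩
    rwa [abs_div, div_le_iff₀ (abs_pos.2 hx)]

/-- Horizontally related points have horizontally related images, with expansion. -/
theorem cone_expand (H : M.IsHyperbolicModel α K₀) {i : ι} {z z' : ℝ × ℝ} (hz : z ∈ M.E i)
    (hz' : z' ∈ M.E i) (hh : |z'.2 - z.2| ≤ α * |z'.1 - z.1|) :
    |(M.f i z').2 - (M.f i z).2| ≤ α * |(M.f i z').1 - (M.f i z).1| ∧
      K₀ * |z'.1 - z.1| ≤ |(M.f i z').1 - (M.f i z).1| := by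
  obtain ⟨c, hc, he⟩ := exists_slope hh H.pos.le
  obtain ⟨hs, ⟨ξ, hξ, h1⟩, ⟨ξ', hξ', h2⟩⟩ := H.exists_chord hz hz' hc he
  rw [h2, abs_mul]
  refine ⟨by gcongr; exact H.abs_slopeMap_le (hs hξ') hc, ?_⟩
  rw [h1, abs_mul]
  gcongr
  exact H.le_runRate (hs hξ) hc

end IsHyperbolicModel

/-! ### The dual model: inverse maps with the two axes swapped -/

/-- The model obtained by inverting all maps and swapping the axes. -/
noncomputable def dual (M : PiecewiseMap ι) : PiecewiseMap ι where
  E i := Prod.swap ⁻¹' M.S i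
  f i := ((Homeomorph.prodComm ℝ ℝ).toOpenPartialHomeomorph.trans (M.f i).symm).trans
    (Homeomorph.prodComm ℝ ℝ).toOpenPartialHomeomorph

theorem dual_f_apply (M : PiecewiseMap ι) (i : ι) (z : ℝ × ℝ) :
    M.dual.f i z = ((M.f i).symm z.swap).swap := rfl

theorem dual_E (M : PiecewiseMap ι) (i : ι) : M.dual.E i = Prod.swap ⁻¹' M.S i := rfl

theorem dual_source (M : PiecewiseMap ι) (i : ι) :
    (M.dual.f i).source = Prod.swap ⁻¹' (M.f i).target := by
  ext z; simp [dual]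

theorem dual_target (M : PiecewiseMap ι) (i : ι) :
    (M.dual.f i).target = Prod.swap ⁻¹' (M.f i).source := by
  ext z; simp [dual]

theorem dual_S (M : PiecewiseMap ι) (i : ι) (h : M.E i ⊆ (M.f i).source) :
    M.dual.S i = Prod.swap ⁻¹' M.E i := by
  ext z
  constructor
  · rintro ⟨w, ⟨v, hv, hvw⟩, rfl⟩
    rw [dual_f_apply, ← hvw]
    simpa [(M.f i).left_inv (h hv)] using hv
  · intro hz
    refine ⟨(M.f i z.swap).swap, ⟨z.swap, hz, by simp⟩, ?_⟩
    rw [dual_f_apply, Prod.swap_swap, (M.f i).left_inv (h hz), Prod.swap_swap]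

end PiecewiseMap

namespace PiecewiseMap

variable {ι : Type*} {M : PiecewiseMap ι} {α K₀ : ℝ}

theorem fderiv_fderiv_symm (H : M.IsHyperbolicModel α K₀) {i : ι} {w : ℝ × ℝ} (hw : w ∈ M.E i)
    (v : ℝ × ℝ) : fderiv ℝ (M.f i) w (fderiv ℝ (M.f i).symm (M.f i w) v) = v := by
  have hs := H.mem_source hw
  have ht := (M.f i).map_source hs
  have h1 : HasFDerivAt (M.f i).symm (fderiv ℝ (M.f i).symm (M.f i w)) (M.f i w) :=
    (((H.model.contDiffOn_symm i).contDiffAt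
      ((M.f i).open_target.mem_nhds ht)).differentiableAt (by norm_num)).hasFDerivAt
  have h2 : HasFDerivAt (M.f i) (fderiv ℝ (M.f i) w) ((M.f i).symm (M.f i w)) := by
    rw [(M.f i).left_inv hs]; exact (H.differentiableAt hw).hasFDerivAt
  have h3 := (h2.comp _ h1).congr_of_eventuallyEq
    (((M.f i).eventually_right_inverse ht).mono fun x hx => hx.symm : id =ᶠ[_] _)
  exact congrArg (fun L => L v) (h3.unique (hasFDerivAt_id _))

theorem fderiv_dual (H : M.IsHyperbolicModel α K₀) {i : ι} {w : ℝ × ℝ} (hw : w ∈ M.E i)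
    (v : ℝ × ℝ) : fderiv ℝ (M.dual.f i) (M.f i w).swap v =
      (fderiv ℝ (M.f i).symm (M.f i w) v.swap).swap := by
  have hs := H.mem_source hw
  have ht := (M.f i).map_source hs
  have h1 : HasFDerivAt (M.f i).symm (fderiv ℝ (M.f i).symm (M.f i w))
      (ContinuousLinearEquiv.prodComm ℝ ℝ ℝ (M.f i w).swap) :=
    (((H.model.contDiffOn_symm i).contDiffAt
      ((M.f i).open_target.mem_nhds ht)).differentiableAt (by norm_num)).hasFDerivAt
  have h2 := (ContinuousLinearEquiv.prodComm ℝ ℝ ℝ).hasFDerivAt.comp (M.f i w).swap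
    (h1.comp (M.f i w).swap (ContinuousLinearEquiv.prodComm ℝ ℝ ℝ).hasFDerivAt)
  have h3 : HasFDerivAt (M.dual.f i) _ (M.f i w).swap := h2
  rw [h3.fderiv]; rfl

/-- The inverse matrix consists of cofactors divided by the determinant. After the swap, dividing by
the Jacobian turns (H1) and (H3) into each other, and likewise (H2) and (H4). -/
theorem partial_dual (H : M.IsHyperbolicModel α K₀) {i : ι} {w : ℝ × ℝ} (hw : w ∈ M.E i) :
    0 < absJacobian (M.f i) w ∧
    |(partialX (M.dual.f i) (M.f i w).swap).1| = |(partialX (M.f i) w).1| / absJacobian (M.f i) w ∧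
    |(partialX (M.dual.f i) (M.f i w).swap).2| = |(partialY (M.f i) w).1| / absJacobian (M.f i) w ∧
    |(partialY (M.dual.f i) (M.f i w).swap).1| = |(partialX (M.f i) w).2| / absJacobian (M.f i) w ∧
    |(partialY (M.dual.f i) (M.f i w).swap).2| = |(partialY (M.f i) w).2| / absJacobian (M.f i) w ∧
    absJacobian (M.dual.f i) (M.f i w).swap = 1 / absJacobian (M.f i) w := by
  have e1 := fderiv_fderiv_symm H hw (0, 1)
  have e2 := fderiv_fderiv_symm H hw (1, 0)
  have d1 : partialX (M.dual.f i) (M.f i w).swap = _ := fderiv_dual H hw (1, 0)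
  have d2 : partialY (M.dual.f i) (M.f i w).swap = _ := fderiv_dual H hw (0, 1)
  simp only [Prod.swap_prod_mk] at d1 d2
  unfold absJacobian
  rw [d1, d2]
  rw [fderiv_apply_eq] at e1 e2
  generalize fderiv ℝ (M.f i).symm (M.f i w) (0, 1) = P at *
  generalize fderiv ℝ (M.f i).symm (M.f i w) (1, 0) = Q at *
  generalize partialX (M.f i) w = X at *
  generalize partialY (M.f i) w = Y at *
  obtain ⟨p, q⟩ := P
  obtain ⟨u, v⟩ := Q
  obtain ⟨a, c⟩ := X
  obtain ⟨b, d⟩ := Y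
  simp only [Prod.smul_mk, Prod.mk_add_mk, smul_eq_mul, Prod.mk.injEq, Prod.swap_prod_mk] at *
  obtain ⟨e1, e1'⟩ := e1
  obtain ⟨e2, e2'⟩ := e2
  -- The determinants of two inverse matrices; this also shows that the Jacobian does not vanish.
  have hD : (q * u - v * p) * (a * d - b * c) = 1 := by
    linear_combination (p * c + q * d) * e2 + e1' - (u * c + v * d) * e1
  have hD0 : a * d - b * c ≠ 0 := fun h => by rw [h, mul_zero] at hD; exact zero_ne_one hD
  have hp := abs_pos.2 hD0
  refine ⟨hp, ?_, ?_, ?_, ?_, ?_⟩ <;>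
    rw [eq_div_iff hp.ne', ← abs_mul]
  · congr 1; linear_combination a * e1' - c * e1
  · rw [← abs_neg]; congr 1; linear_combination b * e1' - d * e1
  · rw [← abs_neg]; congr 1; linear_combination c * e2 - a * e2'
  · congr 1; linear_combination d * e2 - b * e2'
  · rw [hD, abs_one]

theorem _root_.IsFullHeight.swap {α : ℝ} {E : Set (ℝ × ℝ)} (h : IsFullHeight α E) :
    IsFullWidth α (Prod.swap ⁻¹' E) := by
  obtain ⟨l, r, hl, hr, hd, ho, rfl⟩ := h
  exact ⟨l, r, hl, hr, hd, ho, rfl⟩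

theorem _root_.IsFullWidth.swap {α : ℝ} {E : Set (ℝ × ℝ)} (h : IsFullWidth α E) :
    IsFullHeight α (Prod.swap ⁻¹' E) := by
  obtain ⟨l, r, hl, hr, hd, ho, rfl⟩ := h
  exact ⟨l, r, hl, hr, hd, ho, rfl⟩

/-- The dual of a hyperbolic model is a hyperbolic model. -/
theorem IsHyperbolicModel.dual (H : M.IsHyperbolicModel α K₀) : M.dual.IsHyperbolicModel α K₀ where
  pos := H.pos
  lt_one := H.lt_one
  one_lt := H.one_lt
  model := by
    have hsw : ContDiff ℝ 2 (Prod.swap : ℝ × ℝ → ℝ × ℝ) := contDiff_snd.prodMk contDiff_fst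
    constructor
    · intro i z hz
      rw [dual_source]
      obtain ⟨w, hw, hwz⟩ := hz
      rw [mem_preimage, ← hwz]
      exact (M.f i).map_source (H.mem_source hw)
    · intro i
      rw [dual_source]
      exact hsw.comp_contDiffOn ((H.model.contDiffOn_symm i).comp hsw.contDiffOn fun _ h => h)
    · intro i
      rw [dual_target]
      exact hsw.comp_contDiffOn ((H.model.contDiffOn i).comp hsw.contDiffOn fun _ h => h)
    · intro i; exact IsFullWidth.swap (H.model.fullWidth i)
    · intro i; rw [dual_S _ _ (H.model.subset_source i)]; exact IsFullHeight.swap (H.model.fullHeight i)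
  hyp := by
    have key : ∀ i, ∀ z ∈ M.dual.E i, ∃ w ∈ M.E i, z = (M.f i w).swap := by
      rintro i z ⟨w, hw, hwz⟩
      exact ⟨w, hw, by rw [hwz, Prod.swap_swap]⟩
    constructor
    · intro i z hz
      obtain ⟨w, hw, rfl⟩ := key i z hz
      obtain ⟨hJ, h1, h2, h3, h4, h5⟩ := partial_dual H hw
      rw [h1, h2, h3, h4]
      have := div_le_div_of_nonneg_right (H.hyp.h3 i w hw) hJ.le
      calc _ = _ := by ring
        _ ≤ _ := this
        _ = _ := by ring
    · intro i z hz
      obtain ⟨w, hw, rfl⟩ := key i z hz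
      obtain ⟨hJ, h1, h2, h3, h4, h5⟩ := partial_dual H hw
      rw [h1, h3]
      have := div_le_div_of_nonneg_right (H.hyp.h4 i w hw) hJ.le
      rw [mul_div_cancel_left₀ _ hJ.ne'] at this
      calc _ ≤ _ := this
        _ = _ := by ring
    · intro i z hz
      obtain ⟨w, hw, rfl⟩ := key i z hz
      obtain ⟨hJ, h1, h2, h3, h4, h5⟩ := partial_dual H hw
      rw [h1, h2, h3, h4]
      have := div_le_div_of_nonneg_right (H.hyp.h1 i w hw) hJ.le
      calc _ = _ := by ring
        _ ≤ _ := this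
        _ = _ := by ring
    · intro i z hz
      obtain ⟨w, hw, rfl⟩ := key i z hz
      obtain ⟨hJ, h1, h2, h3, h4, h5⟩ := partial_dual H hw
      rw [h1, h2, h5]
      have := div_le_div_of_nonneg_right (H.hyp.h2 i w hw) hJ.le
      calc _ = _ := by ring
        _ ≤ _ := this
        _ = _ := by ring
    · exact H.hyp.h5

theorem swap_mem_dual_E {i : ι} {z : ℝ × ℝ} : z.swap ∈ M.dual.E i ↔ z ∈ M.S i := by
  rw [dual_E, mem_preimage, Prod.swap_swap]

/-- Vertically related points of a strip have vertically related preimages, with expansion. -/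
theorem IsHyperbolicModel.cone_contract (H : M.IsHyperbolicModel α K₀) {i : ι} {z z' : ℝ × ℝ}
    (hz : z ∈ M.E i) (hz' : z' ∈ M.E i)
    (hh : |(M.f i z').1 - (M.f i z).1| ≤ α * |(M.f i z').2 - (M.f i z).2|) :
    |z'.1 - z.1| ≤ α * |z'.2 - z.2| ∧
      K₀ * |(M.f i z').2 - (M.f i z).2| ≤ |z'.2 - z.2| := by
  have := H.dual.cone_expand (i := i) (z := (M.f i z).swap) (z' := (M.f i z').swap)
    (swap_mem_dual_E.2 (IsHyperbolicModel.mem_S hz))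
    (swap_mem_dual_E.2 (IsHyperbolicModel.mem_S hz')) hh
  simpa [dual_f_apply, (M.f i).left_inv (H.mem_source hz),
    (M.f i).left_inv (H.mem_source hz')] using this

/-- Since the past is listed with the most recent symbol first, its strips are the rectangles of the
dual model with the same sequence. Results on `cylE` transfer to `cylS` through this. -/
theorem swap_mem_cylE_dual (H : M.IsHyperbolicModel α K₀) (n : ℕ) (p : ℕ → ι) (z : ℝ × ℝ) :
    z.swap ∈ M.dual.cylE n p ↔ z ∈ M.cylS n p := by
  induction n generalizing p z with
  | zero => simp only [cylE, cylS, unitSquare, mem_prod, Prod.fst_swap, Prod.snd_swap]; tauto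
  | succ n ih =>
    simp only [cylE, cylS, mem_inter_iff, mem_preimage, swap_mem_dual_E]
    constructor
    · rintro ⟨⟨w, hw, rfl⟩, h2⟩
      refine ⟨w, ⟨?_, hw⟩, rfl⟩
      rw [dual_f_apply, ih, Prod.swap_swap, (M.f _).left_inv (H.mem_source hw)] at h2
      exact h2
    · rintro ⟨w, ⟨h1, hw⟩, rfl⟩
      refine ⟨mem_image_of_mem _ hw, ?_⟩
      rw [dual_f_apply, ih, Prod.swap_swap, (M.f _).left_inv (H.mem_source hw)]
      exact h1

end PiecewiseMap

/-! ### The vertical sides of a rectangle are mapped into the vertical sides of the square. -/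

namespace PiecewiseMap

variable {ι : Type*} {M : PiecewiseMap ι} {α K₀ : ℝ}

namespace IsHyperbolicModel

theorem image_mem_square (H : M.IsHyperbolicModel α K₀) {i : ι} {z : ℝ × ℝ} (hz : z ∈ M.E i) :
    (M.f i z).1 ∈ Icc (0 : ℝ) 1 ∧ (M.f i z).2 ∈ Icc (0 : ℝ) 1 := by
  obtain ⟨b, t, -, -, -, ho, he⟩ := H.model.fullWidth i
  have h : M.f i z ∈ M.S i := mem_S hz
  rw [he] at h
  exact ⟨h.1, (ho _ h.1).1.trans h.2.1, h.2.2.trans (ho _ h.1).2.2⟩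

theorem mem_interior_of_image (H : M.IsHyperbolicModel α K₀) {i : ι} {z : ℝ × ℝ} (hz : z ∈ M.E i)
    (h : M.f i z ∈ interior (M.S i)) : z ∈ interior (M.E i) := by
  refine mem_interior.2 ⟨(M.f i).source ∩ M.f i ⁻¹' interior (M.S i), ?_,
    (M.f i).isOpen_inter_preimage isOpen_interior, H.mem_source hz, h⟩
  rintro w ⟨hw, hwS⟩
  obtain ⟨w', hw', he⟩ := interior_subset hwS
  rwa [← (M.f i).injOn (H.mem_source hw') hw he]

theorem mem_interior_region {b t : ℝ → ℝ} (hb : ContinuousOn b (Icc 0 1))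
    (ht : ContinuousOn t (Icc 0 1)) {z : ℝ × ℝ} (hz : z.1 ∈ Ioo (0 : ℝ) 1) (h1 : b z.1 < z.2)
    (h2 : z.2 < t z.1) :
    z ∈ interior {z : ℝ × ℝ | z.1 ∈ Icc (0 : ℝ) 1 ∧ b z.1 ≤ z.2 ∧ z.2 ≤ t z.1} := by
  rw [mem_interior_iff_mem_nhds]
  have hb' := (hb.continuousAt (Icc_mem_nhds hz.1 hz.2)).comp (continuous_fst.continuousAt (x := z))
  have ht' := (ht.continuousAt (Icc_mem_nhds hz.1 hz.2)).comp (continuous_fst.continuousAt (x := z))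
  filter_upwards [continuous_fst.continuousAt.preimage_mem_nhds (Icc_mem_nhds hz.1 hz.2),
    hb'.eventually_lt continuous_snd.continuousAt h1,
    continuous_snd.continuousAt.eventually_lt ht' h2] with w w1 w2 w3
  exact ⟨w1, le_of_lt w2, le_of_lt w3⟩

/-- A boundary curve of `E i` that is transverse to the axis `x = e` of the image is mapped into
this axis. -/
theorem side_eq (H : M.IsHyperbolicModel α K₀) {i : ι} {m : ℝ → ℝ}
    (hm : DifferentiableOn ℝ m (Icc 0 1)) (hE : ∀ y ∈ Icc (0 : ℝ) 1, (m y, y) ∈ M.E i)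
    (hI : ∀ y ∈ Icc (0 : ℝ) 1, (m y, y) ∉ interior (M.E i)) {e : ℝ} (he : e = 0 ∨ e = 1)
    (h1 : ∀ z ∈ M.E i, (M.f i z).1 = e → z.1 = m z.2)
    (h2 : ∀ y ∈ Icc (0 : ℝ) 1, (M.f i (m y, y)).1 ≠ 1 - e) :
    ∀ y ∈ Icc (0 : ℝ) 1, (M.f i (m y, y)).1 = e := by
  obtain ⟨b, t, hb, ht, -, ho, hS⟩ := H.model.fullWidth i
  have heI : e ∈ Icc (0 : ℝ) 1 := by rcases he with rfl | rfl <;> simp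
  set κ : ℝ → ℝ × ℝ := fun y => M.f i (m y, y) with hκ
  have hκS : ∀ y ∈ Icc (0 : ℝ) 1, (κ y).1 ∈ Icc (0 : ℝ) 1 ∧ b (κ y).1 ≤ (κ y).2 ∧
      (κ y).2 ≤ t (κ y).1 := fun y hy => by
    have h : κ y ∈ M.S i := mem_S (hE y hy)
    rwa [hS] at h
  have hκc : ContinuousOn κ (Icc 0 1) :=
    (H.continuousOn i).comp (hm.continuousOn.prodMk continuousOn_id) hE
  have hκc1 : ContinuousOn (fun y => (κ y).1) (Icc 0 1) := continuous_fst.comp_continuousOn hκc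
  have hκc2 : ContinuousOn (fun y => (κ y).2) (Icc 0 1) := continuous_snd.comp_continuousOn hκc
  have hbc := hb.continuousOn.comp hκc1 fun y hy => (hκS y hy).1
  have htc := ht.continuousOn.comp hκc1 fun y hy => (hκS y hy).1
  -- a point of an open side is not mapped to a corner
  have hcorner : ∀ c ∈ Ioo (0 : ℝ) 1, (κ c).1 = e →
      b (κ c).1 < (κ c).2 ∧ (κ c).2 < t (κ c).1 := by
    intro c hc hce
    have hcI := Ioo_subset_Icc_self hc
    have hn : Icc (0 : ℝ) 1 ∈ 𝓝 c := Icc_mem_nhds hc.1 hc.2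
    have hmd := ((hm c hcI).differentiableAt hn).hasDerivAt
    set m' := deriv m c
    have hd : HasDerivAt κ (fderiv ℝ (M.f i) (m c, c) (m', 1)) c :=
      HasFDerivAt.comp_hasDerivAt c (H.differentiableAt (hE c hcI)).hasFDerivAt
        (hmd.prodMk (hasDerivAt_id c))
    set v := fderiv ℝ (M.f i) (m c, c) (m', 1) with hv
    have hd1 : HasDerivAt (fun y => (κ y).1) v.1 c :=
      (hasFDerivAt_fst (𝕜 := ℝ) (p := κ c)).comp_hasDerivAt c hd
    have hd2 : HasDerivAt (fun y => (κ y).2) v.2 c :=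
      (hasFDerivAt_snd (𝕜 := ℝ) (p := κ c)).comp_hasDerivAt c hd
    -- The abscissa of the image attains its extreme value `e` at an interior parameter.
    have hv1 : v.1 = 0 := by
      rcases he with rfl | rfl
      · refine IsLocalMin.hasDerivAt_eq_zero ?_ hd1
        filter_upwards [hn] with y hy
        rw [hce]; exact (hκS y hy).1.1
      · refine IsLocalMax.hasDerivAt_eq_zero ?_ hd1
        filter_upwards [hn] with y hy
        rw [hce]; exact (hκS y hy).1.2
    have hcomp : ∀ g : ℝ → ℝ, ContDiffOn ℝ 1 g (Icc 0 1) →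
        HasDerivAt (fun y => (κ y).2 - g (κ y).1) v.2 c := fun g hg => by
      have hgd := (hg.differentiableOn (by norm_num) _ (hκS c hcI).1).hasDerivWithinAt
      have := (hgd.comp c hd1.hasDerivWithinAt fun y hy => (hκS y hy).1).hasDerivAt hn
      rw [hv1, mul_zero] at this
      have h3 := hd2.sub this
      rw [sub_zero] at h3
      exact h3
    -- If `v` vanished, the derivative of the branch would kill `(m', 1)`. At a corner of the strip
    -- the ordinate relative to `b` or `t` would be extremal as well, which would force exactly
    -- this.
    have hv2 : v.2 ≠ 0 := by
      intro hv2
      have hJ := (partial_dual H (hE c hcI)).1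
      rw [absJacobian, abs_pos] at hJ
      apply hJ
      rw [hv, fderiv_apply_eq] at hv1 hv2
      simp only [Prod.fst_add, Prod.snd_add, Prod.smul_fst, Prod.smul_snd, smul_eq_mul,
        one_mul] at hv1 hv2
      linear_combination (partialX (M.f i) (m c, c)).1 * hv2 - (partialX (M.f i) (m c, c)).2 * hv1
    constructor
    · refine lt_of_le_of_ne (hκS c hcI).2.1 fun heq => hv2 ?_
      refine IsLocalMin.hasDerivAt_eq_zero ?_ (hcomp b hb)
      filter_upwards [hn] with y hy
      rw [← heq, sub_self]; exact sub_nonneg.2 (hκS y hy).2.1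
    · refine lt_of_le_of_ne (hκS c hcI).2.2 fun heq => hv2 ?_
      refine IsLocalMax.hasDerivAt_eq_zero ?_ (hcomp t ht)
      filter_upwards [hn] with y hy
      rw [heq, sub_self]; exact sub_nonpos.2 (hκS y hy).2.2
  -- Near such a parameter the image stays strictly between `b` and `t`. Leaving the edge would put
  -- it in the interior of `S i`, and the boundary point in the interior of `E i`.
  have hopen : ∀ c ∈ Ioo (0 : ℝ) 1, (κ c).1 = e → ∀ᶠ y in 𝓝 c, (κ y).1 = e := by
    intro c hc hce
    have hn : Icc (0 : ℝ) 1 ∈ 𝓝 c := Icc_mem_nhds hc.1 hc.2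
    obtain ⟨k1, k2⟩ := hcorner c hc hce
    filter_upwards [hn, (hbc.continuousAt hn).eventually_lt (hκc2.continuousAt hn) k1,
      (hκc2.continuousAt hn).eventually_lt (htc.continuousAt hn) k2] with y hy j1 j2
    by_contra hne
    refine hI y hy (H.mem_interior_of_image (hE y hy) ?_)
    rw [hS]
    refine mem_interior_region hb.continuousOn ht.continuousOn ?_ j1 j2
    have hy1 := (hκS y hy).1
    have hy2 := h2 y hy
    rcases he with rfl | rfl
    · exact ⟨lt_of_le_of_ne hy1.1 (Ne.symm hne), lt_of_le_of_ne hy1.2 (by simpa using hy2)⟩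
    · exact ⟨lt_of_le_of_ne hy1.1 (Ne.symm (by simpa using hy2)), lt_of_le_of_ne hy1.2 hne⟩
  -- Otherwise the edge `x = e` of the strip, an infinite set, would be covered by the images of the
  -- two end points of the side.
  have hex : ∃ c ∈ Ioo (0 : ℝ) 1, (κ c).1 = e := by
    by_contra! hno
    have hfin : ((fun η => (e, η)) '' Icc (b e) (t e)).Finite := by
      refine ((Set.finite_singleton (κ 1)).insert (κ 0)).subset ?_
      rintro _ ⟨η, hη, rfl⟩
      have hmem : (e, η) ∈ M.S i := by rw [hS]; exact ⟨heI, hη.1, hη.2⟩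
      obtain ⟨z, hz, hze⟩ := hmem
      obtain ⟨l, r, hlr⟩ := H.exists_strip i
      have hz2 := (hlr.mem_square hz).2
      have hz1 := h1 z hz (by rw [hze])
      have hzκ : κ z.2 = (e, η) := by rw [← hze, hκ]; simp only [← hz1]
      rcases eq_or_lt_of_le hz2.1 with h0 | h0
      · left; change (e, η) = _; rw [← hzκ, ← h0]
      rcases eq_or_lt_of_le hz2.2 with h3 | h3
      · right; change (e, η) = _; rw [← hzκ, h3]
      · exact absurd (by rw [hzκ]) (hno z.2 ⟨h0, h3⟩)
    rw [Set.finite_image_iff (fun x _ y _ h => (Prod.ext_iff.1 h).2)] at hfin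
    exact Set.Icc_infinite (ho e heI).2.1 hfin
  -- The set of parameters mapped to the edge is open, relatively closed and nonempty in a connected
  -- interval.
  have hIoo : Ioo (0 : ℝ) 1 ⊆ {y | y ∈ Ioo (0 : ℝ) 1 ∧ (κ y).1 = e} := by
    obtain ⟨c, hc, hce⟩ := hex
    refine isPreconnected_Ioo.subset_left_of_subset_union
      (v := Ioo 0 1 ∩ (fun y => (κ y).1) ⁻¹' {e}ᶜ) ?_ ?_ ?_ ?_ ⟨c, hc, hc, hce⟩
    · rw [isOpen_iff_mem_nhds]
      rintro y ⟨hy, hye⟩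
      exact inter_mem (isOpen_Ioo.mem_nhds hy) (hopen y hy hye)
    · exact (hκc1.mono Ioo_subset_Icc_self).isOpen_inter_preimage isOpen_Ioo isOpen_compl_singleton
    · rw [Set.disjoint_left]
      rintro y ⟨-, hy⟩ ⟨-, hy'⟩
      exact hy' hy
    · intro y hy
      by_cases h : (κ y).1 = e
      · exact Or.inl ⟨hy, h⟩
      · exact Or.inr ⟨hy, h⟩
  have := Set.EqOn.of_subset_closure (s := Ioo (0 : ℝ) 1) (t := Icc (0 : ℝ) 1)
    (f := fun y => (κ y).1) (g := fun _ => e) (fun y hy => (hIoo hy).2) hκc1 continuousOn_const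
    Ioo_subset_Icc_self (by rw [closure_Ioo zero_ne_one])
  exact fun y hy => this hy

theorem isPreconnected_strip {l r : ℝ → ℝ} {E : Set (ℝ × ℝ)} (h : IsVStrip α l r E) :
    IsPreconnected E := by
  have : E = (fun p : ℝ × ℝ => ((1 - p.1) * l p.2 + p.1 * r p.2, p.2)) ''
      (Icc (0 : ℝ) 1 ×ˢ Icc (0 : ℝ) 1) := by
    ext z
    rw [h.mem_iff]
    constructor
    · rintro ⟨h1, h2, h3⟩
      have hp : 0 < r z.2 - l z.2 := sub_pos.2 (h.lt _ h1)
      refine ⟨((z.1 - l z.2) / (r z.2 - l z.2), z.2), ⟨⟨by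
        apply div_nonneg <;> linarith, by rw [div_le_one hp]; linarith⟩, h1⟩, Prod.ext ?_ rfl⟩
      simp only; field_simp; ring
    · rintro ⟨⟨s, y⟩, ⟨hs, hy⟩, rfl⟩
      have := h.le y hy
      have h0 := hs.1
      have h1 := hs.2
      simp only at *
      exact ⟨hy, by nlinarith, by nlinarith⟩
  rw [this]
  refine (isPreconnected_Icc.prod isPreconnected_Icc).image _ ?_
  have hs : MapsTo Prod.snd (Icc (0 : ℝ) 1 ×ˢ Icc (0 : ℝ) 1) (Icc (0 : ℝ) 1) := fun p hp => hp.2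
  have c1 := h.continuousOn_left.comp continuous_snd.continuousOn hs
  have c2 := h.continuousOn_right.comp continuous_snd.continuousOn hs
  exact ContinuousOn.prodMk (((continuous_const.sub continuous_fst).continuousOn.mul c1).add
    (continuous_fst.continuousOn.mul c2)) continuous_snd.continuousOn

theorem continuousOn_partialX (H : M.IsHyperbolicModel α K₀) (i : ι) :
    ContinuousOn (partialX (M.f i)) (M.E i) := fun z hz => by
  have := ((H.contDiffAt hz).fderiv_right (m := 1) (by norm_num)).continuousAt
  exact (this.clm_apply continuousAt_const).continuousWithinAt

/-- `F₁ₓ` has no zero on the connected set `E i`. Its sign decides whether the branch preserves or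
reverses the horizontal direction. -/
theorem partialX_pos_or_neg (H : M.IsHyperbolicModel α K₀) (i : ι) :
    (∀ z ∈ M.E i, 0 < (partialX (M.f i) z).1) ∨ ∀ z ∈ M.E i, (partialX (M.f i) z).1 < 0 := by
  obtain ⟨l, r, h⟩ := H.exists_strip i
  have hne : ∀ z ∈ M.E i, (partialX (M.f i) z).1 ≠ 0 := fun z hz => by
    have := H.runRate_ne_zero hz (s := 0) (by simpa using H.pos.le)
    simpa [runRate] using this
  have hc : ContinuousOn (fun z => (partialX (M.f i) z).1) (M.E i) :=
    continuous_fst.comp_continuousOn (H.continuousOn_partialX i)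
  have hp := (isPreconnected_strip h).image _ hc
  by_contra! hcon
  obtain ⟨⟨z, hz, hz1⟩, w, hw, hw1⟩ := hcon
  obtain ⟨v, hv, hv0⟩ := hp.ordConnected.out (mem_image_of_mem _ hz) (mem_image_of_mem _ hw)
    (show (0 : ℝ) ∈ Icc _ _ from ⟨hz1, hw1⟩)
  exact hne v hv hv0

/-- `F` maps the left and the right side of `E i` to the two vertical sides of the square. -/
theorem exists_oriented_strip (H : M.IsHyperbolicModel α K₀) (i : ι) :
    ∃ l r, IsVStrip α l r (M.E i) ∧
      (((∀ x x' y : ℝ, (x, y) ∈ M.E i → (x', y) ∈ M.E i → x < x' →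
          (M.f i (x, y)).1 < (M.f i (x', y)).1) ∧
        ∀ y ∈ Icc (0 : ℝ) 1, (M.f i (l y, y)).1 = 0 ∧ (M.f i (r y, y)).1 = 1) ∨
      ((∀ x x' y : ℝ, (x, y) ∈ M.E i → (x', y) ∈ M.E i → x < x' →
          (M.f i (x', y)).1 < (M.f i (x, y)).1) ∧
        ∀ y ∈ Icc (0 : ℝ) 1, (M.f i (l y, y)).1 = 1 ∧ (M.f i (r y, y)).1 = 0)) := by
  obtain ⟨l, r, hl, hr, hd, ho, hE⟩ := H.model.fullHeight i
  have h : IsVStrip α l r (M.E i) := ⟨lipschitz_of_derivWithin_le hl fun y hy => (hd y hy).1,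
    lipschitz_of_derivWithin_le hr fun y hy => (hd y hy).2, fun y hy => (ho y hy).1,
    fun y hy => (ho y hy).2.1, fun y hy => (ho y hy).2.2, hE⟩
  refine ⟨l, r, h, ?_⟩
  have hlI : ∀ y ∈ Icc (0 : ℝ) 1, (l y, y) ∉ interior (M.E i) := fun y _ hy => by
    have hev : ∀ᶠ x in 𝓝 (l y), (x, y) ∈ M.E i := (continuous_id.prodMk continuous_const : Continuous fun x : ℝ => (x, y)).continuousAt
      (x := l y) (mem_interior_iff_mem_nhds.1 hy)
    obtain ⟨x, hx, hx'⟩ := ((hev.filter_mono nhdsWithin_le_nhds).and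
      (self_mem_nhdsWithin (s := Iio (l y)))).exists
    exact absurd (h.mem_iff.1 hx).2.1 (not_le.2 hx')
  have hrI : ∀ y ∈ Icc (0 : ℝ) 1, (r y, y) ∉ interior (M.E i) := fun y _ hy => by
    have hev : ∀ᶠ x in 𝓝 (r y), (x, y) ∈ M.E i := (continuous_id.prodMk continuous_const : Continuous fun x : ℝ => (x, y)).continuousAt
      (x := r y) (mem_interior_iff_mem_nhds.1 hy)
    obtain ⟨x, hx, hx'⟩ := ((hev.filter_mono nhdsWithin_le_nhds).and
      (self_mem_nhdsWithin (s := Ioi (r y)))).exists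
    exact absurd (h.mem_iff.1 hx).2.2 (not_le.2 hx')
  have hchord : ∀ x x' y : ℝ, (x, y) ∈ M.E i → (x', y) ∈ M.E i → x < x' → ∃ ξ ∈ M.E i,
      (M.f i (x', y)).1 - (M.f i (x, y)).1 = (partialX (M.f i) ξ).1 * (x' - x) := by
    intro x x' y hz hz' _
    obtain ⟨hs, ⟨ξ, hξ, h1⟩, -⟩ := H.exists_chord hz hz' (c := 0) (by simpa using H.pos.le)
      (by simp)
    exact ⟨ξ, hs hξ, by simpa [runRate] using h1⟩
  have hld := hl.differentiableOn (by norm_num)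
  have hrd := hr.differentiableOn (by norm_num)
  have hlE := fun y (hy : y ∈ Icc (0 : ℝ) 1) => h.left_mem hy
  have hrE := fun y (hy : y ∈ Icc (0 : ℝ) 1) => h.right_mem hy
  have hl1 : ∀ z ∈ M.E i, z.1 ≠ l z.2 → l z.2 < z.1 := fun z hz hne =>
    lt_of_le_of_ne (h.mem_iff.1 hz).2.1 hne.symm
  have hr1 : ∀ z ∈ M.E i, z.1 ≠ r z.2 → z.1 < r z.2 := fun z hz hne =>
    lt_of_le_of_ne (h.mem_iff.1 hz).2.2 hne
  have hI := fun z (hz : z ∈ M.E i) => (H.image_mem_square hz).1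
  rcases H.partialX_pos_or_neg i with hp | hp
  · have hmono : ∀ x x' y : ℝ, (x, y) ∈ M.E i → (x', y) ∈ M.E i → x < x' →
        (M.f i (x, y)).1 < (M.f i (x', y)).1 := fun x x' y hz hz' hx => by
      obtain ⟨ξ, hξ, he⟩ := hchord x x' y hz hz' hx
      nlinarith [mul_pos (hp ξ hξ) (sub_pos.2 hx)]
    left
    refine ⟨hmono, fun y hy => ?_⟩
    constructor
    -- Strict monotonicity on horizontal lines supplies both conditions of `side_eq`: only the left
    -- side can reach the abscissa `0`, and it cannot reach `1`. The other three cases are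
    -- analogous.
    · refine H.side_eq hld hlE hlI (Or.inl rfl) (fun z hz hz0 => ?_) (fun y hy hy1 => ?_) y hy
      · by_contra hne
        have h2 := (h.mem_iff.1 hz).1
        have := hmono _ _ z.2 (hlE _ h2) hz (hl1 z hz hne)
        have h3 := (hI _ (hlE _ h2)).1
        rw [Prod.mk.eta, hz0] at this
        linarith
      · have := hmono _ _ y (hlE _ hy) (hrE _ hy) (ho y hy).2.1
        have h3 := (hI _ (hrE _ hy)).2
        linarith
    · refine H.side_eq hrd hrE hrI (Or.inr rfl) (fun z hz hz0 => ?_) (fun y hy hy1 => ?_) y hy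
      · by_contra hne
        have h2 := (h.mem_iff.1 hz).1
        have := hmono _ _ z.2 hz (hrE _ h2) (hr1 z hz hne)
        have h3 := (hI _ (hrE _ h2)).2
        rw [Prod.mk.eta, hz0] at this
        linarith
      · have := hmono _ _ y (hlE _ hy) (hrE _ hy) (ho y hy).2.1
        have h3 := (hI _ (hlE _ hy)).1
        linarith
  · have hmono : ∀ x x' y : ℝ, (x, y) ∈ M.E i → (x', y) ∈ M.E i → x < x' →
        (M.f i (x', y)).1 < (M.f i (x, y)).1 := fun x x' y hz hz' hx => by
      obtain ⟨ξ, hξ, he⟩ := hchord x x' y hz hz' hx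
      nlinarith [mul_pos (neg_pos.2 (hp ξ hξ)) (sub_pos.2 hx)]
    right
    refine ⟨hmono, fun y hy => ?_⟩
    constructor
    · refine H.side_eq hld hlE hlI (Or.inr rfl) (fun z hz hz0 => ?_) (fun y hy hy1 => ?_) y hy
      · by_contra hne
        have h2 := (h.mem_iff.1 hz).1
        have := hmono _ _ z.2 (hlE _ h2) hz (hl1 z hz hne)
        have h3 := (hI _ (hlE _ h2)).2
        rw [Prod.mk.eta, hz0] at this
        linarith
      · have := hmono _ _ y (hlE _ hy) (hrE _ hy) (ho y hy).2.1
        have h3 := (hI _ (hrE _ hy)).1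
        linarith
    · refine H.side_eq hrd hrE hrI (Or.inl rfl) (fun z hz hz0 => ?_) (fun y hy hy1 => ?_) y hy
      · by_contra hne
        have h2 := (h.mem_iff.1 hz).1
        have := hmono _ _ z.2 hz (hrE _ h2) (hr1 z hz hne)
        have h3 := (hI _ (hrE _ h2)).1
        rw [Prod.mk.eta, hz0] at this
        linarith
      · have := hmono _ _ y (hlE _ hy) (hrE _ hy) (ho y hy).2.1
        have h3 := (hI _ (hlE _ hy)).2
        linarith

end IsHyperbolicModel

end PiecewiseMap

/-! ### Cylinders are full height strips. -/

namespace IsVStrip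

variable {α : ℝ} {l r : ℝ → ℝ} {E : Set (ℝ × ℝ)}

theorem reflect (h : IsVStrip α l r E) :
    IsVStrip α (fun y => 1 - r y) (fun y => 1 - l y) {z | (1 - z.1, z.2) ∈ E} where
  lip_left y hy y' hy' := by
    rw [sub_sub_sub_cancel_left, abs_sub_comm]; exact h.lip_right y hy y' hy'
  lip_right y hy y' hy' := by
    rw [sub_sub_sub_cancel_left, abs_sub_comm]; exact h.lip_left y hy y' hy'
  nonneg y hy := sub_nonneg.2 (h.le_one y hy)
  lt y hy := sub_lt_sub_left (h.lt y hy) 1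
  le_one y hy := by linarith [h.nonneg y hy]
  eq := by
    ext z
    rw [mem_ofPred_eq, h.mem_iff]
    constructor
    · rintro ⟨h1, h2, h3⟩
      exact ⟨h1, by linarith, by linarith⟩
    · rintro ⟨h1, h2, h3⟩
      exact ⟨h1, by linarith, by linarith⟩

/-- An increasing horizontal curve across the square meets a full height strip in an interval. -/
theorem exists_section (h : IsVStrip α l r E) (h0 : 0 ≤ α) (h1 : α < 1) {A B : ℝ} (hAB : A ≤ B)
    {γ : ℝ → ℝ × ℝ} (hγ : ContinuousOn γ (Icc A B)) (hsq : ∀ x ∈ Icc A B, (γ x).2 ∈ Icc (0 : ℝ) 1)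
    (hcone : ∀ x ∈ Icc A B, ∀ x' ∈ Icc A B, |(γ x').2 - (γ x).2| ≤ α * |(γ x').1 - (γ x).1|)
    (hmono : StrictMonoOn (fun x => (γ x).1) (Icc A B)) (hA : (γ A).1 = 0) (hB : (γ B).1 = 1) :
    ∃ x₁ x₂, A ≤ x₁ ∧ x₁ < x₂ ∧ x₂ ≤ B ∧
      (∀ x ∈ Icc A B, γ x ∈ E ↔ x₁ ≤ x ∧ x ≤ x₂) ∧
      (γ x₁).1 = l (γ x₁).2 ∧ (γ x₂).1 = r (γ x₂).2 := by
  have c1 : ContinuousOn (fun x => (γ x).1) (Icc A B) := continuous_fst.comp_continuousOn hγ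
  have c2 : ContinuousOn (fun x => (γ x).2) (Icc A B) := continuous_snd.comp_continuousOn hγ
  have hA' : A ∈ Icc A B := left_mem_Icc.2 hAB
  have hB' : B ∈ Icc A B := right_mem_Icc.2 hAB
  -- The horizontal distance from the curve to an `α`-Lipschitz side is strictly increasing, because
  -- the side moves by at most `α²` times the progress of the curve. So each side is crossed exactly
  -- once.
  have key : ∀ m : ℝ → ℝ, (∀ y ∈ Icc (0 : ℝ) 1, ∀ y' ∈ Icc (0 : ℝ) 1, |m y - m y'| ≤ α * |y - y'|) →
      (∀ y ∈ Icc (0 : ℝ) 1, 0 ≤ m y ∧ m y ≤ 1) → ContinuousOn m (Icc 0 1) →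
      ∃ x₁ ∈ Icc A B, (γ x₁).1 - m (γ x₁).2 = 0 ∧
        StrictMonoOn (fun x => (γ x).1 - m (γ x).2) (Icc A B) := by
    intro m hm hm' hmc
    have hc : ContinuousOn (fun x => (γ x).1 - m (γ x).2) (Icc A B) := c1.sub (hmc.comp c2 hsq)
    obtain ⟨x, hx, hx0⟩ := intermediate_value_Icc hAB hc (show (0 : ℝ) ∈ Icc _ _ from
      ⟨by rw [hA]; linarith [(hm' _ (hsq A hA')).1], by rw [hB]; linarith [(hm' _ (hsq B hB')).2]⟩)
    refine ⟨x, hx, hx0, fun a ha b hb hab => ?_⟩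
    have k1 : (γ a).1 < (γ b).1 := hmono ha hb hab
    have k2 := hcone a ha b hb
    rw [abs_of_pos (sub_pos.2 k1)] at k2
    have k3 := (abs_le.1 (hm _ (hsq b hb) _ (hsq a ha))).2
    have k4 := mul_le_mul_of_nonneg_left k2 h0
    have k5 : α * (α * ((γ b).1 - (γ a).1)) < (γ b).1 - (γ a).1 := by
      have : 0 < (γ b).1 - (γ a).1 := sub_pos.2 k1
      have h2 := mul_lt_of_lt_one_left this h1
      have h3 := mul_le_of_le_one_left (mul_nonneg h0 this.le) h1.le
      linarith
    change (γ a).1 - m (γ a).2 < (γ b).1 - m (γ b).2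
    linarith
  obtain ⟨x₁, hx₁, e₁, m₁⟩ := key l h.lip_left
    (fun y hy => ⟨h.nonneg y hy, (h.le y hy).trans (h.le_one y hy)⟩) h.continuousOn_left
  obtain ⟨x₂, hx₂, e₂, m₂⟩ := key r h.lip_right
    (fun y hy => ⟨(h.nonneg y hy).trans (h.le y hy), h.le_one y hy⟩) h.continuousOn_right
  refine ⟨x₁, x₂, hx₁.1, ?_, hx₂.2, fun x hx => ?_, by linarith, by linarith⟩
  · rw [← m₂.lt_iff_lt hx₁ hx₂]
    change (γ x₁).1 - r (γ x₁).2 < (γ x₂).1 - r (γ x₂).2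
    linarith [h.lt _ (hsq x₁ hx₁)]
  · rw [← m₁.le_iff_le hx₁ hx, ← m₂.le_iff_le hx hx₂, h.mem_iff]
    simp only [e₁, e₂, sub_nonneg, sub_nonpos]
    exact ⟨fun h => h.2, fun h => ⟨hsq x hx, h⟩⟩

end IsVStrip

namespace PiecewiseMap

variable {ι : Type*} {M : PiecewiseMap ι} {α K₀ : ℝ}

/-- The composition of the first `n` branches along the itinerary `x`. -/
def iter (M : PiecewiseMap ι) : ℕ → (ℕ → ι) → ℝ × ℝ → ℝ × ℝ
  | 0, _, z => z
  | n + 1, x, z => M.iter n (shiftOne x) (M.f (x 0) z)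

namespace IsHyperbolicModel

theorem mem_square_of_mem_E (H : M.IsHyperbolicModel α K₀) {i : ι} {z : ℝ × ℝ} (hz : z ∈ M.E i) :
    z ∈ unitSquare := by
  obtain ⟨l, r, h⟩ := H.exists_strip i
  exact h.mem_square hz

theorem cylE_subset_square (H : M.IsHyperbolicModel α K₀) (n : ℕ) (x : ℕ → ι) :
    M.cylE n x ⊆ unitSquare := by
  cases n with
  | zero => exact subset_rfl
  | succ n => exact fun z hz => H.mem_square_of_mem_E hz.1

/-- Horizontally related points of a cylinder of length `n` are `K₀⁻ⁿ`-close. -/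
theorem cylE_width (H : M.IsHyperbolicModel α K₀) (n : ℕ) (x : ℕ → ι) {z z' : ℝ × ℝ}
    (hz : z ∈ M.cylE n x) (hz' : z' ∈ M.cylE n x) (hh : |z'.2 - z.2| ≤ α * |z'.1 - z.1|) :
    K₀ ^ n * |z'.1 - z.1| ≤ 1 := by
  induction n generalizing x z z' with
  | zero =>
    have h1 : z.1 ∈ Icc (0 : ℝ) 1 := hz.1
    have h2 : z'.1 ∈ Icc (0 : ℝ) 1 := hz'.1
    rw [pow_zero, one_mul, abs_le]
    constructor <;> linarith [h1.1, h1.2, h2.1, h2.2]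
  | succ n ih =>
    obtain ⟨h1, h2⟩ := H.cone_expand hz.1 hz'.1 hh
    refine le_trans ?_ (ih _ hz.2 hz'.2 h1)
    rw [pow_succ, mul_assoc]
    have := H.one_lt
    gcongr

/-- Cylinders are full height strips, whose sides are mapped into the vertical sides of the
square. -/
theorem cylE_strip (H : M.IsHyperbolicModel α K₀) (n : ℕ) (x : ℕ → ι) :
    ∃ l r, IsVStrip α l r (M.cylE n x) ∧ ∀ y ∈ Icc (0 : ℝ) 1,
      (M.iter n x (l y, y)).1 ∈ ({0, 1} : Set ℝ) ∧ (M.iter n x (r y, y)).1 ∈ ({0, 1} : Set ℝ) := by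
  induction n generalizing x with
  | zero =>
    refine ⟨fun _ => 0, fun _ => 1, ⟨?_, ?_, ?_, ?_, ?_, ?_⟩, ?_⟩
    · intro y _ y' _; simpa using mul_nonneg H.pos.le (abs_nonneg _)
    · intro y _ y' _; simpa using mul_nonneg H.pos.le (abs_nonneg _)
    · simp
    · simp
    · simp
    · ext z
      simp only [cylE, unitSquare, mem_prod, mem_Icc, mem_ofPred_eq]; tauto
    · simp [iter]
  | succ n ih =>
    obtain ⟨l, r, hs, he⟩ := ih (shiftOne x)
    obtain ⟨l₀, r₀, h₀, hor⟩ := H.exists_oriented_strip (x 0)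
    have hI : ∀ y ∈ Icc (0 : ℝ) 1, ∀ t ∈ Icc (l₀ y) (r₀ y), (t, y) ∈ M.E (x 0) :=
      fun y hy t ht => h₀.mem_iff.2 ⟨hy, ht⟩
    have hγc : ∀ y ∈ Icc (0 : ℝ) 1, ContinuousOn (fun t => M.f (x 0) (t, y)) (Icc (l₀ y) (r₀ y)) :=
      fun y hy => (H.continuousOn (x 0)).comp
        (continuous_id.prodMk continuous_const).continuousOn (hI y hy)
    have hsq : ∀ y ∈ Icc (0 : ℝ) 1, ∀ t ∈ Icc (l₀ y) (r₀ y),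
        (M.f (x 0) (t, y)).2 ∈ Icc (0 : ℝ) 1 :=
      fun y hy t ht => (H.image_mem_square (hI y hy t ht)).2
    have hcone : ∀ y ∈ Icc (0 : ℝ) 1, ∀ t ∈ Icc (l₀ y) (r₀ y), ∀ t' ∈ Icc (l₀ y) (r₀ y),
        |(M.f (x 0) (t', y)).2 - (M.f (x 0) (t, y)).2| ≤
          α * |(M.f (x 0) (t', y)).1 - (M.f (x 0) (t, y)).1| := fun y hy t ht t' ht' =>
      (H.cone_expand (hI y hy t ht) (hI y hy t' ht')
        (by simpa using mul_nonneg H.pos.le (abs_nonneg _))).1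
    -- `m₁` and `m₂` are the sides of the shorter cylinder, in the order in which the image of a
    -- horizontal segment of `E` meets them.
    have key : ∃ m₁ m₂ : ℝ → ℝ,
        (∀ y ∈ Icc (0 : ℝ) 1, ∀ y' ∈ Icc (0 : ℝ) 1, |m₁ y - m₁ y'| ≤ α * |y - y'|) ∧
        (∀ y ∈ Icc (0 : ℝ) 1, ∀ y' ∈ Icc (0 : ℝ) 1, |m₂ y - m₂ y'| ≤ α * |y - y'|) ∧
        (∀ y ∈ Icc (0 : ℝ) 1, (M.iter n (shiftOne x) (m₁ y, y)).1 ∈ ({0, 1} : Set ℝ) ∧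
          (M.iter n (shiftOne x) (m₂ y, y)).1 ∈ ({0, 1} : Set ℝ)) ∧
        ∀ y ∈ Icc (0 : ℝ) 1, ∃ x₁ x₂, l₀ y ≤ x₁ ∧ x₁ < x₂ ∧ x₂ ≤ r₀ y ∧
          (∀ t ∈ Icc (l₀ y) (r₀ y), M.f (x 0) (t, y) ∈ M.cylE n (shiftOne x) ↔ x₁ ≤ t ∧ t ≤ x₂) ∧
          (M.f (x 0) (x₁, y)).1 = m₁ (M.f (x 0) (x₁, y)).2 ∧
          (M.f (x 0) (x₂, y)).1 = m₂ (M.f (x 0) (x₂, y)).2 := by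
      rcases hor with ⟨hm, hor⟩ | ⟨hm, hor⟩
      · refine ⟨l, r, hs.lip_left, hs.lip_right, he, fun y hy => ?_⟩
        exact hs.exists_section H.pos.le H.lt_one (h₀.le y hy) (hγc y hy) (hsq y hy) (hcone y hy)
          (fun t ht t' ht' => hm t t' y (hI y hy t ht) (hI y hy t' ht')) (hor y hy).1 (hor y hy).2
      -- For an orientation reversing branch the reflection `x ↦ 1 - x` reduces to an increasing
      -- curve.
      · refine ⟨r, l, hs.lip_right, hs.lip_left, fun y hy => (he y hy).symm, fun y hy => ?_⟩
        obtain ⟨x₁, x₂, k1, k2, k3, k4, k5, k6⟩ := hs.reflect.exists_section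
          (γ := fun t => (1 - (M.f (x 0) (t, y)).1, (M.f (x 0) (t, y)).2)) H.pos.le H.lt_one
          (h₀.le y hy)
          ((continuousOn_const.sub (continuous_fst.comp_continuousOn (hγc y hy))).prodMk
            (continuous_snd.comp_continuousOn (hγc y hy))) (hsq y hy)
          (fun t ht t' ht' => by
            simp only [sub_sub_sub_cancel_left]
            rw [abs_sub_comm (M.f (x 0) (t, y)).1]
            exact hcone y hy t ht t' ht')
          (fun t ht t' ht' htt => by
            have := hm t t' y (hI y hy t ht) (hI y hy t' ht') htt
            simp only; linarith)
          (by simp only; rw [(hor y hy).1, sub_self]) (by simp only; rw [(hor y hy).2, sub_zero])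
        refine ⟨x₁, x₂, k1, k2, k3, fun t ht => ?_, by simpa using k5, by simpa using k6⟩
        rw [← k4 t ht]; simp
    obtain ⟨m₁, m₂, hm₁, hm₂, hm, hex⟩ := key
    choose! L R hL hLR hR hmem heL heR using hex
    have hLI : ∀ y ∈ Icc (0 : ℝ) 1, L y ∈ Icc (l₀ y) (r₀ y) := fun y hy =>
      ⟨hL y hy, (hLR y hy).le.trans (hR y hy)⟩
    have hRI : ∀ y ∈ Icc (0 : ℝ) 1, R y ∈ Icc (l₀ y) (r₀ y) := fun y hy =>
      ⟨(hL y hy).trans (hLR y hy).le, hR y hy⟩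
    refine ⟨L, R, ⟨?_, ?_, ?_, hLR, ?_, ?_⟩, ?_⟩
    -- Points of the new side are mapped to one old side, so they are vertically related, and this
    -- relation passes to preimages.
    · intro y hy y' hy'
      refine (H.cone_contract (i := x 0) (z := (L y', y')) (z' := (L y, y)) (hI _ hy' _ (hLI y' hy'))
        (hI _ hy _ (hLI y hy)) ?_).1
      rw [heL y hy, heL y' hy']
      exact hm₁ _ (hsq y hy _ (hLI y hy)) _ (hsq y' hy' _ (hLI y' hy'))
    · intro y hy y' hy'
      refine (H.cone_contract (i := x 0) (z := (R y', y')) (z' := (R y, y)) (hI _ hy' _ (hRI y' hy'))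
        (hI _ hy _ (hRI y hy)) ?_).1
      rw [heR y hy, heR y' hy']
      exact hm₂ _ (hsq y hy _ (hRI y hy)) _ (hsq y' hy' _ (hRI y' hy'))
    · exact fun y hy => (h₀.nonneg y hy).trans (hL y hy)
    · exact fun y hy => (hR y hy).trans (h₀.le_one y hy)
    · ext z
      simp only [cylE, mem_inter_iff, mem_preimage, mem_ofPred_eq]
      constructor
      · rintro ⟨h1, h2⟩
        obtain ⟨j1, j2⟩ := h₀.mem_iff.1 h1
        exact ⟨j1, (hmem z.2 j1 z.1 j2).1 h2⟩
      · rintro ⟨j1, j2⟩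
        have j3 : z.1 ∈ Icc (l₀ z.2) (r₀ z.2) :=
          ⟨(hL _ j1).trans j2.1, j2.2.trans (hR _ j1)⟩
        exact ⟨hI z.2 j1 z.1 j3, (hmem z.2 j1 z.1 j3).2 j2⟩
    · intro y hy
      have h1 := (hm _ (hsq y hy _ (hLI y hy))).1
      have h2 := (hm _ (hsq y hy _ (hRI y hy))).2
      rw [← heL y hy] at h1
      rw [← heR y hy] at h2
      exact ⟨h1, h2⟩

theorem cylE_isCompact (H : M.IsHyperbolicModel α K₀) (n : ℕ) (x : ℕ → ι) :
    IsCompact (M.cylE n x) := by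
  obtain ⟨l, r, h, -⟩ := H.cylE_strip n x
  exact h.isCompact

/-- Two points of a cylinder of length `n` differ horizontally little more than vertically. -/
theorem abs_fst_sub_le (H : M.IsHyperbolicModel α K₀) {n : ℕ} {x : ℕ → ι} {z z' : ℝ × ℝ}
    (hz : z ∈ M.cylE n x) (hz' : z' ∈ M.cylE n x) :
    |z.1 - z'.1| ≤ α * |z.2 - z'.2| + K₀⁻¹ ^ n := by
  obtain ⟨l, r, h, -⟩ := H.cylE_strip n x
  refine h.abs_fst_sub_le (fun y hy => ?_) hz hz'
  have := H.cylE_width n x (h.left_mem hy) (h.right_mem hy)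
    (by simpa using mul_nonneg H.pos.le (abs_nonneg _))
  have hK : 0 < K₀ ^ n := pow_pos (zero_lt_one.trans H.one_lt) n
  rw [inv_pow, ← one_div, le_div_iff₀ hK]
  simp only at this
  rw [abs_of_nonneg (sub_nonneg.2 (h.le y hy))] at this
  linarith

/-- Two points of a strip of length `n` differ vertically little more than horizontally. -/
theorem abs_snd_sub_le (H : M.IsHyperbolicModel α K₀) {n : ℕ} {p : ℕ → ι} {z z' : ℝ × ℝ}
    (hz : z ∈ M.cylS n p) (hz' : z' ∈ M.cylS n p) :
    |z.2 - z'.2| ≤ α * |z.1 - z'.1| + K₀⁻¹ ^ n :=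
  H.dual.abs_fst_sub_le ((swap_mem_cylE_dual H n p z).2 hz) ((swap_mem_cylE_dual H n p z').2 hz')

theorem cylS_isCompact (H : M.IsHyperbolicModel α K₀) (n : ℕ) (p : ℕ → ι) :
    IsCompact (M.cylS n p) := by
  have h := (H.dual.cylE_isCompact n p).image continuous_swap
  convert h using 1
  ext z
  rw [← swap_mem_cylE_dual H, image_swap_eq_preimage_swap, mem_preimage]

end IsHyperbolicModel

end PiecewiseMap

/-! ### Regularity of slopes and of expansion rates, from the distortion condition. -/

/-- A function with bounded partial derivatives on a curvilinear rectangle is Lipschitz. -/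
theorem IsFullHeight.abs_sub_le {α : ℝ} {E : Set (ℝ × ℝ)} (hE : IsFullHeight α E)
    (h1 : α ≤ 1) {g : ℝ × ℝ → ℝ} {B : ℝ} (hB : 0 ≤ B) (hg : ∀ z ∈ E, DifferentiableAt ℝ g z)
    (hx : ∀ z ∈ E, |fderiv ℝ g z (1, 0)| ≤ B) (hy : ∀ z ∈ E, |fderiv ℝ g z (0, 1)| ≤ B)
    {z z' : ℝ × ℝ} (hz : z ∈ E) (hz' : z' ∈ E) : |g z' - g z| ≤ 4 * B * ‖z' - z‖ := by
  obtain ⟨l, r, hl, hr, hd, ho, rfl⟩ := hE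
  obtain ⟨z1, z2, z3⟩ := hz
  obtain ⟨w1, w2, w3⟩ := hz'
  have hpos : 0 < r z.2 - l z.2 := sub_pos.2 (ho _ z1).2.1
  -- As the region need not be convex, the path follows the curve dividing each section in the ratio
  -- of `z`, then a horizontal segment. The curve contributes `2B`. The segment contributes `2B`
  -- too, since its length is at most the sum of the horizontal and vertical displacements.
  set t := (z.1 - l z.2) / (r z.2 - l z.2) with ht
  have ht0 : 0 ≤ t := div_nonneg (by linarith) hpos.le
  have ht1 : 0 ≤ 1 - t := by rw [sub_nonneg, ht, div_le_one hpos]; linarith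
  set k : ℝ → ℝ := fun η => (1 - t) * l η + t * r η with hk
  have hkz : k z.2 = z.1 := by rw [hk, ht]; field_simp; ring
  have hkm : ∀ η ∈ Icc (0 : ℝ) 1, l η ≤ k η ∧ k η ≤ r η := fun η hη => by
    have := (ho η hη).2.1
    simp only [hk]
    constructor <;> nlinarith
  set σ : ℝ → ℝ := fun η => (1 - t) * derivWithin l (Icc 0 1) η + t * derivWithin r (Icc 0 1) η
  have hkd : ∀ η ∈ Icc (0 : ℝ) 1, HasDerivWithinAt k (σ η) (Icc 0 1) η := fun η hη =>
    ((hl.differentiableOn (by norm_num) η hη).hasDerivWithinAt.const_mul _).add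
      ((hr.differentiableOn (by norm_num) η hη).hasDerivWithinAt.const_mul _)
  have hσ : ∀ η ∈ Icc (0 : ℝ) 1, |σ η| ≤ 1 := fun η hη => by
    obtain ⟨d1, d2⟩ := hd η hη
    refine (abs_add_le _ _).trans ?_
    rw [abs_mul, abs_mul, abs_of_nonneg ht0, abs_of_nonneg ht1]
    nlinarith
  have hκd : ∀ η ∈ Icc (0 : ℝ) 1, HasDerivWithinAt (fun η => g (k η, η))
      (fderiv ℝ g (k η, η) (σ η, 1)) (Icc 0 1) η := fun η hη =>
    HasFDerivAt.comp_hasDerivWithinAt (f := fun η => (k η, η)) η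
      (hg (k η, η) ⟨hη, hkm η hη⟩).hasFDerivAt ((hkd η hη).prodMk (hasDerivWithinAt_id η _))
  have hκb : ∀ η ∈ Icc (0 : ℝ) 1, ‖fderiv ℝ g (k η, η) (σ η, 1)‖ ≤ 2 * B := fun η hη => by
    have e : ((σ η, 1) : ℝ × ℝ) = σ η • ((1 : ℝ), (0 : ℝ)) + ((0 : ℝ), (1 : ℝ)) := by
      ext <;> simp
    rw [e, map_add, map_smul, smul_eq_mul, Real.norm_eq_abs]
    refine (abs_add_le _ _).trans ?_
    rw [abs_mul]
    have a1 := hx (k η, η) ⟨hη, hkm η hη⟩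
    have a2 := hy (k η, η) ⟨hη, hkm η hη⟩
    nlinarith [mul_le_mul (hσ η hη) a1 (abs_nonneg _) zero_le_one]
  have s1 := (convex_Icc (0 : ℝ) 1).norm_image_sub_le_of_norm_hasDerivWithin_le hκd hκb z1 w1
  have s2 := (convex_Icc (0 : ℝ) 1).norm_image_sub_le_of_norm_hasDerivWithin_le hkd
    (C := 1) hσ z1 w1
  have hh : ∀ x ∈ Icc (l z'.2) (r z'.2), HasDerivWithinAt (fun x => g (x, z'.2))
      (fderiv ℝ g (x, z'.2) (1, 0)) (Icc (l z'.2) (r z'.2)) x := fun x hx =>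
    HasFDerivAt.comp_hasDerivWithinAt (f := fun x => (x, z'.2)) x
      (hg (x, z'.2) ⟨w1, hx⟩).hasFDerivAt ((hasDerivWithinAt_id x _).prodMk (hasDerivWithinAt_const x _ z'.2))
  have s3 := (convex_Icc (l z'.2) (r z'.2)).norm_image_sub_le_of_norm_hasDerivWithin_le hh
    (fun x hx' => hx (x, z'.2) ⟨w1, hx'⟩) (hkm z'.2 w1) ⟨w2, w3⟩
  simp only [hkz, Real.norm_eq_abs, Prod.mk.eta] at s1 s2 s3
  have n1 : |z'.1 - z.1| ≤ ‖z' - z‖ := norm_fst_le (z' - z)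
  have n2 : |z'.2 - z.2| ≤ ‖z' - z‖ := norm_snd_le (z' - z)
  have t1 : |g z' - g z| ≤ |g z' - g (k z'.2, z'.2)| + |g (k z'.2, z'.2) - g z| :=
    _root_.abs_sub_le _ _ _
  have t2 : |z'.1 - k z'.2| ≤ |z'.1 - z.1| + |z.1 - k z'.2| := _root_.abs_sub_le _ _ _
  rw [abs_sub_comm z.1] at t2
  nlinarith [mul_le_mul_of_nonneg_left t2 hB]

namespace PiecewiseMap

variable {ι : Type*} {M : PiecewiseMap ι} {α K₀ C₀ : ℝ}

namespace IsHyperbolicModel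

theorem norm_partialX (H : M.IsHyperbolicModel α K₀) {i : ι} {z : ℝ × ℝ} (hz : z ∈ M.E i) :
    ‖partialX (M.f i) z‖ = |(partialX (M.f i) z).1| := by
  rw [Prod.norm_def, Real.norm_eq_abs, Real.norm_eq_abs, max_eq_left]
  refine (H.abs_partial_le hz).2.trans (mul_le_of_le_one_left (abs_nonneg _) H.lt_one.le)

theorem partialX_ne_zero (H : M.IsHyperbolicModel α K₀) {i : ι} {z : ℝ × ℝ} (hz : z ∈ M.E i) :
    0 < |(partialX (M.f i) z).1| := by
  have := H.runRate_ne_zero hz (s := 0) (by simpa using H.pos.le)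
  rw [abs_pos]
  simpa [runRate] using this

theorem differentiableAt_fderiv (H : M.IsHyperbolicModel α K₀) {i : ι} {z : ℝ × ℝ}
    (hz : z ∈ M.E i) : DifferentiableAt ℝ (fderiv ℝ (M.f i)) z :=
  ((H.contDiffAt hz).fderiv_right (m := 1) (by norm_num)).differentiableAt (by norm_num)

theorem fderiv_partial (H : M.IsHyperbolicModel α K₀) {i : ι} {z : ℝ × ℝ} (hz : z ∈ M.E i)
    (v : ℝ × ℝ) : HasFDerivAt (fun z => fderiv ℝ (M.f i) z v)
      ((fderiv ℝ (fderiv ℝ (M.f i)) z).flip v) z := by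
  simpa using (H.differentiableAt_fderiv hz).hasFDerivAt.clm_apply (hasFDerivAt_const v z)

/-- All second partial derivatives are controlled by the distortion constant. -/
theorem second_partial_le (H : M.IsHyperbolicModel α K₀) (hD : M.Distortion C₀) {i : ι}
    {z : ℝ × ℝ} (hz : z ∈ M.E i) :
    0 < C₀ ∧
    ∀ u ∈ ({(1, 0), (0, 1)} : Set (ℝ × ℝ)), ∀ v ∈ ({(1, 0), (0, 1)} : Set (ℝ × ℝ)),
      ‖fderiv ℝ (fderiv ℝ (M.f i)) z u v‖ ≤ C₀ * |(partialX (M.f i) z).1| := by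
  have h := hD i z hz
  rw [H.norm_partialX hz, div_lt_iff₀ (H.partialX_ne_zero hz)] at h
  -- `maxSecondPartial` contains one mixed derivative; symmetry supplies the other.
  have hsymm : IsSymmSndFDerivAt ℝ (M.f i) z := (H.contDiffAt hz).isSymmSndFDerivAt (by simp)
  have e1 : partialX (partialX (M.f i)) z = fderiv ℝ (fderiv ℝ (M.f i)) z (1, 0) (1, 0) := by
    rw [partialX, show partialX (M.f i) = fun z => fderiv ℝ (M.f i) z (1, 0) from rfl,
      (H.fderiv_partial hz (1, 0)).fderiv]; rfl
  have e2 : partialY (partialX (M.f i)) z = fderiv ℝ (fderiv ℝ (M.f i)) z (0, 1) (1, 0) := by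
    rw [partialY, show partialX (M.f i) = fun z => fderiv ℝ (M.f i) z (1, 0) from rfl,
      (H.fderiv_partial hz (1, 0)).fderiv]; rfl
  have e3 : partialY (partialY (M.f i)) z = fderiv ℝ (fderiv ℝ (M.f i)) z (0, 1) (0, 1) := by
    rw [partialY, show partialY (M.f i) = fun z => fderiv ℝ (M.f i) z (0, 1) from rfl,
      (H.fderiv_partial hz (0, 1)).fderiv]; rfl
  rw [maxSecondPartial, e1, e2, e3, max_lt_iff, max_lt_iff] at h
  obtain ⟨h1, h2, h3⟩ := h
  have hpos := H.partialX_ne_zero hz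
  refine ⟨(pos_iff_pos_of_mul_pos ((norm_nonneg _).trans_lt h1)).2 hpos, ?_⟩
  rintro u (rfl | rfl) v (rfl | rfl)
  · exact h1.le
  · rw [hsymm.eq]; exact h2.le
  · exact h2.le
  · exact h3.le

end IsHyperbolicModel

end PiecewiseMap

namespace PiecewiseMap

variable {ι : Type*} {M : PiecewiseMap ι} {α K₀ C₀ : ℝ}

namespace IsHyperbolicModel

/-- The bounds are relative to the expansion rate itself, since `|F₁ₓ|` is comparable with it inside
the cone. This keeps the estimates for the logarithm and the quotient uniform even if the
derivatives of the branches are unbounded. -/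
theorem rates_hasFDerivAt (H : M.IsHyperbolicModel α K₀) (hD : M.Distortion C₀) {i : ι}
    {z : ℝ × ℝ} (hz : z ∈ M.E i) {s : ℝ} (hs : |s| ≤ α) :
    ∃ L₁ L₂ : ℝ × ℝ →L[ℝ] ℝ, HasFDerivAt (fun z => runRate (M.f i) z s) L₁ z ∧
      HasFDerivAt (fun z => riseRate (M.f i) z s) L₂ z ∧
      ∀ u ∈ ({(1, 0), (0, 1)} : Set (ℝ × ℝ)),
        |L₁ u| ≤ 2 * C₀ / (1 - α ^ 2) * |runRate (M.f i) z s| ∧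
        |L₂ u| ≤ 2 * C₀ / (1 - α ^ 2) * |runRate (M.f i) z s| := by
  obtain ⟨hC, hb⟩ := H.second_partial_le hD hz
  have hd := H.fderiv_partial hz (1, s)
  have hrw : (fun z => fderiv ℝ (M.f i) z (1, s)) =
      fun z => (runRate (M.f i) z s, riseRate (M.f i) z s) := by
    ext1 z; exact fderiv_apply_one _ _ _
  rw [hrw] at hd
  set L := (fderiv ℝ (fderiv ℝ (M.f i)) z).flip (1, s) with hL
  refine ⟨_, _, hd.fst, hd.snd, fun u hu => ?_⟩
  have hLu : ‖L u‖ ≤ 2 * C₀ / (1 - α ^ 2) * |runRate (M.f i) z s| := by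
    have e : L u = fderiv ℝ (fderiv ℝ (M.f i)) z u (1, 0) +
        s • fderiv ℝ (fderiv ℝ (M.f i)) z u (0, 1) := by
      rw [hL, ContinuousLinearMap.flip_apply, ← map_smul, ← map_add]
      congr 1; ext <;> simp
    have b1 := hb u hu (1, 0) (by simp)
    have b2 := hb u hu (0, 1) (by simp)
    have b3 := H.partialX_le_runRate hz hs
    have h2 := H.one_sub_sq_pos
    have hm : 0 ≤ C₀ * |(partialX (M.f i) z).1| := (norm_nonneg _).trans b1
    calc ‖L u‖ ≤ C₀ * |(partialX (M.f i) z).1| + 1 * (C₀ * |(partialX (M.f i) z).1|) := by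
          rw [e]
          refine (norm_add_le _ _).trans (add_le_add b1 ?_)
          rw [norm_smul]
          exact mul_le_mul (hs.trans H.lt_one.le) b2 (norm_nonneg _) zero_le_one
      _ = 2 * C₀ / (1 - α ^ 2) * ((1 - α ^ 2) * |(partialX (M.f i) z).1|) := by
          field_simp; ring
      _ ≤ _ := by gcongr
  exact ⟨(norm_fst_le (L u)).trans hLu, (norm_snd_le (L u)).trans hLu⟩

/-- No absolute value is needed for orientation reversing branches, as `Real.log` ignores the sign.
-/
theorem log_runRate_lipschitz (H : M.IsHyperbolicModel α K₀) (hD : M.Distortion C₀) {i : ι}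
    {z z' : ℝ × ℝ} (hz : z ∈ M.E i) (hz' : z' ∈ M.E i) {s : ℝ} (hs : |s| ≤ α) :
    |Real.log (runRate (M.f i) z' s) - Real.log (runRate (M.f i) z s)| ≤
      4 * (2 * C₀ / (1 - α ^ 2)) * ‖z' - z‖ := by
  have hC := (H.second_partial_le hD hz).1
  have hα := H.one_sub_sq_pos
  have key : ∀ w ∈ M.E i, ∃ L : ℝ × ℝ →L[ℝ] ℝ,
      HasFDerivAt (fun z => Real.log (runRate (M.f i) z s)) L w ∧
      ∀ u ∈ ({(1, 0), (0, 1)} : Set (ℝ × ℝ)), |L u| ≤ 2 * C₀ / (1 - α ^ 2) := fun w hw => by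
    obtain ⟨L₁, L₂, h1, -, h3⟩ := H.rates_hasFDerivAt hD hw hs
    have hne := H.runRate_ne_zero hw hs
    refine ⟨_, h1.log hne, fun u hu => ?_⟩
    rw [smul_apply, smul_eq_mul, abs_mul, abs_inv, inv_mul_le_iff₀
      (abs_pos.2 hne), mul_comm]
    exact (h3 u hu).1
  refine (H.model.fullHeight i).abs_sub_le (B := 2 * C₀ / (1 - α ^ 2))
    (g := fun z => Real.log (runRate (M.f i) z s)) H.lt_one.le (by positivity)
    (fun w hw => ?_) (fun w hw => ?_) (fun w hw => ?_) hz hz' <;> obtain ⟨L, h1, h2⟩ := key w hw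
  · exact h1.differentiableAt
  · rw [h1.fderiv]; exact h2 _ (by simp)
  · rw [h1.fderiv]; exact h2 _ (by simp)

theorem slopeMap_lipschitz (H : M.IsHyperbolicModel α K₀) (hD : M.Distortion C₀) {i : ι}
    {z z' : ℝ × ℝ} (hz : z ∈ M.E i) (hz' : z' ∈ M.E i) {s : ℝ} (hs : |s| ≤ α) :
    |slopeMap (M.f i) z' s - slopeMap (M.f i) z s| ≤
      4 * (2 * (2 * C₀ / (1 - α ^ 2))) * ‖z' - z‖ := by
  have hC := (H.second_partial_le hD hz).1
  have hα := H.one_sub_sq_pos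
  set R := 2 * C₀ / (1 - α ^ 2) with hR
  have hR0 : 0 ≤ R := by positivity
  have key : ∀ w ∈ M.E i, ∃ L : ℝ × ℝ →L[ℝ] ℝ,
      HasFDerivAt (fun z => slopeMap (M.f i) z s) L w ∧
      ∀ u ∈ ({(1, 0), (0, 1)} : Set (ℝ × ℝ)), |L u| ≤ 2 * R := fun w hw => by
    obtain ⟨L₁, L₂, h1, h2, h3⟩ := H.rates_hasFDerivAt hD hw hs
    have hne := H.runRate_ne_zero hw hs
    have hq := (HasFDerivAt.comp w ((hasDerivAt_inv hne).hasFDerivAt) h1)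
    have hm := h2.mul hq
    refine ⟨_, hm.congr_of_eventuallyEq (Eventually.of_forall fun x => ?_), fun u hu => ?_⟩
    · simp [slopeMap, div_eq_mul_inv]
    obtain ⟨b1, b2⟩ := h3 u hu
    have b3 := (H.abs_riseRate_le hw hs).trans
      (mul_le_of_le_one_left (abs_nonneg _) H.lt_one.le)
    set D := runRate (M.f i) w s
    set N := riseRate (M.f i) w s
    have hDp : 0 < |D| := abs_pos.2 hne
    have e : ∀ x y : ℝ, N * (x * -(D ^ 2)⁻¹) + D⁻¹ * y = (y - N / D * x) / D := fun x y => by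
      field_simp; ring
    simp only [add_apply, smul_apply, smul_eq_mul,
      ContinuousLinearMap.comp_apply, ContinuousLinearMap.toSpanSingleton_apply, Function.comp]
    rw [e, abs_div, div_le_iff₀ hDp]
    have b4 : |N / D| ≤ 1 := by rw [abs_div, div_le_one hDp]; exact b3
    have := abs_sub (L₂ u) (N / D * L₁ u)
    rw [abs_mul] at this
    nlinarith [mul_le_mul b4 b1 (abs_nonneg _) zero_le_one]
  refine (H.model.fullHeight i).abs_sub_le (B := 2 * R)
    (g := fun z => slopeMap (M.f i) z s) H.lt_one.le (by positivity)
    (fun w hw => ?_) (fun w hw => ?_) (fun w hw => ?_) hz hz' <;> obtain ⟨L, h1, h2⟩ := key w hw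
  · exact h1.differentiableAt
  · rw [h1.fderiv]; exact h2 _ (by simp)
  · rw [h1.fderiv]; exact h2 _ (by simp)

/-- The slope map contracts slopes in the cone. -/
theorem slopeMap_contract (H : M.IsHyperbolicModel α K₀) {i : ι} {z : ℝ × ℝ} (hz : z ∈ M.E i)
    {s s' : ℝ} (hs : |s| ≤ α) (hs' : |s'| ≤ α) :
    |slopeMap (M.f i) z s' - slopeMap (M.f i) z s| ≤ 1 / (K₀ ^ 2 * (1 - α ^ 2)) * |s' - s| := by
  have n1 := H.runRate_ne_zero hz hs
  have n2 := H.runRate_ne_zero hz hs'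
  -- The difference formula for a Möbius map. One factor `K₀` then comes from (H4), another from one
  -- expansion rate, and `1 - α²` from comparing the other rate with `|F₁ₓ|`.
  have e : slopeMap (M.f i) z s' - slopeMap (M.f i) z s =
      ((partialX (M.f i) z).1 * (partialY (M.f i) z).2 -
        (partialY (M.f i) z).1 * (partialX (M.f i) z).2) /
        (runRate (M.f i) z s' * runRate (M.f i) z s) * (s' - s) := by
    rw [slopeMap, slopeMap, div_sub_div _ _ n2 n1, div_mul_eq_mul_div]
    congr 1
    unfold runRate riseRate
    ring
  rw [e, abs_mul, abs_div, abs_mul]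
  refine mul_le_mul_of_nonneg_right ?_ (abs_nonneg _)
  change absJacobian (M.f i) z / _ ≤ _
  have hα := H.one_sub_sq_pos
  have hK : 0 < K₀ := zero_lt_one.trans H.one_lt
  rw [div_le_div_iff₀ (mul_pos (abs_pos.2 n2) (abs_pos.2 n1)) (by positivity), one_mul]
  have h4 := H.hyp.h4 i z hz
  have p : 0 ≤ α * |(partialX (M.f i) z).2| := mul_nonneg H.pos.le (abs_nonneg _)
  have a1 : absJacobian (M.f i) z * K₀ ≤ |(partialX (M.f i) z).1| := by linarith
  calc absJacobian (M.f i) z * (K₀ ^ 2 * (1 - α ^ 2))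
      = K₀ * ((1 - α ^ 2) * (absJacobian (M.f i) z * K₀)) := by ring
    _ ≤ K₀ * ((1 - α ^ 2) * |(partialX (M.f i) z).1|) := by gcongr
    _ ≤ K₀ * |runRate (M.f i) z s| := by gcongr; exact H.partialX_le_runRate hz hs
    _ ≤ |runRate (M.f i) z s'| * |runRate (M.f i) z s| := by
      gcongr; exact H.le_runRate hz hs'

theorem log_runRate_slope (H : M.IsHyperbolicModel α K₀) {i : ι} {z : ℝ × ℝ} (hz : z ∈ M.E i)
    {s s' : ℝ} (hs : |s| ≤ α) (hs' : |s'| ≤ α) :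
    |Real.log (runRate (M.f i) z s') - Real.log (runRate (M.f i) z s)| ≤
      1 / (1 - α ^ 2) * |s' - s| := by
  have hα := H.one_sub_sq_pos
  have key : ∀ s s' : ℝ, |s| ≤ α → |s'| ≤ α → Real.log (runRate (M.f i) z s') -
      Real.log (runRate (M.f i) z s) ≤ 1 / (1 - α ^ 2) * |s' - s| := by
    intro s s' hs hs'
    have n1 := abs_pos.2 (H.runRate_ne_zero hz hs)
    have n2 := abs_pos.2 (H.runRate_ne_zero hz hs')
    rw [← Real.log_abs, ← Real.log_abs (runRate (M.f i) z s), ← Real.log_div n2.ne' n1.ne']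
    refine (Real.log_le_sub_one_of_pos (div_pos n2 n1)).trans ?_
    rw [div_sub_one n1.ne', div_le_iff₀ n1]
    refine (abs_sub_abs_le_abs_sub _ _).trans ?_
    have e : runRate (M.f i) z s' - runRate (M.f i) z s = (s' - s) * (partialY (M.f i) z).1 := by
      unfold runRate; ring
    rw [e, abs_mul]
    have b := (H.abs_partial_le hz).1.trans
      (mul_le_of_le_one_left (abs_nonneg _) H.lt_one.le)
    calc |s' - s| * |(partialY (M.f i) z).1| ≤ |s' - s| * |(partialX (M.f i) z).1| := by gcongr
      _ = 1 / (1 - α ^ 2) * |s' - s| * ((1 - α ^ 2) * |(partialX (M.f i) z).1|) := by field_simp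
      _ ≤ _ := by gcongr; exact H.partialX_le_runRate hz hs
  rw [abs_le]
  have := key s' s hs' hs
  rw [abs_sub_comm] at this
  exact ⟨by linarith, key s s' hs hs'⟩

end IsHyperbolicModel

/-- Joint regularity of the slope map and of the logarithmic expansion rate, with a contraction
factor `θ` for the slopes. -/
structure IsRegular (M : PiecewiseMap ι) (α θ C : ℝ) : Prop where
  nonneg : 0 ≤ θ
  lt_one : θ < 1
  const_nonneg : 0 ≤ C
  slope : ∀ i, ∀ z ∈ M.E i, ∀ z' ∈ M.E i, ∀ s s', |s| ≤ α → |s'| ≤ α →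
    |slopeMap (M.f i) z' s' - slopeMap (M.f i) z s| ≤ θ * |s' - s| + C * ‖z' - z‖
  rate : ∀ i, ∀ z ∈ M.E i, ∀ z' ∈ M.E i, ∀ s s', |s| ≤ α → |s'| ≤ α →
    |Real.log (runRate (M.f i) z' s') - Real.log (runRate (M.f i) z s)| ≤
      C * |s' - s| + C * ‖z' - z‖

theorem IsHyperbolicModel.exists_regular (H : M.IsHyperbolicModel α K₀) (hD : M.Distortion C₀)
    [Nonempty ι] : ∃ θ C, M.IsRegular α θ C := by
  have hα := H.one_sub_sq_pos
  have hK : 0 < K₀ := zero_lt_one.trans H.one_lt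
  obtain ⟨i⟩ := ‹Nonempty ι›
  obtain ⟨l, r, h⟩ := H.exists_strip i
  -- A point of some rectangle is needed to know that `C₀` is positive.
  have hC := (H.second_partial_le hD (h.left_mem (left_mem_Icc.2 zero_le_one))).1
  set C := max (4 * (2 * (2 * C₀ / (1 - α ^ 2)))) (1 / (1 - α ^ 2)) with hCdef
  have c0 : 0 ≤ 1 / (1 - α ^ 2) := by positivity
  have c1 : 4 * (2 * (2 * C₀ / (1 - α ^ 2))) ≤ C := le_max_left _ _
  have c2 : 1 / (1 - α ^ 2) ≤ C := le_max_right _ _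
  have c3 : 4 * (2 * C₀ / (1 - α ^ 2)) ≤ C := by
    have : 0 ≤ 2 * C₀ / (1 - α ^ 2) := by positivity
    linarith
  refine ⟨1 / (K₀ ^ 2 * (1 - α ^ 2)), C, by positivity, ?_, c0.trans c2, ?_, ?_⟩
  -- (H5) is exactly the condition that the contraction factor is less than one.
  · have h5 := H.hyp.h5
    rw [← div_div, div_lt_one hα]; linarith
  · intro i z hz z' hz' s s' hs hs'
    have t := abs_sub_le (slopeMap (M.f i) z' s') (slopeMap (M.f i) z' s) (slopeMap (M.f i) z s)
    have t1 := H.slopeMap_contract hz' hs hs'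
    have t2 := (H.slopeMap_lipschitz hD hz hz' hs).trans
      (mul_le_mul_of_nonneg_right c1 (norm_nonneg _))
    linarith
  · intro i z hz z' hz' s s' hs hs'
    have t := abs_sub_le (Real.log (runRate (M.f i) z' s')) (Real.log (runRate (M.f i) z' s))
      (Real.log (runRate (M.f i) z s))
    have t1 := (H.log_runRate_slope hz' hs hs').trans
      (mul_le_mul_of_nonneg_right c2 (abs_nonneg _))
    have t2 := (H.log_runRate_lipschitz hD hz hz' hs).trans
      (mul_le_mul_of_nonneg_right c3 (norm_nonneg _))
    linarith

end PiecewiseMap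

/-! ### Stable and unstable manifolds, their crossing, and their chords. -/

namespace PiecewiseMap

variable {ι : Type*} {M : PiecewiseMap ι} {α K₀ C₀ : ℝ}

namespace IsHyperbolicModel

theorem cylE_succ_subset (H : M.IsHyperbolicModel α K₀) (n : ℕ) (x : ℕ → ι) :
    M.cylE (n + 1) x ⊆ M.cylE n x := by
  induction n generalizing x with
  | zero => exact H.cylE_subset_square 1 x
  | succ n ih => exact fun z hz => ⟨hz.1, ih _ hz.2⟩

theorem cylS_succ_subset (H : M.IsHyperbolicModel α K₀) (n : ℕ) (p : ℕ → ι) :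
    M.cylS (n + 1) p ⊆ M.cylS n p := fun z hz => by
  rw [← swap_mem_cylE_dual H] at hz ⊢
  exact H.dual.cylE_succ_subset n p hz

theorem unstable_subset_square {q : ℕ → ι} {z : ℝ × ℝ} (hz : z ∈ M.unstableManifold q) :
    z ∈ unitSquare := mem_iInter.1 hz 0

theorem inv_lt_one (H : M.IsHyperbolicModel α K₀) : K₀⁻¹ < 1 := inv_lt_one_of_one_lt₀ H.one_lt

theorem inv_nonneg (H : M.IsHyperbolicModel α K₀) : 0 ≤ K₀⁻¹ :=
  _root_.inv_nonneg.2 (zero_le_one.trans H.one_lt.le)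

theorem le_of_forall_pow (H : M.IsHyperbolicModel α K₀) {a b : ℝ}
    (h : ∀ n : ℕ, a ≤ b + K₀⁻¹ ^ n) : a ≤ b := by
  have := (tendsto_pow_atTop_nhds_zero_of_lt_one H.inv_nonneg H.inv_lt_one).const_add b
  rw [add_zero] at this
  exact ge_of_tendsto' this h

/-- The error term `K₀⁻ⁿ` in the estimate for strips of length `n` disappears in the limit. -/
theorem unstable_cone (H : M.IsHyperbolicModel α K₀) {q : ℕ → ι} {z z' : ℝ × ℝ}
    (hz : z ∈ M.unstableManifold q) (hz' : z' ∈ M.unstableManifold q) :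
    |z.2 - z'.2| ≤ α * |z.1 - z'.1| :=
  H.le_of_forall_pow fun n => H.abs_snd_sub_le (mem_iInter.1 hz n) (mem_iInter.1 hz' n)

theorem stable_cone (H : M.IsHyperbolicModel α K₀) {x : ℕ → ι} {z z' : ℝ × ℝ}
    (hz : z ∈ M.stableManifold x) (hz' : z' ∈ M.stableManifold x) :
    |z.1 - z'.1| ≤ α * |z.2 - z'.2| :=
  H.le_of_forall_pow fun n => H.abs_fst_sub_le (mem_iInter.1 hz n) (mem_iInter.1 hz' n)

/-- Every strip crosses every vertical line of the square. -/
theorem exists_mem_cylS (H : M.IsHyperbolicModel α K₀) (n : ℕ) (p : ℕ → ι) {x : ℝ}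
    (hx : x ∈ Icc (0 : ℝ) 1) : ∃ y, (x, y) ∈ M.cylS n p := by
  obtain ⟨b, t, h, -⟩ := H.dual.cylE_strip n p
  exact ⟨b x, (swap_mem_cylE_dual H n p _).1 (h.left_mem hx)⟩

theorem exists_mem_unstable (H : M.IsHyperbolicModel α K₀) (q : ℕ → ι) {x : ℝ}
    (hx : x ∈ Icc (0 : ℝ) 1) : ∃ y, (x, y) ∈ M.unstableManifold q := by
  have hcl : IsClosed {z : ℝ × ℝ | z.1 = x} := isClosed_eq continuous_fst continuous_const
  obtain ⟨z, hz⟩ := IsCompact.nonempty_iInter_of_sequence_nonempty_isCompact_isClosed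
    (fun n => M.cylS n q ∩ {z | z.1 = x})
    (fun n => inter_subset_inter_left _ (H.cylS_succ_subset n q))
    (fun n => by
      obtain ⟨y, hy⟩ := H.exists_mem_cylS n q hx
      exact ⟨(x, y), hy, rfl⟩)
    ((H.cylS_isCompact 0 q).inter_right hcl)
    (fun n => (H.cylS_isCompact n q).isClosed.inter hcl)
  rw [mem_iInter] at hz
  refine ⟨z.2, mem_iInter.2 fun n => ?_⟩
  rw [← show z.1 = x from (hz 0).2]
  exact (hz n).1

/-- By the cone estimate two points over the same abscissa coincide, so the supremum in
`unstableHeight` is over a singleton. -/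
theorem mem_unstable_iff (H : M.IsHyperbolicModel α K₀) (q : ℕ → ι) {z : ℝ × ℝ} :
    z ∈ M.unstableManifold q ↔ z.1 ∈ Icc (0 : ℝ) 1 ∧ z.2 = M.unstableHeight q z.1 := by
  have key : ∀ x ∈ Icc (0 : ℝ) 1, (x, M.unstableHeight q x) ∈ M.unstableManifold q := by
    intro x hx
    obtain ⟨y, hy⟩ := H.exists_mem_unstable q hx
    have : {y | (x, y) ∈ M.unstableManifold q} = {y} := by
      ext y'
      refine ⟨fun h => ?_, fun h => by rw [show y' = y from h]; exact hy⟩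
      have := H.unstable_cone h hy
      simp only [sub_self, abs_zero, mul_zero] at this
      exact sub_eq_zero.1 (abs_nonpos_iff.1 this)
    rw [unstableHeight, this, csSup_singleton]
    exact hy
  constructor
  · intro hz
    have h1 : z.1 ∈ Icc (0 : ℝ) 1 := (unstable_subset_square hz).1
    have := H.unstable_cone hz (key _ h1)
    simp only [sub_self, abs_zero, mul_zero] at this
    exact ⟨h1, sub_eq_zero.1 (abs_nonpos_iff.1 this)⟩
  · rintro ⟨h1, h2⟩
    have := key _ h1
    rwa [← h2] at this

/-- A side `x = l y` of the rectangle meets a side `y = b x` of the strip at a fixed point of `l ∘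
b`. -/
theorem exists_mem_inter (H : M.IsHyperbolicModel α K₀) (n m : ℕ) (x p : ℕ → ι) :
    (M.cylE n x ∩ M.cylS m p).Nonempty := by
  obtain ⟨l, r, h, -⟩ := H.cylE_strip n x
  obtain ⟨b, t, h', -⟩ := H.dual.cylE_strip m p
  have hb : ∀ x ∈ Icc (0 : ℝ) 1, b x ∈ Icc (0 : ℝ) 1 := fun x hx => (h'.mem_square (h'.left_mem hx)).1
  have hl : ∀ x ∈ Icc (0 : ℝ) 1, l x ∈ Icc (0 : ℝ) 1 := fun x hx => (h.mem_square (h.left_mem hx)).1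
  obtain ⟨c, hc, hfix⟩ := exists_mem_Icc_isFixedPt_of_mapsTo (f := l ∘ b)
    (h.continuousOn_left.comp h'.continuousOn_left hb) zero_le_one
    (fun x hx => hl _ (hb x hx))
  have hfix : l (b c) = c := hfix
  refine ⟨(c, b c), ?_, (swap_mem_cylE_dual H m p _).1 (h'.left_mem hc)⟩
  have := h.left_mem (hb c hc)
  rwa [hfix] at this

/-- Existence is by compactness of nested intersections. The difference of two common points lies in
both the horizontal and the vertical cone, which meet only in `0` as `α² < 1`. -/
theorem existsUnique_point (H : M.IsHyperbolicModel α K₀) (x p : ℕ → ι) :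
    ∃! z, z ∈ M.unstableManifold p ∩ M.stableManifold x := by
  obtain ⟨z, hz⟩ := IsCompact.nonempty_iInter_of_sequence_nonempty_isCompact_isClosed
    (fun n => M.cylE n x ∩ M.cylS n p)
    (fun n => inter_subset_inter (H.cylE_succ_subset n x) (H.cylS_succ_subset n p))
    (fun n => H.exists_mem_inter n n x p)
    ((H.cylE_isCompact 0 x).inter_right (H.cylS_isCompact 0 p).isClosed)
    (fun n => (H.cylE_isCompact n x).isClosed.inter (H.cylS_isCompact n p).isClosed)
  rw [mem_iInter] at hz
  refine ⟨z, ⟨mem_iInter.2 fun n => (hz n).2, mem_iInter.2 fun n => (hz n).1⟩, ?_⟩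
  rintro w ⟨hw1, hw2⟩
  have h1 := H.unstable_cone hw1 (mem_iInter.2 fun n => (hz n).2)
  have h2 := H.stable_cone hw2 (mem_iInter.2 fun n => (hz n).1)
  have hα := H.one_sub_sq_pos
  have h3 : |w.1 - z.1| ≤ 0 := by
    nlinarith [mul_le_mul_of_nonneg_left h1 H.pos.le, abs_nonneg (w.1 - z.1)]
  have h4 : |w.1 - z.1| = 0 := le_antisymm h3 (abs_nonneg _)
  rw [h4, mul_zero] at h1
  exact Prod.ext (sub_eq_zero.1 (abs_eq_zero.1 h4)) (sub_eq_zero.1 (abs_nonpos_iff.1 h1))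

/-- Backward invariance of the unstable manifolds. -/
theorem exists_preimage_unstable (H : M.IsHyperbolicModel α K₀) {q : ℕ → ι} {w : ℝ × ℝ}
    (hw : w ∈ M.unstableManifold q) :
    ∃ v ∈ M.E (q 0), v ∈ M.unstableManifold (shiftOne q) ∧ M.f (q 0) v = w := by
  have h := fun n => mem_iInter.1 hw n
  obtain ⟨v, ⟨-, hv⟩, hvw⟩ := h 1
  refine ⟨v, hv, mem_iInter.2 fun n => ?_, hvw⟩
  obtain ⟨v', ⟨h1, h2⟩, h3⟩ := h (n + 1)
  -- Injectivity of the branch identifies the preimages found at different levels.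
  rwa [H.injOn _ hv h2 (hvw.trans h3.symm)]

theorem map_mem_unstable (H : M.IsHyperbolicModel α K₀) {q : ℕ → ι} {v : ℝ × ℝ}
    (hv : v ∈ M.E (q 0)) (hu : v ∈ M.unstableManifold (shiftOne q)) :
    M.f (q 0) v ∈ M.unstableManifold q := by
  refine mem_iInter.2 fun n => ?_
  have h : ∀ n, M.f (q 0) v ∈ M.cylS (n + 1) q := fun n => ⟨v, ⟨mem_iInter.1 hu n, hv⟩, rfl⟩
  cases n with
  | zero => exact H.cylS_succ_subset 0 q (h 0)
  | succ n => exact h n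

theorem abs_chord_le (H : M.IsHyperbolicModel α K₀) {q : ℕ → ι} {z w : ℝ × ℝ}
    (hz : z ∈ M.unstableManifold q) (hw : w ∈ M.unstableManifold q) (hne : w.1 ≠ z.1) :
    |(w.2 - z.2) / (w.1 - z.1)| ≤ α := by
  rw [abs_div, div_le_iff₀ (abs_pos.2 (sub_ne_zero.2 hne))]
  exact H.unstable_cone hw hz

/-- A chord of an unstable manifold is the image of a chord of its preimage. -/
theorem exists_preimage_chord (H : M.IsHyperbolicModel α K₀) {q : ℕ → ι} {a w : ℝ × ℝ}
    (haE : a ∈ M.E (q 0)) (ha : a ∈ M.unstableManifold (shiftOne q))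
    (hw : w ∈ M.unstableManifold q) (hne : w.1 ≠ (M.f (q 0) a).1) :
    ∃ v ∈ M.unstableManifold (shiftOne q), v.1 ≠ a.1 ∧
      |v.1 - a.1| ≤ |w.1 - (M.f (q 0) a).1| ∧
      ∃ ξ ∈ M.E (q 0), ‖ξ - a‖ ≤ |v.1 - a.1| ∧
        (w.2 - (M.f (q 0) a).2) / (w.1 - (M.f (q 0) a).1) =
          slopeMap (M.f (q 0)) ξ ((v.2 - a.2) / (v.1 - a.1)) := by
  obtain ⟨v, hvE, hv, rfl⟩ := H.exists_preimage_unstable hw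
  have hc := H.unstable_cone hv ha
  have hva : v.1 ≠ a.1 := by
    rintro h
    rw [h, sub_self, abs_zero, mul_zero] at hc
    exact hne (by rw [show v = a from Prod.ext h (sub_eq_zero.1 (abs_nonpos_iff.1 hc))])
  have h0 : v.1 - a.1 ≠ 0 := sub_ne_zero.2 hva
  obtain ⟨-, he⟩ := H.cone_expand haE hvE hc
  obtain ⟨hs, -, ξ, hξ, h2⟩ := H.exists_chord haE hvE (H.abs_chord_le ha hv hva)
    (by field_simp)
  refine ⟨v, hv, hva, ?_, ξ, hs hξ, ?_, ?_⟩
  · nlinarith [abs_nonneg (v.1 - a.1), H.one_lt]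
  · have hb : segment ℝ a v ⊆ Metric.closedBall a |v.1 - a.1| :=
      (convex_closedBall _ _).segment_subset (Metric.mem_closedBall_self (abs_nonneg _)) (by
        rw [Metric.mem_closedBall, dist_eq_norm, Prod.norm_def]
        refine max_le le_rfl (hc.trans (mul_le_of_le_one_left (abs_nonneg _) H.lt_one.le)))
    have := hb hξ
    rwa [Metric.mem_closedBall, dist_eq_norm] at this
  · rw [h2, mul_div_assoc, div_self (sub_ne_zero.2 hne), mul_one]

/-- Chords of unstable manifolds with a common end point have nearly the same slope. -/
theorem chord_sub_le (H : M.IsHyperbolicModel α K₀) {θ C : ℝ} (hR : M.IsRegular α θ C)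
    {q : ℕ → ι} {z w w' : ℝ × ℝ} (hz : z ∈ M.unstableManifold q) (hw : w ∈ M.unstableManifold q)
    (hw' : w' ∈ M.unstableManifold q) (hne : w.1 ≠ z.1) (hne' : w'.1 ≠ z.1) :
    |(w'.2 - z.2) / (w'.1 - z.1) - (w.2 - z.2) / (w.1 - z.1)| ≤
      C / (1 - θ) * (|w.1 - z.1| + |w'.1 - z.1|) := by
  have hθ1 : 0 < 1 - θ := sub_pos.2 hR.lt_one
  -- The chords are pulled back `n` times, where the trivial bound `2α` applies. Each push forward
  -- contracts the slope difference by `θ` and adds `C` times the chord lengths, and these lengths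
  -- shrink backwards.
  have key : ∀ n : ℕ, ∀ (q : ℕ → ι) (z w w' : ℝ × ℝ), z ∈ M.unstableManifold q →
      w ∈ M.unstableManifold q → w' ∈ M.unstableManifold q → w.1 ≠ z.1 → w'.1 ≠ z.1 →
      |(w'.2 - z.2) / (w'.1 - z.1) - (w.2 - z.2) / (w.1 - z.1)| ≤
        2 * α * θ ^ n + C / (1 - θ) * (|w.1 - z.1| + |w'.1 - z.1|) := by
    intro n
    induction n with
    | zero =>
      intro q z w w' hz hw hw' hne hne'
      have h1 := abs_sub ((w'.2 - z.2) / (w'.1 - z.1)) ((w.2 - z.2) / (w.1 - z.1))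
      have h2 := H.abs_chord_le hz hw hne
      have h3 := H.abs_chord_le hz hw' hne'
      have h4 : 0 ≤ C / (1 - θ) * (|w.1 - z.1| + |w'.1 - z.1|) :=
        mul_nonneg (div_nonneg hR.const_nonneg hθ1.le) (by positivity)
      rw [pow_zero]
      linarith
    | succ n ih =>
      intro q z w w' hz hw hw' hne hne'
      obtain ⟨a, haE, ha, rfl⟩ := H.exists_preimage_unstable hz
      obtain ⟨v, hv, hva, hle, ξ, hξE, hξ, e⟩ := H.exists_preimage_chord haE ha hw hne
      obtain ⟨v', hv', hva', hle', ξ', hξE', hξ', e'⟩ := H.exists_preimage_chord haE ha hw' hne'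
      rw [e, e']
      have h1 := hR.slope (q 0) ξ hξE ξ' hξE' _ _ (H.abs_chord_le ha hv hva) (H.abs_chord_le ha hv' hva')
      have h2 := mul_le_mul_of_nonneg_left (ih _ a v v' ha hv hv' hva hva') hR.nonneg
      have h3 : ‖ξ' - ξ‖ ≤ |v.1 - a.1| + |v'.1 - a.1| := by
        have := norm_sub_le (ξ' - a) (ξ - a)
        rw [sub_sub_sub_cancel_right] at this
        linarith
      have h4 := mul_le_mul_of_nonneg_left h3 hR.const_nonneg
      have h5 : C / (1 - θ) * (|v.1 - a.1| + |v'.1 - a.1|) ≤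
          C / (1 - θ) * (|w.1 - (M.f (q 0) a).1| + |w'.1 - (M.f (q 0) a).1|) :=
        mul_le_mul_of_nonneg_left (add_le_add hle hle') (div_nonneg hR.const_nonneg hθ1.le)
      -- `C / (1 - θ)` is the fixed point of `t ↦ θ t + C`, so the induction reproduces the
      -- constant.
      have h6 : θ * (C / (1 - θ) * (|v.1 - a.1| + |v'.1 - a.1|)) +
          C * (|v.1 - a.1| + |v'.1 - a.1|) = C / (1 - θ) * (|v.1 - a.1| + |v'.1 - a.1|) := by
        field_simp; ring
      rw [pow_succ]
      linarith
  refine ge_of_tendsto' (f := fun n : ℕ => 2 * α * θ ^ n +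
    C / (1 - θ) * (|w.1 - z.1| + |w'.1 - z.1|)) (x := atTop) ?_
    fun n => key n q z w w' hz hw hw' hne hne'
  have := ((tendsto_pow_atTop_nhds_zero_of_lt_one hR.nonneg hR.lt_one).const_mul
    (2 * α)).add_const (C / (1 - θ) * (|w.1 - z.1| + |w'.1 - z.1|))
  simpa using this

end IsHyperbolicModel

end PiecewiseMap

/-! ### Unstable manifolds are `C¹`, with invariant tangent slopes. -/

theorem neBot_nhdsWithin_Icc_diff {x : ℝ} (hx : x ∈ Icc (0 : ℝ) 1) :
    (𝓝[Icc (0 : ℝ) 1 \ {x}] x).NeBot := by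
  rw [← accPt_principal_iff_nhdsWithin, ← uniqueDiffWithinAt_iff_accPt]
  exact uniqueDiffOn_Icc zero_lt_one x hx

theorem tendsto_abs_sub_nhdsWithin (A x : ℝ) (s : Set ℝ) :
    Tendsto (fun a => A * |a - x|) (𝓝[s] x) (𝓝 0) := by
  have : Continuous fun a : ℝ => A * |a - x| := by fun_prop
  have h := this.tendsto x
  simp only [sub_self, abs_zero, mul_zero] at h
  exact h.mono_left nhdsWithin_le_nhds

/-- A function whose chords with a common end point have nearly the same slope is
differentiable. -/
theorem differentiableWithinAt_of_slope {g : ℝ → ℝ} {A : ℝ}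
    (h : ∀ x ∈ Icc (0 : ℝ) 1, ∀ a ∈ Icc (0 : ℝ) 1, ∀ b ∈ Icc (0 : ℝ) 1, a ≠ x → b ≠ x →
      |slope g x b - slope g x a| ≤ A * (|a - x| + |b - x|)) {x : ℝ} (hx : x ∈ Icc (0 : ℝ) 1) :
    DifferentiableWithinAt ℝ g (Icc 0 1) x ∧ ∀ a ∈ Icc (0 : ℝ) 1, a ≠ x →
      |derivWithin g (Icc 0 1) x - slope g x a| ≤ A * |a - x| := by
  have := neBot_nhdsWithin_Icc_diff hx
  set F := 𝓝[Icc (0 : ℝ) 1 \ {x}] x with hF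
  have hmem : ∀ᶠ a in F, a ∈ Icc (0 : ℝ) 1 ∧ a ≠ x := self_mem_nhdsWithin
  -- The difference quotients form a Cauchy filter, so no candidate for the derivative is needed
  -- beforehand.
  have hcau : Cauchy (map (slope g x) F) := by
    rw [Metric.cauchy_iff]
    refine ⟨inferInstance, fun ε hε => ?_⟩
    have hsm : ∀ᶠ a in F, A * |a - x| < ε / 2 :=
      (tendsto_abs_sub_nhdsWithin A x _).eventually_lt_const (half_pos hε)
    refine ⟨_, image_mem_map (hmem.and hsm), ?_⟩
    rintro _ ⟨a, ⟨⟨ha, hax⟩, h1⟩, rfl⟩ _ ⟨b, ⟨⟨hb, hbx⟩, h2⟩, rfl⟩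
    rw [Real.dist_eq]
    have := h x hx b hb a ha hbx hax
    linarith
  obtain ⟨s, hs⟩ := cauchy_iff_exists_le_nhds.1 hcau
  have hs : Tendsto (slope g x) F (𝓝 s) := hs
  have hd := hasDerivWithinAt_iff_tendsto_slope.2 hs
  refine ⟨hd.differentiableWithinAt, fun a ha hax => ?_⟩
  rw [hd.derivWithin (uniqueDiffOn_Icc zero_lt_one x hx)]
  have h1 : Tendsto (fun b => A * |a - x| + A * |b - x|) F (𝓝 (A * |a - x|)) := by
    simpa using (tendsto_abs_sub_nhdsWithin A x _).const_add (A * |a - x|)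
  refine le_of_tendsto_of_tendsto ((hs.sub_const (slope g x a)).abs) h1 ?_
  filter_upwards [hmem] with b hb
  rw [← mul_add]
  exact h x hx a ha b hb.1 hax hb.2

namespace PiecewiseMap

variable {ι : Type*} {M : PiecewiseMap ι} {α K₀ C₀ θ C : ℝ}

namespace IsHyperbolicModel

theorem height_mem (H : M.IsHyperbolicModel α K₀) (q : ℕ → ι) {x : ℝ} (hx : x ∈ Icc (0 : ℝ) 1) :
    (x, M.unstableHeight q x) ∈ M.unstableManifold q := (H.mem_unstable_iff q).2 ⟨hx, rfl⟩

theorem height_differentiable (H : M.IsHyperbolicModel α K₀) (hR : M.IsRegular α θ C)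
    (q : ℕ → ι) {x : ℝ} (hx : x ∈ Icc (0 : ℝ) 1) :
    DifferentiableWithinAt ℝ (M.unstableHeight q) (Icc 0 1) x ∧
      ∀ a ∈ Icc (0 : ℝ) 1, a ≠ x →
        |derivWithin (M.unstableHeight q) (Icc 0 1) x - slope (M.unstableHeight q) x a| ≤
          C / (1 - θ) * |a - x| := by
  refine differentiableWithinAt_of_slope (fun x hx a ha b hb hax hbx => ?_) hx
  rw [slope_def_field, slope_def_field]
  exact H.chord_sub_le hR (H.height_mem q hx) (H.height_mem q ha) (H.height_mem q hb) hax hbx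

theorem height_slope_sub_le (H : M.IsHyperbolicModel α K₀) (hR : M.IsRegular α θ C)
    {q : ℕ → ι} {z w : ℝ × ℝ} (hz : z ∈ M.unstableManifold q) (hw : w ∈ M.unstableManifold q)
    (hne : w.1 ≠ z.1) :
    |derivWithin (M.unstableHeight q) (Icc 0 1) z.1 - (w.2 - z.2) / (w.1 - z.1)| ≤
      C / (1 - θ) * |w.1 - z.1| := by
  obtain ⟨h1, h2⟩ := (H.mem_unstable_iff q).1 hz
  obtain ⟨h3, h4⟩ := (H.mem_unstable_iff q).1 hw
  have := (H.height_differentiable hR q h1).2 _ h3 hne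
  rwa [slope_def_field, ← h2, ← h4] at this

theorem abs_height_slope_le (H : M.IsHyperbolicModel α K₀) (hR : M.IsRegular α θ C)
    (q : ℕ → ι) {x : ℝ} (hx : x ∈ Icc (0 : ℝ) 1) :
    |derivWithin (M.unstableHeight q) (Icc 0 1) x| ≤ α := by
  have := neBot_nhdsWithin_Icc_diff hx
  have h := (hasDerivWithinAt_iff_tendsto_slope.1
    (H.height_differentiable hR q hx).1.hasDerivWithinAt).abs
  refine le_of_tendsto h ?_
  filter_upwards [self_mem_nhdsWithin] with a ha
  rw [slope_def_field]
  exact H.abs_chord_le (H.height_mem q hx) (H.height_mem q ha.1) ha.2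

theorem height_contDiffOn (H : M.IsHyperbolicModel α K₀) (hR : M.IsRegular α θ C)
    (q : ℕ → ι) : ContDiffOn ℝ 1 (M.unstableHeight q) (Icc 0 1) := by
  rw [contDiffOn_one_iff_derivWithin (uniqueDiffOn_Icc zero_lt_one)]
  refine ⟨fun x hx => (H.height_differentiable hR q hx).1, ?_⟩
  have hA : 0 ≤ C / (1 - θ) := div_nonneg hR.const_nonneg (sub_pos.2 hR.lt_one).le
  refine (LipschitzOnWith.of_dist_le_mul (K := (2 * (C / (1 - θ))).toNNReal)
    fun x hx y hy => ?_).continuousOn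
  rw [Real.coe_toNNReal _ (by positivity), Real.dist_eq, Real.dist_eq]
  rcases eq_or_ne x y with rfl | hne
  · simp
  have h1 := (H.height_differentiable hR q hx).2 y hy hne.symm
  have h2 := (H.height_differentiable hR q hy).2 x hx hne
  rw [slope_comm, abs_sub_comm] at h2
  rw [abs_sub_comm y x] at h1
  have := abs_sub_le (derivWithin (M.unstableHeight q) (Icc 0 1) x)
    (slope (M.unstableHeight q) x y) (derivWithin (M.unstableHeight q) (Icc 0 1) y)
  linarith

/-- The tangent slopes of the unstable manifolds are mapped to each other by the slope map. -/
theorem height_slope_image (H : M.IsHyperbolicModel α K₀) (hR : M.IsRegular α θ C)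
    {q : ℕ → ι} {v : ℝ × ℝ} (hvE : v ∈ M.E (q 0)) (hv : v ∈ M.unstableManifold (shiftOne q)) :
    derivWithin (M.unstableHeight q) (Icc 0 1) (M.f (q 0) v).1 =
      slopeMap (M.f (q 0)) v (derivWithin (M.unstableHeight (shiftOne q)) (Icc 0 1) v.1) := by
  have hfv := H.map_mem_unstable hvE hv
  have hx := ((H.mem_unstable_iff q).1 hfv).1
  have := neBot_nhdsWithin_Icc_diff hx
  have hA : 0 ≤ C / (1 - θ) := div_nonneg hR.const_nonneg (sub_pos.2 hR.lt_one).le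
  refine sub_eq_zero.1 (abs_nonpos_iff.1 ?_)
  refine ge_of_tendsto (tendsto_abs_sub_nhdsWithin (2 * (C / (1 - θ)) + C) (M.f (q 0) v).1
    (Icc (0 : ℝ) 1 \ {(M.f (q 0) v).1})) ?_
  filter_upwards [self_mem_nhdsWithin] with a ha
  have hw := H.height_mem q ha.1
  obtain ⟨v', hv', hne, hle, ξ, hξE, hξ, he⟩ := H.exists_preimage_chord hvE hv hw ha.2
  have h1 := H.height_slope_sub_le hR hfv hw ha.2
  have h2 := H.height_slope_sub_le hR hv hv' hne
  have h3 := hR.slope (q 0) v hvE ξ hξE _ _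
    (H.abs_height_slope_le hR (shiftOne q) (unstable_subset_square hv).1)
    (H.abs_chord_le hv hv' hne)
  rw [he] at h1
  rw [abs_sub_comm] at h2
  simp only at h1 hle
  have h4 := mul_le_mul_of_nonneg_left h2 hR.nonneg
  have h5 : θ * (C / (1 - θ) * |v'.1 - v.1|) ≤ C / (1 - θ) * |a - (M.f (q 0) v).1| :=
    (mul_le_of_le_one_left (by positivity) hR.lt_one.le).trans (mul_le_mul_of_nonneg_left hle hA)
  have h6 := mul_le_mul_of_nonneg_left (hξ.trans hle) hR.const_nonneg
  have h7 := abs_sub_le (derivWithin (M.unstableHeight q) (Icc 0 1) (M.f (q 0) v).1)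
    (slopeMap (M.f (q 0)) ξ ((v'.2 - v.2) / (v'.1 - v.1)))
    (slopeMap (M.f (q 0)) v (derivWithin (M.unstableHeight (shiftOne q)) (Icc 0 1) v.1))
  linarith

/-! ### The coded points -/

theorem point_mem (H : M.IsHyperbolicModel α K₀) (ω : ℤ → ι) :
    M.point ω ∈ M.unstableManifold (past ω) ∩ M.stableManifold (future ω) :=
  Classical.epsilon_spec (H.existsUnique_point (future ω) (past ω)).exists

theorem point_mem_E (H : M.IsHyperbolicModel α K₀) (ω : ℤ → ι) : M.point ω ∈ M.E (ω 0) :=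
  (mem_iInter.1 (H.point_mem ω).2 1).1

theorem shiftOne_past (ω : ℤ → ι) : shiftOne (past (shiftTwo ω)) = past ω := by
  funext k
  simp only [shiftOne, past, shiftTwo]
  congr 1

theorem future_shiftTwo (ω : ℤ → ι) : future (shiftTwo ω) = shiftOne (future ω) := by
  funext k
  simp [shiftOne, future, shiftTwo]

theorem past_shiftTwo_zero (ω : ℤ → ι) : past (shiftTwo ω) 0 = ω 0 := by
  simp [past, shiftTwo]

/-- The image point lies on both manifolds of the shifted sequence, which cross only once. -/
theorem point_shift (H : M.IsHyperbolicModel α K₀) (ω : ℤ → ι) :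
    M.point (shiftTwo ω) = M.f (ω 0) (M.point ω) := by
  refine (H.existsUnique_point (future (shiftTwo ω)) (past (shiftTwo ω))).unique
    (H.point_mem _) ⟨?_, ?_⟩
  · have h := H.map_mem_unstable (q := past (shiftTwo ω)) (v := M.point ω)
      (by rw [past_shiftTwo_zero]; exact H.point_mem_E ω)
      (by rw [shiftOne_past]; exact (H.point_mem ω).1)
    rwa [past_shiftTwo_zero] at h
  · rw [future_shiftTwo]
    exact mem_iInter.2 fun n => (mem_iInter.1 (H.point_mem ω).2 (n + 1)).2

theorem slope_shift (H : M.IsHyperbolicModel α K₀) (hR : M.IsRegular α θ C) (ω : ℤ → ι) :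
    M.unstableSlope (shiftTwo ω) = slopeMap (M.f (ω 0)) (M.point ω) (M.unstableSlope ω) := by
  have h := H.height_slope_image hR (q := past (shiftTwo ω)) (v := M.point ω)
      (by rw [past_shiftTwo_zero]; exact H.point_mem_E ω)
      (by rw [shiftOne_past]; exact (H.point_mem ω).1)
  rw [past_shiftTwo_zero, shiftOne_past, ← H.point_shift] at h
  exact h

theorem abs_unstableSlope_le (H : M.IsHyperbolicModel α K₀) (hR : M.IsRegular α θ C) (ω : ℤ → ι) :
    |M.unstableSlope ω| ≤ α :=
  H.abs_height_slope_le hR _ (unstable_subset_square (H.point_mem ω).1).1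

/-- Inside the cone the max norm is the absolute value of the first component, as `α < 1`. -/
theorem phi_eq (H : M.IsHyperbolicModel α K₀) (hR : M.IsRegular α θ C) (ω : ℤ → ι) :
    M.phi ω = -Real.log (runRate (M.f (ω 0)) (M.point ω) (M.unstableSlope ω)) := by
  have hs := H.abs_unstableSlope_le hR ω
  have h1 : ‖((1, M.unstableSlope ω) : ℝ × ℝ)‖ = 1 := by
    rw [Prod.norm_def]
    simpa using hs.trans H.lt_one.le
  rw [phi, unstableDeriv, h1, div_one, fderiv_apply_one, Prod.norm_def]
  simp only [Real.norm_eq_abs]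
  rw [max_eq_left ((H.abs_riseRate_le (H.point_mem_E ω) hs).trans
    (mul_le_of_le_one_left (abs_nonneg _) H.lt_one.le)), Real.log_abs]

end IsHyperbolicModel

end PiecewiseMap

/-! ### Convergence of the series for `u`, and dependence of `ψ` on the future only. -/

/-- The inequality is summed rather than solved. The bound does not depend on the number of terms
except through the errors, which serves both the infinite series and the finite orbits in
`exists_distortion`. -/
theorem sum_le_of_contraction {d a : ℕ → ℝ} {θ : ℝ} (hθ : θ < 1) (N : ℕ)
    (hd : ∀ k, 0 ≤ d k) (h : ∀ k < N, d (k + 1) ≤ θ * d k + a k) :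
    ∑ k ∈ Finset.range N, d k ≤ (d 0 + ∑ k ∈ Finset.range N, a k) / (1 - θ) := by
  rw [le_div_iff₀ (sub_pos.2 hθ)]
  have key : ∀ n ≤ N, (∑ k ∈ Finset.range n, d k) * (1 - θ) + d n ≤
      d 0 + ∑ k ∈ Finset.range n, a k := by
    intro n
    induction n with
    | zero => simp
    | succ n ih =>
      intro hn
      rw [Finset.sum_range_succ, Finset.sum_range_succ]
      have := ih (by omega)
      have := h n (by omega)
      linarith
  have := key N le_rfl
  have := hd N
  linarith

theorem summable_of_contraction {d a : ℕ → ℝ} {θ : ℝ} (hθ : θ < 1) (hd : ∀ k, 0 ≤ d k)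
    (ha : ∀ k, 0 ≤ a k) (hs : Summable a) (h : ∀ k, d (k + 1) ≤ θ * d k + a k) : Summable d := by
  refine summable_of_sum_range_le hd (c := (d 0 + ∑' k, a k) / (1 - θ)) fun n => ?_
  refine (sum_le_of_contraction hθ n hd fun k _ => h k).trans ?_
  have := sub_pos.2 hθ
  gcongr
  exact hs.sum_le_tsum _ fun k _ => ha k

section Sequences

variable {ι : Type*}

theorem shiftOne_iterate_apply (k : ℕ) (x : ℕ → ι) (j : ℕ) : shiftOne^[k] x j = x (j + k) := by
  induction k generalizing x with
  | zero => rfl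
  | succ k ih => rw [Function.iterate_succ_apply, ih, shiftOne]; congr 1

theorem shiftTwo_iterate_apply (k : ℕ) (ω : ℤ → ι) (j : ℤ) : shiftTwo^[k] ω j = ω (j + k) := by
  induction k generalizing ω with
  | zero => simp
  | succ k ih => rw [Function.iterate_succ_apply, ih, shiftTwo]; congr 1; push_cast; ring

theorem future_shiftTwo_iterate (k : ℕ) (ω : ℤ → ι) :
    future (shiftTwo^[k] ω) = shiftOne^[k] (future ω) := by
  funext j
  rw [shiftOne_iterate_apply, future, future, shiftTwo_iterate_apply]
  push_cast; rfl

end Sequences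

namespace PiecewiseMap

variable {ι : Type*} {M : PiecewiseMap ι} {α K₀ C₀ θ C : ℝ}

theorem cylE_congr (M : PiecewiseMap ι) {n : ℕ} {x x' : ℕ → ι} (h : ∀ j < n, x j = x' j) :
    M.cylE n x = M.cylE n x' := by
  induction n generalizing x x' with
  | zero => rfl
  | succ n ih =>
    rw [cylE, cylE, h 0 (by omega), ih (x := shiftOne x) (x' := shiftOne x')
      fun j hj => h (j + 1) (by omega)]

theorem cylS_congr (M : PiecewiseMap ι) {n : ℕ} {p p' : ℕ → ι} (h : ∀ j < n, p j = p' j) :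
    M.cylS n p = M.cylS n p' := by
  induction n generalizing p p' with
  | zero => rfl
  | succ n ih =>
    rw [cylS, cylS, h 0 (by omega), ih (p := shiftOne p) (p' := shiftOne p')
      fun j hj => h (j + 1) (by omega)]

namespace IsHyperbolicModel

/-- Points with the same future, the last `k` symbols of whose pasts agree, are close. -/
theorem norm_point_sub_le (H : M.IsHyperbolicModel α K₀) {ω ω' : ℤ → ι}
    (hf : future ω = future ω') (k : ℕ) :
    ‖M.point (shiftTwo^[k] ω') - M.point (shiftTwo^[k] ω)‖ ≤ 1 / (1 - α ^ 2) * K₀⁻¹ ^ k := by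
  have hα := H.one_sub_sq_pos
  have h1 := H.point_mem (shiftTwo^[k] ω)
  have h2 := H.point_mem (shiftTwo^[k] ω')
  rw [future_shiftTwo_iterate] at h1 h2
  rw [← hf] at h2
  have a1 := H.stable_cone h2.2 h1.2
  have hp : ∀ j < k, past (shiftTwo^[k] ω') j = past (shiftTwo^[k] ω) j := by
    intro j hj
    rw [past, past, shiftTwo_iterate_apply, shiftTwo_iterate_apply]
    have e : -((j : ℤ) + 1) + k = ((k - 1 - j : ℕ) : ℤ) := by omega
    rw [e]
    exact (congrFun hf _).symm
  have h3 := mem_iInter.1 h2.1 k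
  rw [M.cylS_congr hp] at h3
  have a2 := H.abs_snd_sub_le h3 (mem_iInter.1 h1.1 k)
  -- The stable cone bounds the horizontal difference by `α` times the vertical one, and the strip
  -- bounds the vertical one by `α` times the horizontal one plus `K₀⁻ᵏ`. Combining them gives the
  -- factor `1 - α²`.
  have a3 := mul_le_mul_of_nonneg_left a1 H.pos.le
  have a4 : |(M.point (shiftTwo^[k] ω')).2 - (M.point (shiftTwo^[k] ω)).2| ≤
      1 / (1 - α ^ 2) * K₀⁻¹ ^ k := by
    rw [div_mul_eq_mul_div, one_mul, le_div_iff₀ hα]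
    linarith
  rw [Prod.norm_def]
  exact max_le (a1.trans ((mul_le_of_le_one_left (abs_nonneg _) H.lt_one.le).trans a4)) a4

/-- `φ` is Lipschitz in the point and in the tangent slope. The points approach geometrically, and
the slope differences are contracted up to a geometric error, so both are summable. -/
theorem summable_phi_sub (H : M.IsHyperbolicModel α K₀) (hR : M.IsRegular α θ C) {ω ω' : ℤ → ι}
    (hf : future ω = future ω') :
    Summable fun k => M.phi (shiftTwo^[k] ω) - M.phi (shiftTwo^[k] ω') := by
  have h0 : ∀ k : ℕ, (shiftTwo^[k] ω') 0 = (shiftTwo^[k] ω) 0 := fun k => by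
    rw [shiftTwo_iterate_apply, shiftTwo_iterate_apply, zero_add]
    exact (congrFun hf k).symm
  have hα := H.one_sub_sq_pos
  set a : ℕ → ℝ := fun k => C * (1 / (1 - α ^ 2) * K₀⁻¹ ^ k) with ha
  have ha0 : ∀ k, 0 ≤ a k := fun k =>
    mul_nonneg hR.const_nonneg (mul_nonneg (by positivity) (pow_nonneg H.inv_nonneg k))
  have has : Summable a :=
    ((summable_geometric_of_lt_one H.inv_nonneg H.inv_lt_one).mul_left _).mul_left _
  have hpt : ∀ k, C * ‖M.point (shiftTwo^[k] ω') - M.point (shiftTwo^[k] ω)‖ ≤ a k := fun k =>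
    mul_le_mul_of_nonneg_left (H.norm_point_sub_le hf k) hR.const_nonneg
  have hE : ∀ k, M.point (shiftTwo^[k] ω') ∈ M.E ((shiftTwo^[k] ω) 0) := fun k => by
    rw [← h0]; exact H.point_mem_E _
  set d : ℕ → ℝ := fun k =>
    |M.unstableSlope (shiftTwo^[k] ω') - M.unstableSlope (shiftTwo^[k] ω)| with hd
  have hds : Summable d := by
    refine summable_of_contraction hR.lt_one (fun k => abs_nonneg _) ha0 has fun k => ?_
    simp only [hd]
    rw [Function.iterate_succ_apply', Function.iterate_succ_apply', H.slope_shift hR,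
      H.slope_shift hR, h0]
    refine (hR.slope _ _ (H.point_mem_E _) _ (hE k) _ _ (H.abs_unstableSlope_le hR _)
      (H.abs_unstableSlope_le hR _)).trans ?_
    linarith [hpt k]
  refine Summable.of_norm_bounded (g := fun k => C * d k + a k) ((hds.mul_left C).add has)
    fun k => ?_
  rw [H.phi_eq hR, H.phi_eq hR, h0, Real.norm_eq_abs, neg_sub_neg]
  refine (hR.rate _ _ (H.point_mem_E _) _ (hE k) _ _ (H.abs_unstableSlope_le hR _)
      (H.abs_unstableSlope_le hR _)).trans ?_
  linarith [hpt k]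

theorem summable_transferTerm (H : M.IsHyperbolicModel α K₀) (hR : M.IsRegular α θ C)
    (p : ℕ → ι) (ω : ℤ → ι) : Summable (M.transferTerm p ω) :=
  H.summable_phi_sub hR (ω' := joinSeq p (future ω)) rfl

/-- The term `k` of `u (F z)` is paired with the term `k + 1` of `u z`, and the term `0` of `u z`
with `φ z`. What survives involves `ω` only through its future. -/
theorem psi_eq_tsum (H : M.IsHyperbolicModel α K₀) (hR : M.IsRegular α θ C) (p : ℕ → ι)
    (ω : ℤ → ι) : M.psi p ω = M.phi (joinSeq p (future ω)) +
      ∑' k, (M.phi (shiftTwo^[k + 1] (joinSeq p (future ω))) -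
        M.phi (shiftTwo^[k] (joinSeq p (shiftOne (future ω))))) := by
  have s1 := H.summable_transferTerm hR p ω
  have s2 := H.summable_transferTerm hR p (shiftTwo ω)
  have s3 := (summable_nat_add_iff 1).2 s1
  rw [psi, transfer, transfer, s1.tsum_eq_zero_add]
  have e := s2.tsum_sub s3
  have e2 : ∀ k, M.transferTerm p (shiftTwo ω) k - M.transferTerm p ω (k + 1) =
      M.phi (shiftTwo^[k + 1] (joinSeq p (future ω))) -
        M.phi (shiftTwo^[k] (joinSeq p (shiftOne (future ω)))) := fun k => by
    rw [transferTerm, transferTerm, future_shiftTwo, Function.iterate_succ_apply]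
    ring
  simp only [e2] at e
  rw [e]
  simp only [transferTerm, Function.iterate_zero, id]
  ring

theorem psi_eq_phiU (H : M.IsHyperbolicModel α K₀) (hR : M.IsRegular α θ C) (p : ℕ → ι)
    (ω : ℤ → ι) : M.psi p ω = M.phiU p (future ω) := by
  rw [phiU, H.psi_eq_tsum hR, H.psi_eq_tsum hR]; rfl

/-- The Birkhoff sums of `φᵘ` and of `φ` along a periodic orbit agree. -/
theorem sum_phiU_eq (H : M.IsHyperbolicModel α K₀) (hR : M.IsRegular α θ C) (p : ℕ → ι)
    {n : ℕ} {ω : ℤ → ι} (hω : shiftTwo^[n] ω = ω) :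
    ∑ k ∈ Finset.range n, M.phiU p (shiftOne^[k] (future ω)) =
      ∑ k ∈ Finset.range n, M.phi (shiftTwo^[k] ω) := by
  have h : ∀ k, M.phiU p (shiftOne^[k] (future ω)) = M.phi (shiftTwo^[k] ω) +
      (M.transfer p (shiftTwo^[k + 1] ω) - M.transfer p (shiftTwo^[k] ω)) := fun k => by
    rw [← future_shiftTwo_iterate, ← H.psi_eq_phiU hR, psi, Function.iterate_succ_apply']
    ring
  simp only [h]
  rw [Finset.sum_add_distrib, Finset.sum_range_sub fun k => M.transfer p (shiftTwo^[k] ω), hω]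
  simp

end IsHyperbolicModel

end PiecewiseMap

/-! ### Bounded distortion of cylinders. -/

namespace PiecewiseMap

variable {ι : Type*} {M : PiecewiseMap ι} {α K₀ C₀ θ C : ℝ}

theorem iter_succ' (M : PiecewiseMap ι) (k : ℕ) (x : ℕ → ι) (z : ℝ × ℝ) :
    M.iter (k + 1) x z = M.f (x k) (M.iter k x z) := by
  induction k generalizing x z with
  | zero => rfl
  | succ k ih => rw [iter, ih]; rfl

theorem iter_mem_cylE (M : PiecewiseMap ι) {k m : ℕ} {x : ℕ → ι} {z : ℝ × ℝ}
    (hz : z ∈ M.cylE (k + m) x) : M.iter k x z ∈ M.cylE m (shiftOne^[k] x) := by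
  induction k generalizing x z with
  | zero => rw [Nat.zero_add] at hz; exact hz
  | succ k ih =>
    rw [show k + 1 + m = k + m + 1 by omega] at hz
    exact ih hz.2

namespace IsHyperbolicModel

theorem iter_mem_E {k n : ℕ} (hk : k < n) {x : ℕ → ι} {z : ℝ × ℝ}
    (hz : z ∈ M.cylE n x) : M.iter k x z ∈ M.E (x k) := by
  obtain ⟨m, rfl⟩ : ∃ m, n = k + (m + 1) := ⟨n - k - 1, by omega⟩
  have := (M.iter_mem_cylE hz).1
  rwa [shiftOne_iterate_apply, zero_add] at this

theorem iter_mem_cylS (H : M.IsHyperbolicModel α K₀) {k n : ℕ} (hk : k ≤ n) {ω : ℤ → ι}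
    {z : ℝ × ℝ} (hz : z ∈ M.cylE n (future ω)) :
    M.iter k (future ω) z ∈ M.cylS k (past (shiftTwo^[k] ω)) := by
  induction k with
  | zero => exact H.cylE_subset_square n _ hz
  | succ k ih =>
    have h0 : (shiftTwo^[k] ω) 0 = future ω k := by
      rw [shiftTwo_iterate_apply, zero_add]; rfl
    rw [Function.iterate_succ_apply', cylS, shiftOne_past, past_shiftTwo_zero, iter_succ', h0]
    exact mem_image_of_mem _ ⟨ih (by omega), iter_mem_E (by omega) hz⟩

/-- The orbit of a point of a cylinder shadows the orbit of any coded point with this itinerary. -/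
theorem norm_iter_sub_point_le (H : M.IsHyperbolicModel α K₀) {k n : ℕ} (hk : k ≤ n) {ω : ℤ → ι}
    {z : ℝ × ℝ} (hz : z ∈ M.cylE n (future ω)) :
    ‖M.iter k (future ω) z - M.point (shiftTwo^[k] ω)‖ ≤
      1 / (1 - α ^ 2) * (K₀⁻¹ ^ k + K₀⁻¹ ^ (n - k)) := by
  have hα := H.one_sub_sq_pos
  have h1 := H.point_mem (shiftTwo^[k] ω)
  have hE : M.iter k (future ω) z ∈ M.cylE (n - k) (shiftOne^[k] (future ω)) :=
    M.iter_mem_cylE (by rwa [Nat.add_sub_cancel' hk])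
  -- At time `k` the two points share `k` past symbols, which controls the vertical difference, and
  -- `n - k` future symbols, which controls the horizontal one.
  have a2 := H.abs_snd_sub_le (H.iter_mem_cylS hk hz) (mem_iInter.1 h1.1 k)
  rw [future_shiftTwo_iterate] at h1
  have a1 := H.abs_fst_sub_le hE (mem_iInter.1 h1.2 (n - k))
  have p1 := pow_nonneg H.inv_nonneg k
  have p2 := pow_nonneg H.inv_nonneg (n - k)
  have q1 := mul_le_of_le_one_left p1 H.lt_one.le
  have q2 := mul_le_of_le_one_left p2 H.lt_one.le
  have b1 := mul_le_mul_of_nonneg_left a1 H.pos.le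
  have b2 := mul_le_mul_of_nonneg_left a2 H.pos.le
  rw [Prod.norm_def, div_mul_eq_mul_div, one_mul]
  refine max_le ?_ ?_
  · rw [le_div_iff₀ hα, Real.norm_eq_abs, Prod.fst_sub]
    linarith
  · rw [le_div_iff₀ hα, Real.norm_eq_abs, Prod.snd_sub]
    linarith

theorem geom_sum_le (H : M.IsHyperbolicModel α K₀) (n : ℕ) :
    ∑ k ∈ Finset.range n, (K₀⁻¹ ^ k + K₀⁻¹ ^ (n - k)) ≤ 2 / (1 - K₀⁻¹) := by
  have h1 := H.inv_nonneg
  have h2 := H.inv_lt_one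
  have g : ∑ k ∈ Finset.range n, K₀⁻¹ ^ k ≤ (1 - K₀⁻¹)⁻¹ := by
    rw [← tsum_geometric_of_lt_one h1 h2]
    exact (summable_geometric_of_lt_one h1 h2).sum_le_tsum _ fun k _ => pow_nonneg h1 k
  have g2 : ∑ k ∈ Finset.range n, K₀⁻¹ ^ (n - k) ≤ ∑ k ∈ Finset.range n, K₀⁻¹ ^ k := by
    rw [← Finset.sum_range_reflect (fun k => K₀⁻¹ ^ k)]
    refine Finset.sum_le_sum fun k hk => pow_le_pow_of_le_one h1 h2.le ?_
    have := Finset.mem_range.1 hk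
    omega
  rw [Finset.sum_add_distrib, div_eq_mul_inv]
  linarith

/-- Bounded distortion: the width of a cylinder is comparable with the reciprocal of the unstable
derivative at any coded point with this itinerary. -/
theorem exists_distortion (H : M.IsHyperbolicModel α K₀) (hR : M.IsRegular α θ C) :
    ∃ D, ∀ (n : ℕ) (ω : ℤ → ι), ∃ l r, IsVStrip α l r (M.cylE n (future ω)) ∧
      ∀ y ∈ Icc (0 : ℝ) 1,
        |Real.log (r y - l y) - ∑ k ∈ Finset.range n, M.phi (shiftTwo^[k] ω)| ≤ D := by
  have hα := H.one_sub_sq_pos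
  have hθ := sub_pos.2 hR.lt_one
  -- `G` bounds the total shadowing error over the orbit, uniformly in `n`. Below, `(2 + G) / (1 -
  -- θ)` bounds the total slope error, the `2` coming from the initial slopes.
  set G := C * (1 / (1 - α ^ 2) * (2 / (1 - K₀⁻¹))) with hG
  refine ⟨C * ((2 + G) / (1 - θ)) + G, fun n ω => ?_⟩
  obtain ⟨l, r, h, he⟩ := H.cylE_strip n (future ω)
  refine ⟨l, r, h, fun y hy => ?_⟩
  set x := future ω with hx
  set Z : ℕ → ℝ × ℝ := fun k => M.iter k x (l y, y) with hZ
  set W : ℕ → ℝ × ℝ := fun k => M.iter k x (r y, y) with hW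
  have hZE : ∀ k < n, Z k ∈ M.E (x k) := fun k hk => iter_mem_E hk (h.left_mem hy)
  have hWE : ∀ k < n, W k ∈ M.E (x k) := fun k hk => iter_mem_E hk (h.right_mem hy)
  have hZs : ∀ k, Z (k + 1) = M.f (x k) (Z k) := fun k => iter_succ' _ _ _ _
  have hWs : ∀ k, W (k + 1) = M.f (x k) (W k) := fun k => iter_succ' _ _ _ _
  have hlr := h.lt y hy
  have hrel : ∀ k ≤ n, (W k).1 ≠ (Z k).1 ∧ |(W k).2 - (Z k).2| ≤ α * |(W k).1 - (Z k).1| := by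
    intro k
    induction k with
    | zero =>
      intro _
      refine ⟨hlr.ne', ?_⟩
      simpa [hZ, hW, iter] using mul_nonneg H.pos.le (abs_nonneg _)
    | succ k ih =>
      intro hk
      obtain ⟨h1, h2⟩ := ih (by omega)
      obtain ⟨h3, h4⟩ := H.cone_expand (hZE k (by omega)) (hWE k (by omega)) h2
      rw [hZs, hWs]
      refine ⟨fun h0 => ?_, h3⟩
      rw [h0, sub_self, abs_zero] at h4
      exact absurd h4 (not_le.2 (mul_pos (zero_lt_one.trans H.one_lt)
        (abs_pos.2 (sub_ne_zero.2 h1))))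
  -- The slopes `c` of the chords joining the images of the two end points are compared with the
  -- tangent slopes `s` at the shadowed coded points; both evolve by the slope map.
  set c : ℕ → ℝ := fun k => ((W k).2 - (Z k).2) / ((W k).1 - (Z k).1) with hc
  set s : ℕ → ℝ := fun k => M.unstableSlope (shiftTwo^[k] ω) with hs
  set P : ℕ → ℝ × ℝ := fun k => M.point (shiftTwo^[k] ω) with hP
  have hsα : ∀ k, |s k| ≤ α := fun k => H.abs_unstableSlope_le hR _
  have h0 : ∀ k : ℕ, (shiftTwo^[k] ω) 0 = x k := fun k => by
    rw [shiftTwo_iterate_apply, zero_add]; rfl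
  have hPE : ∀ k, P k ∈ M.E (x k) := fun k => by rw [← h0]; exact H.point_mem_E _
  have hss : ∀ k, s (k + 1) = slopeMap (M.f (x k)) (P k) (s k) := fun k => by
    simp only [hs, hP]
    rw [Function.iterate_succ_apply', H.slope_shift hR, h0]
  have hcα : ∀ k ≤ n, |c k| ≤ α := fun k hk => by
    obtain ⟨h1, h2⟩ := hrel k hk
    rw [hc, abs_div, div_le_iff₀ (abs_pos.2 (sub_ne_zero.2 h1))]
    exact h2
  set a : ℕ → ℝ := fun k => C * (1 / (1 - α ^ 2) * (K₀⁻¹ ^ k + K₀⁻¹ ^ (n - k))) with ha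
  have hstep : ∀ k < n, ∃ ξ ∈ M.E (x k), ∃ ξ' ∈ M.E (x k), C * ‖ξ - P k‖ ≤ a k ∧
      C * ‖ξ' - P k‖ ≤ a k ∧
      Real.log ((W (k + 1)).1 - (Z (k + 1)).1) - Real.log ((W k).1 - (Z k).1) =
        Real.log (runRate (M.f (x k)) ξ (c k)) ∧
      c (k + 1) = slopeMap (M.f (x k)) ξ' (c k) := by
    intro k hk
    have hne := sub_ne_zero.2 (hrel k hk.le).1
    have hne' := sub_ne_zero.2 (hrel (k + 1) hk).1
    obtain ⟨hseg, ⟨ξ, hξ, e1⟩, ξ', hξ', e2⟩ := H.exists_chord (hZE k hk) (hWE k hk) (hcα k hk.le)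
      (by simp only [hc]; field_simp)
    have hball : segment ℝ (Z k) (W k) ⊆
        Metric.closedBall (P k) (1 / (1 - α ^ 2) * (K₀⁻¹ ^ k + K₀⁻¹ ^ (n - k))) := by
      refine (convex_closedBall _ _).segment_subset ?_ ?_ <;>
        rw [Metric.mem_closedBall, dist_eq_norm]
      · exact H.norm_iter_sub_point_le hk.le (h.left_mem hy)
      · exact H.norm_iter_sub_point_le hk.le (h.right_mem hy)
    have hb : ∀ ξ ∈ segment ℝ (Z k) (W k), C * ‖ξ - P k‖ ≤ a k := fun ξ hξ =>
      mul_le_mul_of_nonneg_left (by rw [← dist_eq_norm]; exact hball hξ) hR.const_nonneg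
    rw [← hZs, ← hWs] at e1 e2
    refine ⟨ξ, hseg hξ, ξ', hseg hξ', hb ξ hξ, hb ξ' hξ', ?_, ?_⟩
    · rw [e1, Real.log_mul (H.runRate_ne_zero (hseg hξ) (hcα k hk.le)) hne, add_sub_cancel_right]
    · rw [hc]
      simp only
      rw [e2, mul_div_assoc, div_self hne', mul_one]
  have hasum : ∑ k ∈ Finset.range n, a k ≤ G := by
    rw [ha, ← Finset.mul_sum, ← Finset.mul_sum]
    exact mul_le_mul_of_nonneg_left (mul_le_mul_of_nonneg_left (H.geom_sum_le n) (by positivity))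
      hR.const_nonneg
  have hd : ∑ k ∈ Finset.range n, |c k - s k| ≤ (2 + G) / (1 - θ) := by
    refine (sum_le_of_contraction (a := a) hR.lt_one n (fun k => abs_nonneg (c k - s k))
      fun k hk => ?_).trans ?_
    · obtain ⟨ξ, -, ξ', hξ', -, hle, -, e⟩ := hstep k hk
      rw [e, hss]
      exact (hR.slope _ _ (hPE k) _ hξ' _ _ (hsα k) (hcα k hk.le)).trans (by linarith)
    · have := abs_sub (c 0) (s 0)
      have := hcα 0 (Nat.zero_le n)
      have := hsα 0
      have := H.lt_one
      gcongr
      linarith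
  have htel : ∑ k ∈ Finset.range n,
      (Real.log ((W (k + 1)).1 - (Z (k + 1)).1) - Real.log ((W k).1 - (Z k).1)) =
      -Real.log (r y - l y) := by
    rw [Finset.sum_range_sub fun k => Real.log ((W k).1 - (Z k).1)]
    -- After `n` steps the end points lie on opposite vertical sides of the square, at horizontal
    -- distance one.
    have hn : Real.log ((W n).1 - (Z n).1) = 0 := by
      obtain ⟨h1, h2⟩ := he y hy
      have h3 := (hrel n le_rfl).1
      change (Z n).1 ∈ _ at h1
      change (W n).1 ∈ _ at h2
      rcases h1 with h1 | h1 <;> rcases h2 with h2 | h2 <;> rw [h1, h2] at h3 ⊢ <;> simp at h3 ⊢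
    rw [hn, zero_sub]; rfl
  rw [← neg_neg (Real.log (r y - l y)), ← htel, ← Finset.sum_neg_distrib, ← Finset.sum_sub_distrib]
  refine (Finset.abs_sum_le_sum_abs _ _).trans ?_
  calc _ ≤ ∑ k ∈ Finset.range n, (C * |c k - s k| + a k) := by
        refine Finset.sum_le_sum fun k hk => ?_
        have hk := Finset.mem_range.1 hk
        obtain ⟨ξ, hξ, ξ', -, hle, -, e, -⟩ := hstep k hk
        rw [e, H.phi_eq hR, h0, neg_sub_neg, abs_sub_comm]
        exact (hR.rate _ _ (hPE k) _ hξ _ _ (hsα k) (hcα k hk.le)).trans (by linarith)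
    _ = C * ∑ k ∈ Finset.range n, |c k - s k| + ∑ k ∈ Finset.range n, a k := by
        rw [Finset.sum_add_distrib, Finset.mul_sum]
    _ ≤ _ := add_le_add (mul_le_mul_of_nonneg_left hd hR.const_nonneg) hasum

end IsHyperbolicModel

end PiecewiseMap

/-! ### Areas of strips, and periodic sequences. -/

namespace IsVStrip

variable {α : ℝ} {l r : ℝ → ℝ} {E : Set (ℝ × ℝ)}

theorem section_eq (h : IsVStrip α l r E) {y : ℝ} (hy : y ∈ Icc (0 : ℝ) 1) :
    (fun x => (x, y)) ⁻¹' E = Icc (l y) (r y) := by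
  ext x
  rw [mem_preimage, h.mem_iff]
  exact ⟨fun h => h.2, fun h => ⟨hy, h⟩⟩

theorem section_eq_empty (h : IsVStrip α l r E) {y : ℝ} (hy : y ∉ Icc (0 : ℝ) 1) :
    (fun x => (x, y)) ⁻¹' E = ∅ := by
  ext x
  rw [mem_preimage, h.mem_iff]
  exact ⟨fun h => hy h.1, fun h => h.elim⟩

/-- The area of a strip is bounded by its extremal widths. -/
theorem volume_bounds (h : IsVStrip α l r E) {a b : ℝ}
    (hab : ∀ y ∈ Icc (0 : ℝ) 1, a ≤ r y - l y ∧ r y - l y ≤ b) :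
    ENNReal.ofReal a ≤ volume E ∧ volume E ≤ ENNReal.ofReal b := by
  have hc : ∀ c : ℝ≥0∞, ∫⁻ y : ℝ, (Icc (0 : ℝ) 1).indicator (fun _ => c) y = c := fun c => by
    rw [lintegral_indicator_const measurableSet_Icc]; simp
  rw [Measure.volume_eq_prod, Measure.prod_apply_symm h.isClosed.measurableSet,
    ← hc (ENNReal.ofReal a), ← hc (ENNReal.ofReal b)]
  constructor <;> refine lintegral_mono fun y => ?_ <;> by_cases hy : y ∈ Icc (0 : ℝ) 1
  · rw [indicator_of_mem hy, h.section_eq hy, Real.volume_Icc]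
    exact ENNReal.ofReal_le_ofReal (hab y hy).1
  · rw [indicator_of_notMem hy]; exact zero_le
  · rw [indicator_of_mem hy, h.section_eq hy, Real.volume_Icc]
    exact ENNReal.ofReal_le_ofReal (hab y hy).2
  · rw [indicator_of_notMem hy, h.section_eq_empty hy, measure_empty]

theorem mem_interior (h : IsVStrip α l r E) {z : ℝ × ℝ} (hz : z.2 ∈ Ioo (0 : ℝ) 1)
    (h1 : l z.2 < z.1) (h2 : z.1 < r z.2) : z ∈ interior E := by
  rw [mem_interior_iff_mem_nhds]
  have hn := Icc_mem_nhds hz.1 hz.2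
  have hl := (h.continuousOn_left.continuousAt hn).comp (continuous_snd.continuousAt (x := z))
  have hr := (h.continuousOn_right.continuousAt hn).comp (continuous_snd.continuousAt (x := z))
  filter_upwards [continuous_snd.continuousAt.preimage_mem_nhds hn,
    hl.eventually_lt continuous_fst.continuousAt h1,
    continuous_fst.continuousAt.eventually_lt hr h2] with w w1 w2 w3
  exact h.mem_iff.2 ⟨w1, le_of_lt w2, le_of_lt w3⟩

/-- By Fubini: off the heights `0` and `1`, a horizontal section of the difference contains at most
the two end points. -/
theorem volume_diff_interior (h : IsVStrip α l r E) : volume (E \ interior E) = 0 := by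
  rw [Measure.volume_eq_prod, Measure.prod_apply_symm
    (h.isClosed.measurableSet.diff isOpen_interior.measurableSet)]
  refine lintegral_eq_zero_of_ae_eq_zero ?_
  have h0 : ∀ᵐ y : ℝ, y ∉ ({0, 1} : Set ℝ) := (Set.toFinite _).countable.ae_notMem volume
  filter_upwards [h0] with y hy
  simp only [mem_insert_iff, mem_singleton_iff, not_or] at hy
  refine measure_mono_null (t := {l y, r y}) ?_ ((Set.toFinite _).measure_zero _)
  rintro x ⟨hx, hx'⟩
  obtain ⟨h1, h2, h3⟩ := h.mem_iff.1 hx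
  simp only at h1 h2 h3
  by_contra hne
  simp only [mem_insert_iff, mem_singleton_iff, not_or] at hne
  exact hx' (h.mem_interior (z := (x, y)) ⟨lt_of_le_of_ne h1.1 (Ne.symm hy.1),
    lt_of_le_of_ne h1.2 hy.2⟩ (lt_of_le_of_ne h2 (Ne.symm hne.1)) (lt_of_le_of_ne h3 hne.2))

end IsVStrip

theorem volume_unitSquare : volume unitSquare = 1 := by
  rw [unitSquare, Measure.volume_eq_prod, Measure.prod_prod]
  simp

/-- The two-sided periodic sequence of period `n` whose first symbols are those of `x`. -/
def periodicExtension {ι : Type*} (n : ℕ) (x : ℕ → ι) : ℤ → ι := fun j => x (j % n).toNat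

section Sequences

variable {ι : Type*}

theorem shiftTwo_iterate_periodicExtension (n : ℕ) (x : ℕ → ι) :
    shiftTwo^[n] (periodicExtension n x) = periodicExtension n x := by
  funext j
  rw [shiftTwo_iterate_apply, periodicExtension, periodicExtension, Int.add_emod_right]

theorem periodicExtension_natCast {n : ℕ} (x : ℕ → ι) (j : ℕ) :
    future (periodicExtension n x) j = x (j % n) := by
  rw [future, periodicExtension]; congr 1

theorem apply_mod_of_periodic {n : ℕ} {x : ℕ → ι} (h : shiftOne^[n] x = x) (j : ℕ) :
    x (j % n) = x j := by
  have h1 : ∀ m j, x (j + n * m) = x j := by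
    intro m
    induction m with
    | zero => simp
    | succ m ih =>
      intro j
      rw [Nat.mul_succ, ← add_assoc, ← shiftOne_iterate_apply n x, h, ih]
  conv_rhs => rw [← Nat.mod_add_div j n, h1]

theorem future_periodicExtension {n : ℕ} {x : ℕ → ι} (h : shiftOne^[n] x = x) :
    future (periodicExtension n x) = x := by
  funext j
  rw [periodicExtension_natCast, apply_mod_of_periodic h]

theorem shiftOne_iterate_future_periodicExtension (n : ℕ) (x : ℕ → ι) :
    shiftOne^[n] (future (periodicExtension n x)) = future (periodicExtension n x) := by
  rw [← future_shiftTwo_iterate, shiftTwo_iterate_periodicExtension]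

theorem eq_of_periodic {n : ℕ} (hn : 0 < n) {x x' : ℕ → ι} (h : shiftOne^[n] x = x)
    (h' : shiftOne^[n] x' = x') (heq : ∀ j < n, x j = x' j) : x = x' := by
  funext j
  rw [← apply_mod_of_periodic h, ← apply_mod_of_periodic h', heq _ (Nat.mod_lt _ hn)]

theorem countable_periodic [Countable ι] {n : ℕ} (hn : 0 < n) (a : ι) :
    Countable {x : ℕ → ι // shiftOne^[n] x = x ∧ x 0 = a} := by
  refine Function.Injective.countable (β := Fin n → ι)
    (f := fun x j => x.1 j) fun x x' h => Subtype.ext ?_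
  exact eq_of_periodic hn x.2.1 x'.2.1 fun j hj => congrFun h ⟨j, hj⟩

end Sequences

/-! ### Cylinders tile the square up to null sets; bounds for the partition sums. -/

namespace PiecewiseMap

variable {ι : Type*} {M : PiecewiseMap ι} {α K₀ C₀ θ C : ℝ}

namespace IsHyperbolicModel

/-- The set is contained in the image of a null set under the differentiable inverse branch. -/
theorem volume_preimage_eq_zero (H : M.IsHyperbolicModel α K₀) (i : ι) {N : Set (ℝ × ℝ)}
    (hN : volume N = 0) : volume (M.E i ∩ M.f i ⁻¹' N) = 0 := by
  have hd : DifferentiableOn ℝ (M.f i).symm (N ∩ (M.f i).target) :=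
    ((H.model.contDiffOn_symm i).differentiableOn (by norm_num)).mono inter_subset_right
  refine measure_mono_null ?_ (addHaar_image_eq_zero_of_differentiableOn_of_addHaar_eq_zero volume
    hd (measure_mono_null inter_subset_left hN))
  rintro z ⟨hz, hzN⟩
  have hs := H.mem_source hz
  exact ⟨M.f i z, ⟨hzN, (M.f i).map_source hs⟩, (M.f i).left_inv hs⟩

theorem volume_inter_E (H : M.IsHyperbolicModel α K₀) (hG : M.Geometric) {i j : ι} (hij : i ≠ j) :
    volume (M.E i ∩ M.E j) = 0 := by
  obtain ⟨l, r, h⟩ := H.exists_strip i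
  obtain ⟨l', r', h'⟩ := H.exists_strip j
  refine measure_mono_null ?_ (measure_union_null h.volume_diff_interior h'.volume_diff_interior)
  rintro z ⟨hz, hz'⟩
  by_cases hi : z ∈ interior (M.E i)
  · refine Or.inr ⟨hz', fun hj => ?_⟩
    have : z ∈ interior (M.E i) ∩ interior (M.E j) := ⟨hi, hj⟩
    rw [hG.disjoint_E i j hij] at this
    exact this
  · exact Or.inl ⟨hz, hi⟩

theorem volume_inter_cylE (H : M.IsHyperbolicModel α K₀) (hG : M.Geometric) (n : ℕ) {x x' : ℕ → ι}
    (h : ∃ j < n, x j ≠ x' j) : volume (M.cylE n x ∩ M.cylE n x') = 0 := by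
  induction n generalizing x x' with
  | zero => obtain ⟨j, hj, -⟩ := h; omega
  | succ n ih =>
    by_cases h0 : x 0 = x' 0
    · obtain ⟨j, hj, hne⟩ := h
      cases j with
      | zero => exact absurd h0 hne
      | succ j =>
        have := H.volume_preimage_eq_zero (x 0)
          (ih (x := shiftOne x) (x' := shiftOne x') ⟨j, by omega, hne⟩)
        refine measure_mono_null ?_ this
        rintro z ⟨⟨h1, h2⟩, -, h4⟩
        rw [← h0] at h4
        exact ⟨h1, h2, h4⟩
    · exact measure_mono_null (inter_subset_inter inter_subset_left inter_subset_left)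
        (H.volume_inter_E hG h0)

theorem image_mem_unitSquare (H : M.IsHyperbolicModel α K₀) {i : ι} {z : ℝ × ℝ}
    (hz : z ∈ M.E i) : M.f i z ∈ unitSquare := H.image_mem_square hz

/-- Almost every point of `E a` has an itinerary of length `n + 1`, starting with `a`. -/
theorem volume_diff_cylE (H : M.IsHyperbolicModel α K₀) (hG : M.Geometric) [Countable ι] (n : ℕ) :
    (∀ a : ι, volume (M.E a \ ⋃ x ∈ {x : ℕ → ι | x 0 = a}, M.cylE (n + 1) x) = 0) ∧
      volume (unitSquare \ ⋃ x, M.cylE (n + 1) x) = 0 := by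
  have glob : ∀ n, (∀ a : ι, volume (M.E a \ ⋃ x ∈ {x : ℕ → ι | x 0 = a}, M.cylE (n + 1) x) = 0) →
      volume (unitSquare \ ⋃ x, M.cylE (n + 1) x) = 0 := by
    intro n hn
    refine measure_mono_null ?_ (measure_union_null hG.full_measure (measure_iUnion_null hn))
    rintro z ⟨hz, hz'⟩
    by_cases hi : z ∈ ⋃ i, interior (M.E i)
    · obtain ⟨i, hi⟩ := mem_iUnion.1 hi
      refine Or.inr (mem_iUnion.2 ⟨i, interior_subset hi, fun hx => hz' ?_⟩)
      simp only [mem_iUnion] at hx ⊢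
      obtain ⟨x, -, hx⟩ := hx
      exact ⟨x, hx⟩
    · exact Or.inl ⟨hz, hi⟩
  -- The two statements alternate: the one for the rectangles gives the one for the square by (G2),
  -- which pulled back by a branch gives the next one for the rectangles.
  have loc : ∀ n, (∀ a : ι, volume (M.E a \ ⋃ x ∈ {x : ℕ → ι | x 0 = a}, M.cylE (n + 1) x) = 0) := by
    intro n
    induction n with
    | zero =>
      intro a
      refine measure_mono_null (t := ∅) ?_ measure_empty
      rintro z ⟨hz, hz'⟩
      exact hz' (mem_iUnion₂.2 ⟨fun _ => a, rfl, hz, H.image_mem_unitSquare hz⟩)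
    | succ n ih =>
      intro a
      refine measure_mono_null ?_ (H.volume_preimage_eq_zero a (glob n ih))
      rintro z ⟨hz, hz'⟩
      refine ⟨hz, H.image_mem_unitSquare hz, fun hx => hz' ?_⟩
      obtain ⟨x, hx⟩ := mem_iUnion.1 hx
      obtain ⟨w, rfl, rfl⟩ : ∃ w : ℕ → ι, w 0 = a ∧ shiftOne w = x :=
        ⟨fun k => Nat.casesOn k a x, rfl, rfl⟩
      exact mem_iUnion₂.2 ⟨w, rfl, hz, hx⟩
  exact ⟨loc n, glob n (loc n)⟩

/-- A cylinder of length `n` sees only `n` symbols, so every itinerary may be replaced by the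
periodic one with the same initial word. -/
theorem volume_E_le_tsum (H : M.IsHyperbolicModel α K₀) (hG : M.Geometric) [Countable ι] {n : ℕ}
    (hn : 0 < n) (a : ι) : volume (M.E a) ≤
      ∑' x : {x : ℕ → ι // shiftOne^[n] x = x ∧ x 0 = a}, volume (M.cylE n x.1) := by
  obtain ⟨m, rfl⟩ : ∃ m, n = m + 1 := ⟨n - 1, by omega⟩
  have := countable_periodic hn a
  refine le_trans ?_ (measure_iUnion_le _)
  have h0 := (H.volume_diff_cylE hG m).1 a
  refine (measure_le_inter_add_sdiff volume (M.E a)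
    (⋃ x ∈ {x : ℕ → ι | x 0 = a}, M.cylE (m + 1) x)).trans ?_
  rw [h0, add_zero]
  refine measure_mono ?_
  rintro z ⟨-, hz⟩
  obtain ⟨x, hx0, hx⟩ := mem_iUnion₂.1 hz
  have hcong : ∀ j < m + 1, x j = future (periodicExtension (m + 1) x) j := fun j hj => by
    rw [periodicExtension_natCast, Nat.mod_eq_of_lt hj]
  refine mem_iUnion.2 ⟨⟨future (periodicExtension (m + 1) x),
    shiftOne_iterate_future_periodicExtension _ _, ?_⟩, ?_⟩
  · rw [← hcong 0 hn]; exact hx0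
  · rwa [M.cylE_congr hcong] at hx

theorem tsum_volume_le (H : M.IsHyperbolicModel α K₀) (hG : M.Geometric) [Countable ι] {n : ℕ}
    (hn : 0 < n) (a : ι) :
    ∑' x : {x : ℕ → ι // shiftOne^[n] x = x ∧ x 0 = a}, volume (M.cylE n x.1) ≤ 1 := by
  have := countable_periodic hn a
  rw [← measure_iUnion₀]
  · rw [← volume_unitSquare]
    exact measure_mono (iUnion_subset fun x => H.cylE_subset_square n x.1)
  · intro x x' hne
    refine H.volume_inter_cylE hG n ?_
    by_contra! hcon
    exact hne (Subtype.ext (eq_of_periodic hn x.2.1 x'.2.1 hcon))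
  · exact fun x => (H.cylE_isCompact n x.1).isClosed.measurableSet.nullMeasurableSet

/-- The partition sums are bounded from above and away from zero. -/
theorem partitionSum_bounds (H : M.IsHyperbolicModel α K₀) (hR : M.IsRegular α θ C)
    (hG : M.Geometric) [Countable ι] (p : ℕ → ι) (a : ι) :
    ∃ A B : ℝ, ∀ n, 0 < n → ENNReal.ofReal (Real.exp A) ≤ partitionSum (M.phiU p) n a ∧
      partitionSum (M.phiU p) n a ≤ ENNReal.ofReal (Real.exp B) := by
  obtain ⟨D, hD⟩ := H.exists_distortion hR
  -- The square has height one, so bounds on the widths of a strip are bounds on its area.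
  have hvol : ∀ n (ω : ℤ → ι),
      ENNReal.ofReal (Real.exp (-D + ∑ k ∈ Finset.range n, M.phi (shiftTwo^[k] ω))) ≤
        volume (M.cylE n (future ω)) ∧ volume (M.cylE n (future ω)) ≤
      ENNReal.ofReal (Real.exp (D + ∑ k ∈ Finset.range n, M.phi (shiftTwo^[k] ω))) := by
    intro n ω
    obtain ⟨l, r, h, hlr⟩ := hD n ω
    refine h.volume_bounds fun y hy => ?_
    have hpos := sub_pos.2 (h.lt y hy)
    have := abs_le.1 (hlr y hy)
    rw [← Real.le_log_iff_exp_le hpos, ← Real.log_le_iff_le_exp hpos]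
    constructor <;> linarith
  have hterm : ∀ n (x : {x : ℕ → ι // shiftOne^[n] x = x ∧ x 0 = a}),
      ENNReal.ofReal (Real.exp (-D)) * volume (M.cylE n x.1) ≤
        ENNReal.ofReal (Real.exp (∑ k ∈ Finset.range n, M.phiU p (shiftOne^[k] x.1))) ∧
      ENNReal.ofReal (Real.exp (∑ k ∈ Finset.range n, M.phiU p (shiftOne^[k] x.1))) ≤
        ENNReal.ofReal (Real.exp D) * volume (M.cylE n x.1) := by
    intro n x
    have hx := future_periodicExtension x.2.1
    have hs := H.sum_phiU_eq hR p (shiftTwo_iterate_periodicExtension n x.1)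
    obtain ⟨h1, h2⟩ := hvol n (periodicExtension n x.1)
    rw [← hs, hx] at h1 h2
    set S := ∑ k ∈ Finset.range n, M.phiU p (shiftOne^[k] x.1)
    have e : ∀ u v : ℝ, ENNReal.ofReal (Real.exp u) * ENNReal.ofReal (Real.exp v) =
        ENNReal.ofReal (Real.exp (u + v)) := fun u v => by
      rw [← ENNReal.ofReal_mul (Real.exp_nonneg _), ← Real.exp_add]
    constructor
    · refine (mul_le_mul_right h2 _).trans ?_
      rw [e, neg_add_cancel_left]
    · refine le_trans ?_ (mul_le_mul_right h1 _)
      rw [e, add_neg_cancel_left]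
  -- Any sequence with `ω 0 = a` would do: the distortion bound for `n = 1` gives a positive lower
  -- bound for the area of `E a`.
  set ω : ℤ → ι := fun _ => a
  set w := -D + ∑ k ∈ Finset.range 1, M.phi (shiftTwo^[k] ω) with hw
  have hEa : ENNReal.ofReal (Real.exp w) ≤ volume (M.E a) :=
    (hvol 1 ω).1.trans (measure_mono inter_subset_left)
  refine ⟨-D + w, D, fun n hn => ⟨?_, ?_⟩⟩
  · calc ENNReal.ofReal (Real.exp (-D + w))
        = ENNReal.ofReal (Real.exp (-D)) * ENNReal.ofReal (Real.exp w) := by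
          rw [← ENNReal.ofReal_mul (Real.exp_nonneg _), ← Real.exp_add]
      _ ≤ ENNReal.ofReal (Real.exp (-D)) * ∑' x : {x : ℕ → ι // shiftOne^[n] x = x ∧ x 0 = a},
          volume (M.cylE n x.1) := mul_le_mul_right (hEa.trans (H.volume_E_le_tsum hG hn a)) _
      _ ≤ _ := by
          rw [← ENNReal.tsum_mul_left]
          exact ENNReal.tsum_le_tsum fun x => (hterm n x).1
  · calc partitionSum (M.phiU p) n a
        ≤ ENNReal.ofReal (Real.exp D) * ∑' x : {x : ℕ → ι // shiftOne^[n] x = x ∧ x 0 = a},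
          volume (M.cylE n x.1) := by
          rw [← ENNReal.tsum_mul_left]
          exact ENNReal.tsum_le_tsum fun x => (hterm n x).2
      _ ≤ ENNReal.ofReal (Real.exp D) * 1 := mul_le_mul_right (H.tsum_volume_le hG hn a) _
      _ = _ := mul_one _

end IsHyperbolicModel

end PiecewiseMap

theorem hasGurevichPressure_zero_of_bounds {ι : Type*} {φ : (ℕ → ι) → ℝ}
    (h : ∀ a, ∃ A B : ℝ, ∀ n, 0 < n → ENNReal.ofReal (Real.exp A) ≤ partitionSum φ n a ∧
      partitionSum φ n a ≤ ENNReal.ofReal (Real.exp B)) : HasGurevichPressure φ 0 := by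
  intro a
  obtain ⟨A, B, hAB⟩ := h a
  have hlog : ∀ A : ℝ, ENNReal.log (ENNReal.ofReal (Real.exp A)) = (A : EReal) := fun A => by
    rw [ENNReal.log_ofReal_of_pos (Real.exp_pos A), Real.log_exp]
  have hlim : ∀ A : ℝ, Tendsto (fun n : ℕ => (A : EReal) / (n : EReal)) atTop (𝓝 0) := fun A => by
    have := (continuous_coe_real_ereal.tendsto 0).comp (tendsto_const_div_atTop_nhds_zero_nat A)
    refine this.congr fun n => ?_
    rw [Function.comp_apply, EReal.coe_div]; rfl
  refine tendsto_of_tendsto_of_tendsto_of_le_of_le' (hlim A) (hlim B) ?_ ?_ <;>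
    filter_upwards [eventually_gt_atTop 0] with n hn
  · rw [← hlog A]
    exact EReal.div_le_div_right_of_nonneg (Nat.cast_nonneg' n)
      (ENNReal.log_monotone (hAB n hn).1)
  · rw [← hlog B]
    exact EReal.div_le_div_right_of_nonneg (Nat.cast_nonneg' n)
      (ENNReal.log_monotone (hAB n hn).2)

theorem proposition7p1 {ι : Type*} [Countable ι] (M : PiecewiseMap ι) (α K₀ C₀ : ℝ)
    (hα₀ : 0 < α) (hα₁ : α < 1) (hK₀ : 1 < K₀)
    (hM : M.IsModel α) (hG : M.Geometric) (hH : M.Hyperbolic α K₀) (hD : M.Distortion C₀)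
    -- the past of the fixed unstable manifold
    (p : ℕ → ι) :
    -- the objects that enter the potential are well defined
    (∀ ω : ℤ → ι, ∃! z, z ∈ M.unstableManifold (past ω) ∩ M.stableManifold (future ω)) ∧
    (∀ q : ℕ → ι, ∃ g : ℝ → ℝ, ContDiffOn ℝ 1 g (Icc 0 1) ∧
      M.unstableManifold q = {z | z.1 ∈ Icc (0 : ℝ) 1 ∧ z.2 = g z.1}) ∧
    (∀ ω : ℤ → ι, Summable (M.transferTerm p ω)) ∧
    -- the function `φ - u + u ∘ F` depends only on the future, so it is `φᵘ` on one-sided sequences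
    (∀ ω : ℤ → ι, M.psi p ω = M.phiU p (future ω)) ∧
    -- the pressure of `φᵘ` is zero
    HasGurevichPressure (M.phiU p) 0 := by
  have H : M.IsHyperbolicModel α K₀ := ⟨hα₀, hα₁, hK₀, hM, hH⟩
  have : Nonempty ι := ⟨p 0⟩
  obtain ⟨θ, C, hR⟩ := H.exists_regular hD
  exact ⟨fun ω => H.existsUnique_point (future ω) (past ω),
    fun q => ⟨M.unstableHeight q, H.height_contDiffOn hR q, Set.ext fun z => H.mem_unstable_iff q⟩,
    H.summable_transferTerm hR p, H.psi_eq_phiU hR p,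
    hasGurevichPressure_zero_of_bounds fun a => H.partitionSum_bounds hR hG p a⟩
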